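/- Let $d\ge 0$ be an integer, $D=d+1$, and let $\zeta_+(\nu,\omega)$ ($\nu\in\mathbb C$, $\omega\in\mathbb R$) be a complex-valued function (the generalized zeta function) such that, for some $\omega_+,\omega_->0$ and all $\nu$ with $\operatorname{Re}\nu<1$: $\zeta_+(\nu,\pm\omega)=0$ for $\omega\in[0,\omega_\pm]$, and $\omega\mapsto\zeta_+(\nu,\pm\omega)$ is locally integrable on $[\omega_\pm,\infty)$. Let $\zeta^\pm_k(\nu)$, $k\ge0$, be complex coefficients. For given $\nu$ and $N\ge 0$ consider the condition $$(A^\pm_{\nu,N})\qquad \zeta_+(\nu,\pm\omega)=\sum_{k=0}^N\zeta^\pm_k(\nu)\,\omega^{d-2\nu-k}+O(\omega^{d-2\operatorname{Re}\nu-N-1}),\quad \omega\to+\infty .$$ Let $-\omega_-<\mu<\omega_+$ and put $$\sigma^s_\nu(\mu)=\int_0^\infty(\omega-\mu)^s\zeta_+(\nu,\omega)\,d\omega,\qquad \tau^s_\nu(\mu)=\int_0^\infty(\omega+\mu)^s\zeta_+(\nu,-\omega)\,d\omega$$ for $\operatorname{Re}s<2\operatorname{Re}\nu-d-1$, and by meromorphic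 continuation in $s$ to the right of this half-plane. Let $\eta(z)=(1-2^{1-z})\zeta(z)$, $\eta(1)=\ln 2$. For the Bose--Einstein statistics put $n(x)=1/(e^x-1)$, $\zeta_\ast=\zeta$ (the Riemann zeta function), $l_\ast=-1$; for the Fermi--Dirac statistics put $n(x)=1/(e^x+1)$, $\zeta_\ast=\eta$, $l_\ast=0$. Put $c_l=(-1)^l\zeta_\ast(-l)/\Gamma(l+1)$, where for bosons $c_{-1}$ is understood as a limit, $c_{-1}=1$. For $\beta>0$ let $$I^+_\nu(\beta)=\int_0^\infty\zeta_+(\nu,\omega)\,n(\beta(\omega-\mu))\,d\omega,\qquad I^-_\nu(\beta)=\int_0^\infty\zeta_+(\nu,-\omega)\,n(\beta(\omega+\mu))\,d\omega$$ (particles and antiparticles); the one-loop potential is $$\Omega(\beta)=-\int_0^\infty\big[\zeta_+(0,\omega)\,n(\beta(\omega-\mu))+\zeta_+(0,-\omega)\,n(\beta(\omega+\mu))\big]d\omega .$$ In what follows the upper signs go with $\sigma$ and the lower signs with $\tau$; write $\sigma^{+,s}_\nu=\sigma^s_\nu(\mu)$ and $\sigma^{-,s}_\nu=\tau^s_\nu(\mu)$.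 Then for both statistics and both signs the following holds. 1. (Exact formula.) Let $\operatorname{Re}\nu<1$, $2\nu\notin\mathbb Z$, $N\ge 0$, and let $(A^\pm_{\nu,N})$ hold. Then the integral for $\sigma^{\pm,s}_\nu$ converges absolutely when $\operatorname{Re}s<2\operatorname{Re}\nu-d-1$, and $\sigma^{\pm,s}_\nu$ continues analytically to $\operatorname{Re}s<2\operatorname{Re}\nu-d+N$ without the points $2\nu-d-1+m$, $0\le m\le N$. For every $\beta>0$ the integral $I^\pm_\nu(\beta)$ converges absolutely, and for every $x_0\notin\mathbb Z$ with $2\operatorname{Re}\nu-d-1+N<x_0<2\operatorname{Re}\nu-d+N$ $$I^\pm_\nu(\beta)=\sum_{m=0}^N\beta^{m+2\nu-D}\zeta_\ast(D-2\nu-m)\sum_{n=0}^m\Gamma(D-2\nu-m+n)\,\zeta^\pm_{m-n}(\nu)\frac{(\pm\mu)^n}{n!}+\sum_{l=l_\ast}^{\lfloor x_0\rfloor}c_l\,\sigma^{\pm,l}_\nu\,\beta^l+\int_{x_0-i\infty}^{x_0+i\infty}\frac{ds}{2\pi i}\Gamma(-s)\zeta_\ast(-s)\,\sigma^{\pm,s}_\nu\,\beta^s,$$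 where the last integral converges absolutely. 2. (Complete expansion at fixed $\nu$.) Let $\operatorname{Re}\nu<1$, $2\nu\notin\mathbb Z$, and let $(A^\pm_{\nu,N})$ hold for all $N$. Then, as $\beta\to+0$, $$I^\pm_\nu(\beta)\simeq\sum_{k,n=0}^\infty\Gamma(D-2\nu-k)\,\zeta_\ast(D-2\nu-k-n)\frac{\zeta^\pm_k(\nu)(\pm\beta\mu)^n}{n!\,\beta^{D-2\nu-k}}+\sum_{l=l_\ast}^\infty c_l\,\sigma^{\pm,l}_\nu\,\beta^l,$$ that is, for every real $M$ the difference between $I^\pm_\nu(\beta)$ and the sum of all the terms in which the exponent of $\beta$ has real part less than $M$ is $O(\beta^M)$. 3. (The limit $\nu\to0$.) Suppose that $\nu\mapsto\int_{\mathbb R}\varphi(\omega)\zeta_+(\nu,\omega)\,d\omega$ is continuous at $\nu=0$ for every $\varphi\in C_c^\infty(\mathbb R)$ (for instance, that it is analytic for $\operatorname{Re}\nu<1$), and that for every $N$ the expansion $(A^\pm_{\nu,N})$ holds uniformly for $\nu$ in some neighbourhood of $0$. Then $I^\pm_0(\beta)$ converges absolutely for every $\beta>0$, and the expansion of $I^\pm_0(\beta)$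 as $\beta\to+0$ is the limit of that in 2 as $\nu\to0$: for every integer $L$ let $S^\pm_L(\nu,\beta)$ be the sum of the terms of the double series in 2 with $k+n-D<L$ and of the terms of the second series with $l<L$; then the finite limit $S^\pm_L(\beta)=\lim_{\nu\to0,\ \nu\ne0}S^\pm_L(\nu,\beta)$ exists for every $\beta>0$, and $$I^\pm_0(\beta)=S^\pm_L(\beta)+O(\beta^L|\ln\beta|),\qquad\beta\to+0 .$$ If these conditions hold for both signs, then $\Omega(\beta)=-I_0^+(\beta)-I_0^-(\beta)$ for every $\beta>0$. -/

import Mathlib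

open Filter Topology MeasureTheory Asymptotics

noncomputable section

namespace HighTemp

/-- The two quantum statistics. -/
inductive Statistics
  | bose
  | fermi

/-- The Bose-Einstein function `1 / (e^x - 1)` or the Fermi-Dirac function `1 / (e^x + 1)`. -/
def occupation : Statistics → ℝ → ℝ
  | .bose, x => 1 / (Real.exp x - 1)
  | .fermi, x => 1 / (Real.exp x + 1)

/-- The Dirichlet eta function `η(z) = (1 - 2^(1-z)) ζ(z)`, with its value `log 2` at the
removable singularity `z = 1`. -/
def dirichletEta (z : ℂ) : ℂ :=
  open Classical in if z = 1 then (Real.log 2 : ℂ) else (1 - 2 ^ (1 - z)) * riemannZeta z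

/-- `ζ` for bosons, `η` for fermions. -/
def statZeta : Statistics → ℂ → ℂ
  | .bose => riemannZeta
  | .fermi => dirichletEta

/-- First index of the sum over `l`. -/
def firstIndex : Statistics → ℤ
  | .bose => -1
  | .fermi => 0

/-- The coefficient `(-1)^l ζ(-l) / Γ(l+1)` (bosons), `(-1)^l η(-l) / Γ(l+1)` (fermions).
For bosons and `l = -1` it is understood as the limit
`- lim_{z → -1} ζ(-z) / Γ(z+1) = 1`. -/
def integerCoeff : Statistics → ℤ → ℂ
  | .bose, l => if l = -1 then 1 else (-1) ^ l * riemannZeta (-(l : ℂ)) / Complex.Gamma (l + 1)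
  | .fermi, l => (-1) ^ l * dirichletEta (-(l : ℂ)) / Complex.Gamma (l + 1)

/-- `∫_0^∞ f(ω) / (e^{β(ω-μ)} ∓ 1) dω`. -/
def thermalIntegral (st : Statistics) (f : ℝ → ℂ) (β μ : ℝ) : ℂ :=
  ∫ ω in Set.Ioi (0 : ℝ), f ω * (occupation st (β * (ω - μ)) : ℂ)

/-- The one-loop potential
`Ω = - ∫_0^∞ [f(ω) / (e^{β(ω-μ)} ∓ 1) + f(-ω) / (e^{β(ω+μ)} ∓ 1)] dω`, where `f = ζ_+(0, ·)`. -/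
def omegaPotential (st : Statistics) (f : ℝ → ℂ) (β μ : ℝ) : ℂ :=
  -∫ ω in Set.Ioi (0 : ℝ), (f ω * (occupation st (β * (ω - μ)) : ℂ)
    + f (-ω) * (occupation st (β * (ω + μ)) : ℂ))

/-- `∫_0^∞ (ω - μ)^s f(ω) dω`. -/
def powerIntegral (f : ℝ → ℂ) (μ : ℝ) (s : ℂ) : ℂ :=
  ∫ ω in Set.Ioi (0 : ℝ), ((ω - μ : ℝ) : ℂ) ^ s * f ω

/-- The value at `s` of the meromorphic continuation of `F` from the half-plane `Re z < a` to a
half-plane `Re z < b` that contains `s`, provided that the continuation is analytic at `s`.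
By the identity theorem this value is unique, if it exists. -/
def continuation (F : ℂ → ℂ) (a : ℝ) (s : ℂ) : ℂ :=
  Classical.epsilon fun w : ℂ => ∃ (b : ℝ) (g : ℂ → ℂ), s.re < b ∧
    MeromorphicOn g {z : ℂ | z.re < b} ∧ (∀ z : ℂ, z.re < a → g z = F z) ∧
    AnalyticAt ℂ g s ∧ g s = w

/-- `σ^s_ν(μ)`: the continuation in `s` of `∫_0^∞ (ω - μ)^s f(ω) dω` from
`Re s < 2 Re ν - d - 1`; here `f = ζ_+(ν, ·)`. With `f = ζ_+(ν, -·)` and `-μ` in place of `μ`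
it is `τ^s_ν(μ)`. -/
def sigmaFun (f : ℝ → ℂ) (d : ℕ) (ν : ℂ) (μ : ℝ) (s : ℂ) : ℂ :=
  continuation (powerIntegral f μ) (2 * ν.re - d - 1) s

/-- `f` vanishes on `[0, ω₀]` and is locally integrable on `[ω₀, ∞)`. -/
structure Admissible (f : ℝ → ℂ) (ω₀ : ℝ) : Prop where
  vanishes : ∀ ω ∈ Set.Icc 0 ω₀, f ω = 0
  locallyIntegrable : LocallyIntegrableOn f (Set.Ici ω₀) volume

/-- `∑_{k=0}^N c_k ω^{d - 2ν - k}`. -/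
def powerSum (d : ℕ) (ν : ℂ) (c : ℕ → ℂ) (N : ℕ) (ω : ℝ) : ℂ :=
  ∑ k ∈ Finset.range (N + 1), c k * (ω : ℂ) ^ ((d : ℂ) - 2 * ν - k)

/-- `f(ω) = ∑_{k=0}^N c_k ω^{d - 2ν - k} + O(ω^{d - 2ν - N - 1})` as `ω → +∞`. -/
def HasPowerExpansion (f : ℝ → ℂ) (d : ℕ) (ν : ℂ) (c : ℕ → ℂ) (N : ℕ) : Prop :=
  (fun ω : ℝ => f ω - powerSum d ν c N ω)
    =O[atTop] fun ω : ℝ => ω ^ ((d : ℝ) - 2 * ν.re - N - 1)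

/-- The large `ω` expansion of `Z ν ω` holds to all orders, uniformly for `ν` near `0`. -/
def HasUniformPowerExpansion (Z : ℂ → ℝ → ℂ) (d : ℕ) (c : ℕ → ℂ → ℂ) : Prop :=
  ∀ N : ℕ, ∃ C R : ℝ, 0 < R ∧ ∀ᶠ ν in 𝓝 (0 : ℂ), ∀ ω : ℝ, R ≤ ω →
    ‖Z ν ω - powerSum d ν (fun k => c k ν) N ω‖ ≤ C * ω ^ ((d : ℝ) - 2 * ν.re - N - 1)

/-- `β^{m+2ν-D} ζ(D-2ν-m) ∑_{n=0}^m Γ(D-2ν-m+n) c_{m-n} μ^n / n!`, where `D = d + 1`. -/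
def groupedTerm (st : Statistics) (d : ℕ) (ν : ℂ) (c : ℕ → ℂ) (μ β : ℝ) (m : ℕ) : ℂ :=
  (β : ℂ) ^ ((m : ℂ) + 2 * ν - (d + 1)) * statZeta st ((d : ℂ) + 1 - 2 * ν - m) *
    ∑ n ∈ Finset.range (m + 1), Complex.Gamma ((d : ℂ) + 1 - 2 * ν - m + n) * c (m - n) *
      (μ : ℂ) ^ n / (n.factorial : ℂ)

/-- `Γ(D-2ν-k) ζ(D-2ν-k-n) c_k (βμ)^n / (n! β^{D-2ν-k})`, where `D = d + 1`. -/
def doubleTerm (st : Statistics) (d : ℕ) (ν : ℂ) (c : ℕ → ℂ) (μ β : ℝ) (k n : ℕ) : ℂ :=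
  Complex.Gamma ((d : ℂ) + 1 - 2 * ν - k) * statZeta st ((d : ℂ) + 1 - 2 * ν - k - n) *
    (c k * ((β : ℂ) * μ) ^ n) / ((n.factorial : ℂ) * (β : ℂ) ^ ((d : ℂ) + 1 - 2 * ν - k))

/-- `(-1)^l ζ(-l) / Γ(l+1) σ^l_ν(μ) β^l`. -/
def integerTerm (st : Statistics) (f : ℝ → ℂ) (d : ℕ) (ν : ℂ) (μ β : ℝ) (l : ℤ) : ℂ :=
  integerCoeff st l * sigmaFun f d ν μ (l : ℂ) * (β : ℂ) ^ l

/-- `Γ(-s) ζ(-s) σ^s_ν(μ) β^s`. -/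
def contourIntegrand (st : Statistics) (f : ℝ → ℂ) (d : ℕ) (ν : ℂ) (μ β : ℝ) (s : ℂ) : ℂ :=
  Complex.Gamma (-s) * statZeta st (-s) * sigmaFun f d ν μ s * (β : ℂ) ^ s

/-- `σ^s_ν(μ)` is the absolutely convergent integral for `Re s < 2 Re ν - d - 1` and is analytic
for `Re s < 2 Re ν - d + N` away from the points `2ν - d - 1 + m`, `m = 0, …, N`. -/
def SigmaContinues (f : ℝ → ℂ) (d : ℕ) (ν : ℂ) (μ : ℝ) (N : ℕ) : Prop :=
  (∀ s : ℂ, s.re < 2 * ν.re - d - 1 →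
    IntegrableOn (fun ω : ℝ => ((ω - μ : ℝ) : ℂ) ^ s * f ω) (Set.Ioi 0) volume ∧
    sigmaFun f d ν μ s = ∫ ω in Set.Ioi (0 : ℝ), ((ω - μ : ℝ) : ℂ) ^ s * f ω) ∧
  DifferentiableOn ℂ (sigmaFun f d ν μ)
    {s : ℂ | s.re < 2 * ν.re - d + N ∧ ∀ m : ℕ, m ≤ N → s ≠ 2 * ν - d - 1 + m}

/-- The exact formula with remainder, for every `β > 0`: the thermal integral converges, and for
every vertical line `Re s = x₀`, `x₀` not an integer, in the strip
`2 Re ν - d - 1 + N < Re s < 2 Re ν - d + N`, it equals the sum over `m ≤ N`, plus the sum over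
the integers `l < x₀`, plus the absolutely convergent integral
`∫ ds / (2πi) Γ(-s) ζ(-s) σ^s_ν(μ) β^s` over this line. -/
def ExactExpansion (st : Statistics) (f : ℝ → ℂ) (d : ℕ) (ν : ℂ) (c : ℕ → ℂ) (μ : ℝ)
    (N : ℕ) : Prop :=
  ∀ β : ℝ, 0 < β →
    IntegrableOn (fun ω : ℝ => f ω * (occupation st (β * (ω - μ)) : ℂ)) (Set.Ioi 0) volume ∧
    ∀ x₀ : ℝ, 2 * ν.re - d - 1 + N < x₀ → x₀ < 2 * ν.re - d + N → (∀ l : ℤ, x₀ ≠ l) →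
      Integrable (fun t : ℝ => contourIntegrand st f d ν μ β (x₀ + t * Complex.I)) volume ∧
      thermalIntegral st f β μ =
        ∑ m ∈ Finset.range (N + 1), groupedTerm st d ν c μ β m
        + ∑ l ∈ Finset.Icc (firstIndex st) ⌊x₀⌋, integerTerm st f d ν μ β l
        + 1 / (2 * Real.pi : ℂ) *
          ∫ t : ℝ, contourIntegrand st f d ν μ β (x₀ + t * Complex.I)

/-- The part of the expansion formed by the terms with `k + n < K` of the double sum and by the
terms with `l < L` of the sum over `l`. -/
def partialExpansion (st : Statistics) (f : ℝ → ℂ) (d : ℕ) (ν : ℂ) (c : ℕ → ℂ) (μ : ℝ)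
    (K : ℕ) (L : ℤ) (β : ℝ) : ℂ :=
  (∑ m ∈ Finset.range K, ∑ p ∈ Finset.HasAntidiagonal.antidiagonal m,
      doubleTerm st d ν c μ β p.1 p.2)
    + ∑ l ∈ Finset.Ico (firstIndex st) L, integerTerm st f d ν μ β l

/-- Complete asymptotic expansion at fixed `ν` as `β → +0`: for each real `M`, the terms in which
the exponent of `β` has real part less than `M` give the thermal integral up to `O(β^M)`. -/
def CompleteExpansion (st : Statistics) (f : ℝ → ℂ) (d : ℕ) (ν : ℂ) (c : ℕ → ℂ)
    (μ : ℝ) : Prop :=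
  ∀ M : ℝ,
    (fun β : ℝ => thermalIntegral st f β μ
      - partialExpansion st f d ν c μ ⌈M - 2 * ν.re + (d + 1)⌉₊ ⌈M⌉ β)
      =O[𝓝[>] (0 : ℝ)] fun β : ℝ => β ^ M

/-- Complete asymptotic expansion at `ν = 0`, obtained by the limit `ν → 0`: the thermal
integral at `ν = 0` converges, and for each integer `L` the terms in which the exponent of `β` at `ν = 0` is less than `L` have a finite sum in the
limit `ν → 0`, and this limit gives the thermal integral at `ν = 0` up to `O(β^L log β)`. -/
def LimitExpansion (st : Statistics) (Z : ℂ → ℝ → ℂ) (d : ℕ) (c : ℕ → ℂ → ℂ) (μ : ℝ) : Prop :=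
  (∀ β : ℝ, 0 < β →
    IntegrableOn (fun ω : ℝ => Z 0 ω * (occupation st (β * (ω - μ)) : ℂ)) (Set.Ioi 0) volume) ∧
  ∀ L : ℤ, ∃ S : ℝ → ℂ,
    (∀ β : ℝ, 0 < β →
      Tendsto (fun ν : ℂ =>
        partialExpansion st (Z ν) d ν (fun k => c k ν) μ (L + (d + 1)).toNat L β)
        (𝓝[≠] (0 : ℂ)) (𝓝 (S β))) ∧
    (fun β : ℝ => thermalIntegral st (Z 0) β μ - S β)
      =O[𝓝[>] (0 : ℝ)] fun β : ℝ => β ^ L * |Real.log β|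

end HighTemp

end

/-! After the translation x = ω - μ the thermal integral becomes ∫ g(x) n(βx) dx over x > 0, where g
vanishes up to δ = ω₀ - μ > 0 and behaves at infinity like P(x) = ∑ e_m x^(α-m), α = d - 2ν. Near 0
the occupation function has a Laurent series ∑ a_j y^(j-1). Fix a non-integer x₀ in the strip of the
theorem, and let n_tr be n minus its Laurent terms of exponent below x₀. Then |n_tr(y)| ≤ C y^x₀ on
the whole half-line, and g - P is integrable against x^x₀. So ∫ (g - P) n_tr(βx) dx is a remainder
of size β^x₀.

The rest of g n is computed exactly (`PowerTail.integral_occupation`). Cutting the powers of P and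
the Laurent terms at δ splits it into Mellin transforms of n, which produce Γ(α-m+1) ζ_*(α-m+1), and
moments of g - P beyond δ. The boundary terms of the first kind complete the second kind to the
continued moments σ^l. The coefficients a_j are identified as residues of Γ ζ_* (`occCoeff_eq`), and
the binomial series of (x + μ)^(α-k) combined with Γ gives the inner sum over n. In the strip, the
continued σ^s is itself the Mellin transform of g - P (`PowerTail.hasMellin_excess`), so Mellin
inversion of n_tr and Fubini turn the remainder into the contour integral. Choosing N large gives
the complete expansion.

As ν → 0 single terms have poles that cancel. This is not checked term by term: the thermal integral
and the remainder are both continuous at ν = 0, hence so is the limit of their difference, the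
partial expansion. Continuity rests on that of the coefficients, which are recovered from pairings
with bumps placed far out (`RegularFamily.continuousAt_coeff`). With x₀ = L - 1/2 the error is
O(β^(L-1/2)). Passing to L + 1 makes it O(β^(L+1/2)), and the extra terms have the form β^L (β^(2ν)
A(ν) + B(ν)); if such an expression converges for every β > 0, the limit is β^L times an affine
function of log β. -/

noncomputable section

/-! ### Laurent expansion of the occupation function at 0 -/

namespace HighTemp

/-- The analytic extension of `y ↦ y * occupation st y` to the whole line. -/
def regOcc : Statistics → ℝ → ℝ
  | .bose, y => (dslope Real.exp 0 y)⁻¹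
  | .fermi, y => y / (Real.exp y + 1)

lemma regOcc_eq (st : Statistics) {y : ℝ} (hy : y ≠ 0) : regOcc st y = y * occupation st y := by
  cases st with
  | bose =>
    simp only [regOcc, occupation, dslope_of_ne _ hy, slope_def_field]
    simp [div_eq_mul_inv]
  | fermi => simp [regOcc, occupation, div_eq_mul_inv]

lemma analyticAt_dslope_zero {f : ℝ → ℝ} (hf : ∀ y, AnalyticAt ℝ f y) (y : ℝ) :
    AnalyticAt ℝ (dslope f 0) y := by
  by_cases hy : y = 0
  · subst hy
    obtain ⟨p, hp⟩ := hf 0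
    exact ⟨_, hp.has_fpower_series_dslope_fslope⟩
  · have h1 : AnalyticAt ℝ (fun z => (f z - f 0) / (z - 0)) y :=
      ((hf y).sub analyticAt_const).div (analyticAt_id.sub analyticAt_const) (by simpa using hy)
    refine h1.congr ?_
    filter_upwards [dslope_eventuallyEq_slope_of_ne f hy] with z hz
    rw [hz, slope_def_field]

lemma dslope_exp_ne_zero (y : ℝ) : dslope Real.exp 0 y ≠ 0 := by
  by_cases hy : y = 0
  · subst hy; simp [dslope_same]
  · rw [dslope_of_ne _ hy, slope_def_field]
    refine div_ne_zero ?_ (by simpa using hy)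
    rw [sub_ne_zero]
    exact fun h => hy (Real.exp_injective h)

lemma analyticAt_regOcc (st : Statistics) (y : ℝ) : AnalyticAt ℝ (regOcc st) y := by
  cases st with
  | bose =>
    exact (analyticAt_dslope_zero (fun _ => analyticAt_rexp) y).inv (dslope_exp_ne_zero y)
  | fermi =>
    exact analyticAt_id.div (analyticAt_rexp.add analyticAt_const) (by positivity)

/-- The `K`-th Taylor remainder quotient of `regOcc` at `0`. -/
def taylorRem (st : Statistics) : ℕ → ℝ → ℝ
  | 0 => regOcc st
  | K + 1 => dslope (taylorRem st K) 0

lemma analyticAt_taylorRem (st : Statistics) (K : ℕ) : ∀ y, AnalyticAt ℝ (taylorRem st K) y := by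
  induction K with
  | zero => exact analyticAt_regOcc st
  | succ K ih => exact analyticAt_dslope_zero ih

/-- The coefficient of `y ^ (j - 1)` in the Laurent expansion of the occupation function. -/
def occCoeff (st : Statistics) (j : ℕ) : ℝ := taylorRem st j 0

/-- The occupation function minus the first `K` terms of its Laurent expansion. -/
def occTrunc (st : Statistics) (K : ℕ) (y : ℝ) : ℝ :=
  occupation st y - ∑ j ∈ Finset.range K, occCoeff st j * y ^ ((j : ℤ) - 1)

lemma occTrunc_zero (st : Statistics) : occTrunc st 0 = occupation st := by
  ext y; simp [occTrunc]

/-- Each `dslope` strips one Taylor coefficient of y n(y) and divides by y. The order of vanishing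
at 0 is thus read off without any formula for the coefficients. -/
lemma occTrunc_eq (st : Statistics) (K : ℕ) {y : ℝ} (hy : y ≠ 0) :
    occTrunc st K y = y ^ ((K : ℤ) - 1) * taylorRem st K y := by
  induction K with
  | zero =>
    simp only [occTrunc, taylorRem, regOcc_eq st hy]
    simp only [Finset.range_zero, Finset.sum_empty, sub_zero, Nat.cast_zero, zero_sub, zpow_neg,
      zpow_one]
    field_simp
  | succ K ih =>
    have h1 : occTrunc st (K + 1) y = occTrunc st K y - occCoeff st K * y ^ ((K : ℤ) - 1) := by
      simp only [occTrunc, Finset.sum_range_succ]; ring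
    have h2 : taylorRem st K y = occCoeff st K + y * taylorRem st (K + 1) y := by
      have := sub_smul_dslope (taylorRem st K) 0 y
      simp only [sub_zero, smul_eq_mul] at this
      simp only [taylorRem, occCoeff] at this ⊢
      linarith
    have h3 : y ^ (((K + 1 : ℕ) : ℤ) - 1) = y ^ ((K : ℤ) - 1) * y := by
      rw [← zpow_add_one₀ hy]; congr 1; push_cast; ring
    rw [h1, ih, h2, h3]; ring

lemma analyticAt_occTrunc (st : Statistics) (K : ℕ) {y : ℝ} (hy : 0 < y) :
    AnalyticAt ℝ (occTrunc st K) y := by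
  have h : AnalyticAt ℝ (fun z : ℝ => z ^ ((K : ℤ) - 1) * taylorRem st K z) y :=
    ((analyticAt_id (𝕜 := ℝ)).zpow hy.ne').mul (analyticAt_taylorRem st K y)
  refine h.congr ?_
  filter_upwards [eventually_ne_nhds hy.ne'] with z hz
  rw [occTrunc_eq st K hz]

lemma zpow_mul_analytic_isBigO {T : ℝ → ℝ} (hT : ∀ y, AnalyticAt ℝ T y) (k : ℤ) {φ : ℝ → ℝ}
    (h : ∀ y, 0 < y → φ y = y ^ k * T y) :
    φ =O[𝓝[>] 0] fun y : ℝ => y ^ (k : ℝ) := by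
  have h1 : T =O[𝓝[>] 0] fun _ => (1 : ℝ) :=
    ((hT 0).continuousAt.tendsto.isBigO_one ℝ).mono nhdsWithin_le_nhds
  have h2 := (isBigO_refl (fun y : ℝ => y ^ k) (𝓝[>] 0)).mul h1
  refine h2.congr' ?_ ?_
  · filter_upwards [self_mem_nhdsWithin] with y hy
    exact (h y hy).symm
  · filter_upwards [self_mem_nhdsWithin] with y hy
    simp [Real.rpow_intCast]

/-- Functions of the form y^k · (analytic) are stable under differentiation at the cost of one
power, so bounds near 0 for any number of derivatives follow by iteration. -/
lemma deriv_zpow_mul_analytic {T : ℝ → ℝ} (hT : ∀ y, AnalyticAt ℝ T y) (k : ℤ) {φ : ℝ → ℝ}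
    (h : ∀ y, 0 < y → φ y = y ^ k * T y) :
    ∃ T' : ℝ → ℝ, (∀ y, AnalyticAt ℝ T' y) ∧ ∀ y, 0 < y → deriv φ y = y ^ (k - 1) * T' y := by
  refine ⟨fun y => k * T y + y * deriv T y, fun y =>
    (analyticAt_const.mul (hT y)).add (analyticAt_id.mul (hT y).deriv), fun y hy => ?_⟩
  have h1 : φ =ᶠ[𝓝 y] fun y => y ^ k * T y := by
    filter_upwards [eventually_gt_nhds hy] with z hz using h z hz
  rw [h1.deriv_eq]
  have h2 := (hasDerivAt_zpow k y (Or.inl hy.ne')).mul (hT y).differentiableAt.hasDerivAt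
  refine h2.deriv.trans ?_
  have h3 : y ^ k = y ^ (k - 1) * y := by
    rw [← zpow_add_one₀ hy.ne']; congr 1; ring
  rw [h3]; ring

/-- Two derivatives are controlled because the Mellin transform must decay quadratically on vertical
lines. -/
lemma occTrunc_isBigO_zero (st : Statistics) (K : ℕ) :
    occTrunc st K =O[𝓝[>] 0] (fun y : ℝ => y ^ ((K : ℝ) - 1)) ∧
    deriv (occTrunc st K) =O[𝓝[>] 0] (fun y : ℝ => y ^ ((K : ℝ) - 2)) ∧
    deriv (deriv (occTrunc st K)) =O[𝓝[>] 0] (fun y : ℝ => y ^ ((K : ℝ) - 3)) := by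
  have h0 : ∀ y, 0 < y → occTrunc st K y = y ^ ((K : ℤ) - 1) * taylorRem st K y :=
    fun y hy => occTrunc_eq st K hy.ne'
  obtain ⟨T1, hT1, h1⟩ := deriv_zpow_mul_analytic (analyticAt_taylorRem st K) _ h0
  obtain ⟨T2, hT2, h2⟩ := deriv_zpow_mul_analytic hT1 _ h1
  refine ⟨?_, ?_, ?_⟩
  · simpa using zpow_mul_analytic_isBigO (analyticAt_taylorRem st K) _ h0
  · have := zpow_mul_analytic_isBigO hT1 _ h1
    refine this.congr_right fun y => ?_
    congr 1; push_cast; ring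
  · have := zpow_mul_analytic_isBigO hT2 _ h2
    refine this.congr_right fun y => ?_
    congr 1; push_cast; ring

/-! ### Decay of the occupation function and of its derivatives at infinity -/

/-- The sign in the Riccati equation `n' = -(n + κ n²)` of the occupation function. -/
def statSign : Statistics → ℝ
  | .bose => 1
  | .fermi => -1

lemma hasDerivAt_occupation (st : Statistics) {y : ℝ} (hy : 0 < y) :
    HasDerivAt (occupation st) (-(occupation st y + statSign st * occupation st y ^ 2)) y := by
  have he : 1 < Real.exp y := by simpa using hy
  cases st with
  | bose =>
    have h : HasDerivAt (fun x => 1 / (Real.exp x - 1)) _ y :=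
      (hasDerivAt_const y (1 : ℝ)).fun_div ((Real.hasDerivAt_exp y).sub_const 1) (by linarith)
    convert! h using 1
    have : Real.exp y - 1 ≠ 0 := by linarith
    simp only [occupation, statSign]
    field_simp
    ring
  | fermi =>
    have h : HasDerivAt (fun x => 1 / (Real.exp x + 1)) _ y :=
      (hasDerivAt_const y (1 : ℝ)).fun_div ((Real.hasDerivAt_exp y).add_const 1) (by positivity)
    convert! h using 1
    have : Real.exp y + 1 ≠ 0 := by positivity
    simp only [occupation, statSign]
    field_simp
    ring

lemma occupation_isBigO_exp (st : Statistics) :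
    occupation st =O[atTop] fun y => Real.exp (-y) := by
  refine IsBigO.of_bound 2 ?_
  filter_upwards [eventually_ge_atTop 1] with y hy
  have he : 2 ≤ Real.exp y := by linarith [Real.add_one_le_exp y]
  have hb : ∀ a : ℝ, Real.exp y / 2 ≤ a → ‖1 / a‖ ≤ 2 * ‖Real.exp (-y)‖ := fun a ha => by
    have ha0 : 0 < a := by linarith
    rw [Real.norm_of_nonneg (by positivity), Real.norm_of_nonneg (by positivity), Real.exp_neg,
      div_le_iff₀ ha0, ← div_eq_mul_inv, div_mul_eq_mul_div, le_div_iff₀ (by positivity)]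
    linarith
  cases st with
  | bose => exact hb _ (by linarith)
  | fermi => exact hb _ (by linarith)

/-- The Riccati equation expresses both derivatives as polynomials in n without constant term, so
they inherit the exponential decay and lie below every power. -/
lemma occupation_derivs_isBigO (st : Statistics) (q : ℝ) :
    occupation st =O[atTop] (fun y : ℝ => y ^ q) ∧
    deriv (occupation st) =O[atTop] (fun y : ℝ => y ^ q) ∧
    deriv (deriv (occupation st)) =O[atTop] (fun y : ℝ => y ^ q) := by
  have hexp : (fun y => Real.exp (-y)) =O[atTop] fun y : ℝ => y ^ q := by
    simpa using (isLittleO_exp_neg_mul_rpow_atTop one_pos q).isBigO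
  have h0 : occupation st =O[atTop] (fun y : ℝ => y ^ q) := (occupation_isBigO_exp st).trans hexp
  have hone : occupation st =O[atTop] fun _ => (1 : ℝ) := by
    refine (occupation_isBigO_exp st).trans ?_
    exact (Real.tendsto_exp_neg_atTop_nhds_zero).isBigO_one ℝ
  have hr : (fun y => -(occupation st y + statSign st * occupation st y ^ 2))
      =O[atTop] (fun y : ℝ => y ^ q) := by
    refine (h0.add (IsBigO.const_mul_left ?_ _)).neg_left
    simpa [pow_two] using h0.mul hone
  have hd : ∀ y, 0 < y → deriv (occupation st) y =
      -(occupation st y + statSign st * occupation st y ^ 2) := fun y hy =>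
    (hasDerivAt_occupation st hy).deriv
  have h1 : deriv (occupation st) =O[atTop] (fun y : ℝ => y ^ q) := by
    refine hr.congr' ?_ EventuallyEq.rfl
    filter_upwards [eventually_gt_atTop 0] with y hy using (hd y hy).symm
  refine ⟨h0, h1, ?_⟩
  have hd2 : ∀ y, 0 < y → deriv (deriv (occupation st)) y =
      -(deriv (occupation st) y * (1 + 2 * statSign st * occupation st y)) := fun y hy => by
    have e : deriv (occupation st) =ᶠ[𝓝 y]
        fun y => -(occupation st y + statSign st * occupation st y ^ 2) := by
      filter_upwards [eventually_gt_nhds hy] with z hz using hd z hz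
    rw [e.deriv_eq]
    have h := hasDerivAt_occupation st hy
    have := (h.add ((h.pow 2).const_mul (statSign st))).neg
    refine this.deriv.trans ?_
    rw [h.deriv]; push_cast; ring
  have hb : (fun y => 1 + 2 * statSign st * occupation st y) =O[atTop] fun _ => (1 : ℝ) :=
    (isBigO_refl _ _).add (hone.const_mul_left _)
  have h2 := (h1.mul hb).neg_left
  refine h2.congr' ?_ (by simp)
  filter_upwards [eventually_gt_atTop 0] with y hy using (hd2 y hy).symm

lemma zpow_isBigO_atTop {k : ℤ} {q : ℝ} (h : (k : ℝ) ≤ q) :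
    (fun y : ℝ => y ^ k) =O[atTop] fun y : ℝ => y ^ q := by
  refine IsBigO.of_bound 1 ?_
  filter_upwards [eventually_ge_atTop 1] with y hy
  rw [Real.norm_of_nonneg (by positivity), Real.norm_of_nonneg (by positivity), one_mul,
    ← Real.rpow_intCast]
  exact Real.rpow_le_rpow_of_exponent_le hy h

lemma deriv_sum_zpow (K : ℕ) (a : ℕ → ℝ) (k : ℕ → ℤ) {y : ℝ} (hy : 0 < y) :
    HasDerivAt (fun y : ℝ => ∑ j ∈ Finset.range K, a j * y ^ k j)
      (∑ j ∈ Finset.range K, (a j * k j) * y ^ (k j - 1)) y := by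
  refine HasDerivAt.fun_sum fun j _ => ?_
  have := (hasDerivAt_zpow (k j) y (Or.inl hy.ne')).const_mul (a j)
  convert! this using 1; ring

lemma differentiableAt_occupation_derivs (st : Statistics) {y : ℝ} (hy : 0 < y) :
    DifferentiableAt ℝ (occupation st) y ∧ DifferentiableAt ℝ (deriv (occupation st)) y := by
  have := analyticAt_occTrunc st 0 hy
  rw [occTrunc_zero] at this
  exact ⟨this.differentiableAt, this.deriv.differentiableAt⟩

/-- At infinity n itself is negligible and the subtracted powers dominate; q is any bound for their
exponents, hence arbitrary when K = 0. -/
lemma occTrunc_isBigO_atTop (st : Statistics) (K : ℕ) {q : ℝ}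
    (hq : ∀ j < K, (j : ℝ) - 1 ≤ q) :
    occTrunc st K =O[atTop] (fun y : ℝ => y ^ q) ∧
    deriv (occTrunc st K) =O[atTop] (fun y : ℝ => y ^ (q - 1)) ∧
    deriv (deriv (occTrunc st K)) =O[atTop] (fun y : ℝ => y ^ (q - 2)) := by
  have hs : ∀ (a : ℕ → ℝ) (i : ℕ),
      (fun y : ℝ => ∑ j ∈ Finset.range K, a j * y ^ ((j : ℤ) - 1 - i))
        =O[atTop] fun y : ℝ => y ^ (q - i) := fun a i => by
    refine IsBigO.fun_sum fun j hj => (zpow_isBigO_atTop ?_).const_mul_left _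
    have := hq j (Finset.mem_range.1 hj)
    push_cast; linarith
  have h1 : ∀ y, 0 < y → deriv (occTrunc st K) y = deriv (occupation st) y -
      ∑ j ∈ Finset.range K, (occCoeff st j * ((j : ℤ) - 1 : ℤ)) * y ^ ((j : ℤ) - 1 - 1) :=
    fun y hy => ((differentiableAt_occupation_derivs st hy).1.hasDerivAt.sub
      (deriv_sum_zpow K (occCoeff st) (fun j => (j : ℤ) - 1) hy)).deriv
  have h2 : ∀ y, 0 < y → deriv (deriv (occTrunc st K)) y = deriv (deriv (occupation st)) y -
      ∑ j ∈ Finset.range K, (occCoeff st j * ((j : ℤ) - 1 : ℤ) * ((j : ℤ) - 1 - 1 : ℤ)) *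
        y ^ ((j : ℤ) - 1 - 1 - 1) := fun y hy => by
    have e : deriv (occTrunc st K) =ᶠ[𝓝 y] fun y => deriv (occupation st) y -
        ∑ j ∈ Finset.range K, (occCoeff st j * ((j : ℤ) - 1 : ℤ)) * y ^ ((j : ℤ) - 1 - 1) := by
      filter_upwards [eventually_gt_nhds hy] with z hz using h1 z hz
    rw [e.deriv_eq]
    exact ((differentiableAt_occupation_derivs st hy).2.hasDerivAt.sub
      (deriv_sum_zpow K _ (fun j => (j : ℤ) - 1 - 1) hy)).deriv
  refine ⟨?_, ?_, ?_⟩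
  · have := (occupation_derivs_isBigO st q).1.sub (by simpa using hs (occCoeff st) 0)
    exact this
  · have := (occupation_derivs_isBigO st (q - 1)).2.1.sub
      (by simpa using hs (fun j => occCoeff st j * ((j : ℤ) - 1 : ℤ)) 1)
    refine this.congr' ?_ EventuallyEq.rfl
    filter_upwards [eventually_gt_atTop 0] with y hy
    rw [h1 y hy]; simp
  · have := (occupation_derivs_isBigO st (q - 2)).2.2.sub
      (hs (fun j => occCoeff st j * ((j : ℤ) - 1 : ℤ) * ((j : ℤ) - 1 - 1 : ℤ)) 2)
    refine this.congr' ?_ EventuallyEq.rfl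
    filter_upwards [eventually_gt_atTop 0] with y hy
    rw [h2 y hy]
    congr 1
    refine Finset.sum_congr rfl fun j _ => ?_
    congr 2
    push_cast; ring

end HighTemp

end

/-! ### Identity theorem, decay of Mellin transforms and Mellin inversion -/

noncomputable section

namespace HighTemp

/-- The difference has infinite order at z₀, and finite order at one point of a preconnected set
would propagate to all of it. Infinite order at s controls only a punctured neighbourhood;
continuity supplies the value at s. -/
lemma meromorphic_identity {f g : ℂ → ℂ} {U : Set ℂ} (hU : IsPreconnected U)
    (hf : MeromorphicOn f U) (hg : MeromorphicOn g U) {z₀ s : ℂ} (hz₀ : z₀ ∈ U)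
    (h : ∀ᶠ z in 𝓝 z₀, f z = g z) (hs : s ∈ U) (hfs : ContinuousAt f s) (hgs : ContinuousAt g s) :
    f s = g s := by
  have hfg : MeromorphicOn (f - g) U := hf.sub hg
  have h1 : meromorphicOrderAt (f - g) z₀ = ⊤ := by
    rw [meromorphicOrderAt_eq_top_iff]
    filter_upwards [eventually_nhdsWithin_of_eventually_nhds h] with z hz
    simp [hz]
  have h2 : meromorphicOrderAt (f - g) s = ⊤ := by
    by_contra hne
    exact hfg.meromorphicOrderAt_ne_top_of_isPreconnected hU hs hz₀ hne h1
  rw [meromorphicOrderAt_eq_top_iff] at h2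
  have h3 : Tendsto (f - g) (𝓝[≠] s) (𝓝 ((f - g) s)) :=
    ((hfs.sub hgs).tendsto).mono_left nhdsWithin_le_nhds
  have h4 : Tendsto (f - g) (𝓝[≠] s) (𝓝 0) := tendsto_const_nhds.congr' (by
    filter_upwards [h2] with z hz using hz.symm)
  exact sub_eq_zero.1 (tendsto_nhds_unique h3 h4)

lemma isPreconnected_re_lt (b : ℝ) : IsPreconnected {z : ℂ | z.re < b} :=
  (convex_halfSpace_re_lt b).isPreconnected

lemma isPreconnected_re_gt (b : ℝ) : IsPreconnected {z : ℂ | b < z.re} :=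
  (convex_halfSpace_re_gt b).isPreconnected

/-- Integration by parts: for b < Re s < a the growth bounds make y^s f(y) tend to 0 at both ends.
-/
lemma mellin_of_hasDerivAt {f f' : ℝ → ℂ} {a b : ℝ} {s : ℂ}
    (hd : ∀ y, 0 < y → HasDerivAt f (f' y) y) (hc : ContinuousOn f' (Set.Ioi 0))
    (ht : f =O[atTop] fun y : ℝ => y ^ (-a)) (ht' : f' =O[atTop] fun y : ℝ => y ^ (-(a + 1)))
    (hz : f =O[𝓝[>] 0] fun y : ℝ => y ^ (-b)) (hz' : f' =O[𝓝[>] 0] fun y : ℝ => y ^ (-(b + 1)))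
    (ha : s.re < a) (hb : b < s.re) : mellin f' (s + 1) = -(s * mellin f s) := by
  have hfc : ContinuousOn f (Set.Ioi 0) := fun y hy => (hd y hy).continuousAt.continuousWithinAt
  have hconv : MellinConvergent f s := mellinConvergent_of_isBigO_rpow
    (hfc.locallyIntegrableOn measurableSet_Ioi) ht ha hz hb
  have hconv' : MellinConvergent f' (s + 1) := mellinConvergent_of_isBigO_rpow
    (hc.locallyIntegrableOn measurableSet_Ioi) ht' (by simpa using ha) hz' (by simpa using hb)
  -- The formula for the derivative of y^s requires s ≠ 0; for s = 0 the weight is the constant 1.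
  by_cases hs : s = 0
  · subst hs
    have h := integral_Ioi_mul_deriv_eq_deriv_mul (a := (0 : ℝ)) (u := fun _ => (1 : ℂ)) (v := f)
      (u' := fun _ => 0) (v' := f') (a' := 0) (b' := 0) (fun x _ => hasDerivAt_const _ _) hd
      (by simpa [MellinConvergent, Pi.mul_def] using hconv')
      (by simpa [Pi.mul_def] using integrableOn_zero) ?_ ?_
    · simpa [mellin] using h
    · have h1 : Tendsto (fun y : ℝ => y ^ (-b)) (𝓝[>] 0) (𝓝 0) := by
        have hb' : 0 < -b := by simpa using hb
        have := (Real.continuousAt_rpow_const 0 (-b) (Or.inr hb'.le)).tendsto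
        rw [Real.zero_rpow hb'.ne'] at this
        exact this.mono_left nhdsWithin_le_nhds
      simpa [Pi.mul_def] using hz.trans_tendsto h1
    · have h1 : Tendsto (fun y : ℝ => y ^ (-a)) atTop (𝓝 0) :=
        tendsto_rpow_neg_atTop (by simpa using ha)
      simpa [Pi.mul_def] using ht.trans_tendsto h1
  have hu : ∀ y ∈ Set.Ioi (0 : ℝ), HasDerivAt (fun y : ℝ => (y : ℂ) ^ s)
      (s * (y : ℂ) ^ (s - 1)) y := fun y hy => by
    exact hasDerivAt_ofReal_cpow_const (ne_of_gt hy) hs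
  have hn : ∀ y : ℝ, 0 < y → ‖(y : ℂ) ^ s‖ = y ^ s.re := fun y hy =>
    Complex.norm_cpow_eq_rpow_re_of_pos hy s
  have h := integral_Ioi_mul_deriv_eq_deriv_mul (a := (0 : ℝ)) (u := fun y : ℝ => (y : ℂ) ^ s)
      (v := f) (u' := fun y : ℝ => s * (y : ℂ) ^ (s - 1)) (v' := f') (a' := 0) (b' := 0) hu hd
      (by simpa [MellinConvergent] using! hconv') ?_ ?_ ?_
  · simp only [mellin, add_sub_cancel_right, smul_eq_mul]
    rw [h, ← integral_const_mul]
    simp [mul_assoc]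
  · have := hconv.const_mul s
    simpa [Pi.mul_def, mul_assoc] using! this
  · have h1 : Tendsto (fun y : ℝ => y ^ (s.re - b)) (𝓝[>] 0) (𝓝 0) := by
      have hb' : 0 < s.re - b := by linarith
      have := (Real.continuousAt_rpow_const 0 (s.re - b) (Or.inr hb'.le)).tendsto
      rw [Real.zero_rpow hb'.ne'] at this
      exact this.mono_left nhdsWithin_le_nhds
    refine IsBigO.trans_tendsto ?_ h1
    have h2 : (fun y : ℝ => (y : ℂ) ^ s) =O[𝓝[>] 0] fun y : ℝ => y ^ s.re := by
      refine IsBigO.of_bound 1 ?_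
      filter_upwards [self_mem_nhdsWithin] with y hy
      rw [hn y hy, one_mul]; exact le_abs_self _
    refine (h2.mul hz).congr' EventuallyEq.rfl ?_
    filter_upwards [self_mem_nhdsWithin] with y hy
    rw [← Real.rpow_add hy]; rfl
  · have h1 : Tendsto (fun y : ℝ => y ^ (-(a - s.re))) atTop (𝓝 0) :=
      tendsto_rpow_neg_atTop (by linarith)
    refine IsBigO.trans_tendsto ?_ h1
    have h2 : (fun y : ℝ => (y : ℂ) ^ s) =O[atTop] fun y : ℝ => y ^ s.re := by
      refine IsBigO.of_bound 1 ?_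
      filter_upwards [eventually_gt_atTop 0] with y hy
      rw [hn y hy, one_mul]; exact le_abs_self _
    refine (h2.mul ht).congr' EventuallyEq.rfl ?_
    filter_upwards [eventually_gt_atTop 0] with y hy
    rw [← Real.rpow_add hy]; congr 1; ring

/-- Two integrations by parts give a Mellin transform that is integrable on vertical lines. -/
lemma verticalIntegrable_mellin {f f' f'' : ℝ → ℂ} {a b σ : ℝ}
    (hd : ∀ y, 0 < y → HasDerivAt f (f' y) y) (hd' : ∀ y, 0 < y → HasDerivAt f' (f'' y) y)
    (hc : ContinuousOn f'' (Set.Ioi 0))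
    (ht : f =O[atTop] fun y : ℝ => y ^ (-a)) (ht' : f' =O[atTop] fun y : ℝ => y ^ (-(a + 1)))
    (ht'' : f'' =O[atTop] fun y : ℝ => y ^ (-(a + 1 + 1)))
    (hz : f =O[𝓝[>] 0] fun y : ℝ => y ^ (-b)) (hz' : f' =O[𝓝[>] 0] fun y : ℝ => y ^ (-(b + 1)))
    (hz'' : f'' =O[𝓝[>] 0] fun y : ℝ => y ^ (-(b + 1 + 1)))
    (ha : σ < a) (hb : b < σ) (hσ : σ ≠ 0) (hσ' : σ + 1 ≠ 0) :
    Complex.VerticalIntegrable (mellin f) σ := by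
  have hfc : ContinuousOn f (Set.Ioi 0) := fun y hy => (hd y hy).continuousAt.continuousWithinAt
  have hfc' : ContinuousOn f' (Set.Ioi 0) := fun y hy => (hd' y hy).continuousAt.continuousWithinAt
  have key : ∀ s : ℂ, s.re = σ → mellin f'' (s + 1 + 1) = (s + 1) * (s * mellin f s) := by
    intro s hs
    rw [mellin_of_hasDerivAt hd' hc ht' ht'' hz' hz'' (by simpa [hs] using ha)
      (by simpa [hs] using hb), mellin_of_hasDerivAt hd hfc' ht ht' hz hz' (by simpa [hs] using ha)
      (by simpa [hs] using hb)]
    ring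
  -- The modulus of y^(s+1) depends on Re s only, so one integral bounds the transform of f'' on the
  -- entire line.
  set B : ℝ := ∫ y in Set.Ioi (0 : ℝ), ‖((y : ℝ) : ℂ) ^ ((σ : ℂ) + 1 + 1 - 1) • f'' y‖ with hB
  have hbound : ∀ s : ℂ, s.re = σ → ‖mellin f'' (s + 1 + 1)‖ ≤ B := by
    intro s hs
    refine (norm_integral_le_integral_norm _).trans (le_of_eq ?_)
    refine setIntegral_congr_fun measurableSet_Ioi fun y hy => ?_
    simp only [norm_smul, Complex.norm_cpow_eq_rpow_re_of_pos hy]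
    simp [hs]
  have hB0 : 0 ≤ B := integral_nonneg fun _ => norm_nonneg _
  -- Since σ is neither 0 nor -1, both |s| and |s + 1| are at least a constant times (1 + t²)^(1/2);
  -- dividing by s(s + 1) then leaves an integrable function of t.
  obtain ⟨c, hc0, hcσ, hcσ'⟩ : ∃ c : ℝ, 0 < c ∧ c ≤ |σ| ∧ c ≤ |σ + 1| :=
    ⟨min |σ| |σ + 1|, lt_min (abs_pos.2 hσ) (abs_pos.2 hσ'), min_le_left _ _, min_le_right _ _⟩
  set m : ℝ := min 1 (c ^ 2) with hm
  have hm0 : 0 < m := lt_min one_pos (by positivity)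
  have hlow : ∀ (r t : ℝ), c ≤ |r| → m * (1 + t ^ 2) ≤ r ^ 2 + t ^ 2 := fun r t hr => by
    have h1 : c ^ 2 ≤ r ^ 2 := by rw [← sq_abs r]; gcongr
    nlinarith [min_le_left 1 (c ^ 2), min_le_right 1 (c ^ 2), sq_nonneg t]
  have hcont : Continuous fun t : ℝ => mellin f (σ + t * Complex.I) := by
    rw [continuous_iff_continuousAt]
    intro t
    have h1 : DifferentiableAt ℂ (mellin f) (σ + t * Complex.I) :=
      mellin_differentiableAt_of_isBigO_rpow
        (hfc.locallyIntegrableOn measurableSet_Ioi) ht (by simpa using ha) hz (by simpa using hb)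
    exact ContinuousAt.comp (f := fun t : ℝ => (σ : ℂ) + t * Complex.I) (x := t)
      h1.continuousAt (by fun_prop)
  refine Integrable.mono' (g := fun t : ℝ => B / m * (1 + t ^ 2)⁻¹)
    (integrable_inv_one_add_sq.const_mul _) hcont.aestronglyMeasurable
    (Eventually.of_forall fun t => ?_)
  set s : ℂ := σ + t * Complex.I with hs
  have hsre : s.re = σ := by simp [hs]
  have hk := hbound s hsre
  rw [key s hsre, norm_mul, norm_mul] at hk
  have hn1 : ‖s‖ ^ 2 = σ ^ 2 + t ^ 2 := by
    rw [Complex.sq_norm, Complex.normSq_apply]; simp [hs]; ring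
  have hn2 : ‖s + 1‖ ^ 2 = (σ + 1) ^ 2 + t ^ 2 := by
    rw [Complex.sq_norm, Complex.normSq_apply]; simp [hs]; ring
  have hprod : m * (1 + t ^ 2) ≤ ‖s + 1‖ * ‖s‖ := by
    refine abs_le_of_sq_le_sq' ?_ (by positivity) |>.2
    rw [mul_pow ‖s + 1‖, hn1, hn2, pow_two]
    exact mul_le_mul (hlow _ _ hcσ') (hlow _ _ hcσ) (by positivity) (by positivity)
  have : m * (1 + t ^ 2) * ‖mellin f s‖ ≤ B :=
    (mul_le_mul_of_nonneg_right hprod (norm_nonneg _)).trans (by linarith)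
  rw [div_mul_eq_mul_div, le_div_iff₀ hm0, ← div_eq_mul_inv, le_div_iff₀ (by positivity)]
  linarith

/-- The number of Laurent terms of the occupation function with exponents below `x₀`. -/
def truncOrder (x₀ : ℝ) : ℕ := (⌊x₀⌋ + 2).toNat

/-- The first exponent that is not subtracted lies above x₀. For x₀ < -1 the truncation to natural
numbers gives order 0, which is right: no Laurent exponent is below x₀. -/
lemma truncOrder_gt {x₀ : ℝ} : x₀ < (truncOrder x₀ : ℝ) - 1 := by
  have h1 : (⌊x₀⌋ + 2 : ℤ) ≤ truncOrder x₀ := Int.self_le_toNat _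
  have h2 : ((⌊x₀⌋ + 2 : ℤ) : ℝ) ≤ (truncOrder x₀ : ℝ) := by exact_mod_cast h1
  push_cast at h2
  linarith [Int.lt_floor_add_one x₀]

lemma lt_of_lt_truncOrder {x₀ : ℝ} (hx : ∀ l : ℤ, x₀ ≠ l) {j : ℕ} (hj : j < truncOrder x₀) :
    (j : ℝ) - 1 < x₀ := by
  have h1 : (j : ℤ) - 1 ≤ ⌊x₀⌋ := by unfold truncOrder at hj; omega
  have h2 : (((j : ℤ) - 1 : ℤ) : ℝ) ≤ x₀ := Int.le_floor.1 h1
  push_cast at h2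
  refine lt_of_le_of_ne h2 fun h => hx ((j : ℤ) - 1) ?_
  rw [← h]; push_cast; ring

lemma exists_lt_truncOrder {x₀ : ℝ} (hx : ∀ l : ℤ, x₀ ≠ l) :
    ∃ q < x₀, ∀ j < truncOrder x₀, (j : ℝ) - 1 ≤ q := by
  -- The entry that matters is the last one: the largest subtracted exponent `truncOrder x₀ - 2`, or
  -- x₀ - 1 when nothing is subtracted.
  refine ⟨((truncOrder x₀ : ℝ) - 2) ⊓ (x₀ - 1) ⊔ (if truncOrder x₀ = 0 then x₀ - 1
    else (truncOrder x₀ : ℝ) - 2), ?_, fun j hj => ?_⟩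
  · split_ifs with h
    · exact max_lt (min_lt_of_right_lt (by linarith)) (by linarith)
    · refine max_lt (min_lt_of_right_lt (by linarith)) ?_
      have := lt_of_lt_truncOrder hx (j := truncOrder x₀ - 1) (by omega)
      rw [Nat.cast_sub (by omega)] at this
      push_cast at this; linarith
  · rw [if_neg (by omega)]
    refine le_max_of_le_right ?_
    have : (j : ℝ) + 1 ≤ truncOrder x₀ := by exact_mod_cast hj
    linarith

/-- The truncated occupation function as a complex-valued function. -/
def occTruncC (st : Statistics) (K : ℕ) (y : ℝ) : ℂ := (occTrunc st K y : ℂ)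

lemma hasDerivAt_occTrunc (st : Statistics) (K : ℕ) {y : ℝ} (hy : 0 < y) :
    HasDerivAt (occTruncC st K) ((deriv (occTrunc st K) y : ℝ) : ℂ) y ∧
    HasDerivAt (fun y => ((deriv (occTrunc st K) y : ℝ) : ℂ))
      ((deriv (deriv (occTrunc st K)) y : ℝ) : ℂ) y := by
  have := analyticAt_occTrunc st K hy
  exact ⟨this.differentiableAt.hasDerivAt.ofReal_comp,
    this.deriv.differentiableAt.hasDerivAt.ofReal_comp⟩

lemma continuousOn_occTruncC (st : Statistics) (K : ℕ) :
    ContinuousOn (occTruncC st K) (Set.Ioi 0) := fun _ hy =>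
  (hasDerivAt_occTrunc st K hy).1.continuousAt.continuousWithinAt

lemma isBigO_ofReal {l : Filter ℝ} {f g : ℝ → ℝ} (h : f =O[l] g) :
    (fun y => (f y : ℂ)) =O[l] g :=
  (isBigO_norm_left).1 (by simpa using h.norm_left)

lemma occTruncC_isBigO_zero (st : Statistics) (K : ℕ) :
    occTruncC st K =O[𝓝[>] 0] fun y : ℝ => y ^ (-(1 - (K : ℝ))) :=
  isBigO_ofReal (by simpa using (occTrunc_isBigO_zero st K).1)

/-- The truncation is O(y^(K-1)) at 0 and O(y^q) at infinity with q < x₀ < K - 1, so the line Re s =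
-x₀ lies inside the strip of convergence. -/
lemma mellinConvergent_occTruncC (st : Statistics) {x₀ : ℝ} (hx : ∀ l : ℤ, x₀ ≠ l) {s : ℂ}
    (hs : s.re = -x₀) : MellinConvergent (occTruncC st (truncOrder x₀)) s := by
  obtain ⟨q, hq, hqj⟩ := exists_lt_truncOrder hx
  refine mellinConvergent_of_isBigO_rpow
    ((continuousOn_occTruncC st _).locallyIntegrableOn measurableSet_Ioi) (a := -q) ?_ ?_
    (occTruncC_isBigO_zero st _) ?_
  · exact isBigO_ofReal (by simpa using (occTrunc_isBigO_atTop st _ hqj).1)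
  · rw [hs]; linarith
  · rw [hs]; linarith [truncOrder_gt (x₀ := x₀)]

lemma verticalIntegrable_occTruncC (st : Statistics) {x₀ : ℝ} (hx : ∀ l : ℤ, x₀ ≠ l) :
    Complex.VerticalIntegrable (mellin (occTruncC st (truncOrder x₀))) (-x₀) := by
  obtain ⟨q, hq, hqj⟩ := exists_lt_truncOrder hx
  obtain ⟨h0, h1, h2⟩ := occTrunc_isBigO_zero st (truncOrder x₀)
  obtain ⟨k0, k1, k2⟩ := occTrunc_isBigO_atTop st _ hqj
  -- The two integrations by parts divide by s(s + 1), so the line Re s = -x₀ has to avoid 0 and -1.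
  have hx0 : x₀ ≠ 0 := by simpa using hx 0
  have hx1 : x₀ ≠ 1 := by simpa using hx 1
  refine verticalIntegrable_mellin (f' := fun y => ((deriv (occTrunc st _) y : ℝ) : ℂ))
    (f'' := fun y => ((deriv (deriv (occTrunc st _)) y : ℝ) : ℂ)) (a := -q)
    (b := 1 - truncOrder x₀)
    (fun y hy => (hasDerivAt_occTrunc st _ hy).1) (fun y hy => (hasDerivAt_occTrunc st _ hy).2)
    (fun y hy => ?_) (isBigO_ofReal ?_) (isBigO_ofReal ?_) (isBigO_ofReal ?_) (isBigO_ofReal ?_)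
    (isBigO_ofReal ?_) (isBigO_ofReal ?_) (by linarith)
    (by linarith [truncOrder_gt (x₀ := x₀)]) (by simpa using hx0)
    (fun h => hx1 (by linarith))
  · have := (analyticAt_occTrunc st (truncOrder x₀) hy).deriv.deriv.continuousAt
    exact (Complex.continuous_ofReal.continuousAt.comp this).continuousWithinAt
  · simpa using k0
  · exact k1.congr_right fun y => by congr 1; ring
  · exact k2.congr_right fun y => by congr 1; ring
  · exact h0.congr_right fun y => by congr 1; ring
  · exact h1.congr_right fun y => by congr 1; ring
  · exact h2.congr_right fun y => by congr 1; ring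

/-- Mellin inversion for the truncated occupation function. -/
lemma occTruncC_eq_integral (st : Statistics) {x₀ : ℝ} (hx : ∀ l : ℤ, x₀ ≠ l) {y : ℝ}
    (hy : 0 < y) :
    occTruncC st (truncOrder x₀) y = 1 / (2 * Real.pi : ℂ) * ∫ t : ℝ, (y : ℂ) ^ (x₀ + t * Complex.I)
      * mellin (occTruncC st (truncOrder x₀)) (-(x₀ + t * Complex.I)) := by
  have h := mellinInv_mellin_eq (-x₀) (occTruncC st (truncOrder x₀)) hy
    (mellinConvergent_occTruncC st hx (by simp)) (verticalIntegrable_occTruncC st hx)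
    ((continuousOn_occTruncC st _).continuousAt (Ioi_mem_nhds hy))
  rw [← h, mellinInv]
  -- Inversion runs over -x₀ + it; reversing t turns this into -(x₀ + it).
  rw [← integral_neg_eq_self]
  simp only [Complex.real_smul]
  push_cast
  congr 2
  ext t
  rw [smul_eq_mul]
  congr 2
  · ring
  · ring

/-- A power bound on the whole half-line from bounds at both ends. -/
lemma exists_bound_rpow {f : ℝ → ℂ} {p q x₀ : ℝ} (hc : ContinuousOn f (Set.Ioi 0))
    (ht : f =O[atTop] fun y : ℝ => y ^ q) (hz : f =O[𝓝[>] 0] fun y : ℝ => y ^ p)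
    (hq : q ≤ x₀) (hp : x₀ ≤ p) : ∃ C, 0 ≤ C ∧ ∀ y, 0 < y → ‖f y‖ ≤ C * y ^ x₀ := by
  obtain ⟨C1, h1⟩ := ht.bound
  obtain ⟨C2, h2⟩ := hz.bound
  obtain ⟨R, hR⟩ := eventually_atTop.1 h1
  obtain ⟨ε, hε, h2⟩ := (nhdsGT_basis (0 : ℝ)).eventually_iff.1 h2
  -- The cuts satisfy a ≤ 1 ≤ b, so that y^p ≤ y^x₀ below a and y^q ≤ y^x₀ above b; the middle range
  -- is compact.
  set a := min (ε / 2) 1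
  set b := max R 1
  have ha : 0 < a := by positivity
  have hcK : ContinuousOn (fun y => ‖f y‖ / y ^ x₀) (Set.Icc a b) := by
    refine ContinuousOn.div (hc.norm.mono fun y hy => lt_of_lt_of_le ha hy.1) ?_ ?_
    · exact ContinuousOn.rpow_const continuousOn_id fun y hy => Or.inl (lt_of_lt_of_le ha hy.1).ne'
    · exact fun y hy => (Real.rpow_pos_of_pos (lt_of_lt_of_le ha hy.1) _).ne'
  obtain ⟨C3, h3⟩ := isCompact_Icc.bddAbove_image hcK
  refine ⟨max (max |C1| |C2|) |C3|, by positivity, fun y hy => ?_⟩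
  have hyx : 0 < y ^ x₀ := Real.rpow_pos_of_pos hy _
  rcases lt_or_ge y a with hya | hya
  · have hy1 : y ≤ 1 := hya.le.trans (min_le_right _ _)
    have := h2 ⟨hy, lt_of_lt_of_le hya ((min_le_left _ _).trans (by linarith))⟩
    rw [Real.norm_of_nonneg (by positivity)] at this
    have h4 : y ^ p ≤ y ^ x₀ := Real.rpow_le_rpow_of_exponent_ge hy hy1 hp
    calc ‖f y‖ ≤ C2 * y ^ p := this
      _ ≤ |C2| * y ^ x₀ := by gcongr; exact le_abs_self _
      _ ≤ _ := by gcongr; exact (le_max_right _ _).trans (le_max_left _ _)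
  rcases le_or_gt y b with hyb | hyb
  · have := h3 (Set.mem_image_of_mem _ ⟨hya, hyb⟩)
    rw [div_le_iff₀ hyx] at this
    exact this.trans (by gcongr; exact (le_abs_self _).trans (le_max_right _ _))
  · have hy1 : 1 ≤ y := (le_max_right _ _).trans hyb.le
    have := hR y ((le_max_left _ _).trans hyb.le)
    rw [Real.norm_of_nonneg (by positivity)] at this
    have h4 : y ^ q ≤ y ^ x₀ := Real.rpow_le_rpow_of_exponent_le hy1 hq
    calc ‖f y‖ ≤ C1 * y ^ q := this
      _ ≤ |C1| * y ^ x₀ := by gcongr; exact le_abs_self _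
      _ ≤ _ := by gcongr; exact (le_max_left _ _).trans (le_max_left _ _)

lemma exists_bound_occTruncC (st : Statistics) {x₀ : ℝ} (hx : ∀ l : ℤ, x₀ ≠ l) :
    ∃ C, 0 ≤ C ∧ ∀ y, 0 < y → ‖occTruncC st (truncOrder x₀) y‖ ≤ C * y ^ x₀ := by
  obtain ⟨q, hq, hqj⟩ := exists_lt_truncOrder hx
  exact exists_bound_rpow (continuousOn_occTruncC st _)
    (isBigO_ofReal (occTrunc_isBigO_atTop st _ hqj).1)
    (isBigO_ofReal (occTrunc_isBigO_zero st _).1) hq.le truncOrder_gt.le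

end HighTemp

end

/-! ### Mellin transform of the occupation function and its Laurent coefficients -/

noncomputable section

namespace HighTemp

lemma hasMellin_cpow_Ioc_of_pos {c : ℝ} (hc : 0 < c) (a : ℂ) {s : ℂ} (hs : 0 < (s + a).re) :
    HasMellin (Set.indicator (Set.Ioc 0 c) (fun t : ℝ => (t : ℂ) ^ a)) s
      ((c : ℂ) ^ (s + a) / (s + a)) := by
  have h1 : -1 < (s - 1 + a).re := by simp at hs ⊢; linarith
  have heq : ∀ t ∈ Set.Ioc (0 : ℝ) c, (t : ℂ) ^ (s - 1) * (t : ℂ) ^ a = (t : ℂ) ^ (s - 1 + a) :=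
    fun t ht => (Complex.cpow_add _ _ (by exact_mod_cast ht.1.ne')).symm
  have hsub : Set.Ioc 0 c ⊆ Set.Ioi 0 := Set.Ioc_subset_Ioi_self
  have hne : s + a ≠ 0 := fun h => by simp [h] at hs
  have hind : ∀ t : ℝ, (t : ℂ) ^ (s - 1) • Set.indicator (Set.Ioc 0 c) (fun t : ℝ => (t : ℂ) ^ a) t
      = Set.indicator (Set.Ioc 0 c) (fun t : ℝ => (t : ℂ) ^ (s - 1 + a)) t := fun t => by
    by_cases ht : t ∈ Set.Ioc 0 c
    · simp only [Set.indicator_of_mem ht, smul_eq_mul, heq t ht]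
    · simp [Set.indicator_of_notMem ht]
  simp only [HasMellin, MellinConvergent, mellin, hind]
  refine ⟨?_, ?_⟩
  · rw [IntegrableOn, integrable_indicator_iff measurableSet_Ioc, IntegrableOn,
      Measure.restrict_restrict_of_subset hsub]
    exact (intervalIntegrable_iff_integrableOn_Ioc_of_le hc.le).1
      (intervalIntegral.intervalIntegrable_cpow' h1)
  · rw [integral_indicator measurableSet_Ioc, Measure.restrict_restrict_of_subset hsub,
      ← intervalIntegral.integral_of_le hc.le, integral_cpow (Or.inl h1)]
    have : s - 1 + a + 1 = s + a := by ring
    rw [this, Complex.ofReal_zero, Complex.zero_cpow hne, sub_zero]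

/-- The value is the negative of the one for `Ioc 0 c`, on the complementary half-plane. Trading one
cut-off for the other is how the continuation passes the pole s = -a. -/
lemma hasMellin_cpow_Ioi_of_pos {c : ℝ} (hc : 0 < c) (a : ℂ) {s : ℂ} (hs : (s + a).re < 0) :
    HasMellin (Set.indicator (Set.Ioi c) (fun t : ℝ => (t : ℂ) ^ a)) s
      (-((c : ℂ) ^ (s + a) / (s + a))) := by
  have h1 : (s - 1 + a).re < -1 := by simp at hs ⊢; linarith
  have hsub : Set.Ioi c ⊆ Set.Ioi 0 := Set.Ioi_subset_Ioi hc.le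
  have hind : ∀ t : ℝ, (t : ℂ) ^ (s - 1) • Set.indicator (Set.Ioi c) (fun t : ℝ => (t : ℂ) ^ a) t
      = Set.indicator (Set.Ioi c) (fun t : ℝ => (t : ℂ) ^ (s - 1 + a)) t := fun t => by
    by_cases ht : t ∈ Set.Ioi c
    · simp only [Set.indicator_of_mem ht, smul_eq_mul]
      exact (Complex.cpow_add _ _ (by exact_mod_cast (hc.trans ht).ne')).symm
    · simp [Set.indicator_of_notMem ht]
  simp only [HasMellin, MellinConvergent, mellin, hind]
  refine ⟨?_, ?_⟩
  · rw [IntegrableOn, integrable_indicator_iff measurableSet_Ioi, IntegrableOn,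
      Measure.restrict_restrict_of_subset hsub]
    exact integrableOn_Ioi_cpow_of_lt h1 hc
  · rw [integral_indicator measurableSet_Ioi, Measure.restrict_restrict_of_subset hsub,
      integral_Ioi_cpow_of_lt h1 hc]
    have : s - 1 + a + 1 = s + a := by ring
    rw [this, neg_div]

/-- The product (s - 1) ζ(s), given the value 1 at s = 1, is entire. -/
lemma meromorphic_riemannZeta : Meromorphic riemannZeta := by
  intro s
  have hc : MeromorphicAt (fun s => (s - 1) * riemannZeta s) s → MeromorphicAt riemannZeta s := by
    intro h
    have h2 : MeromorphicAt (fun s : ℂ => (s - 1)⁻¹ * ((s - 1) * riemannZeta s)) s :=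
      ((analyticAt_id.sub analyticAt_const).meromorphicAt.inv).mul h
    refine h2.congr ?_
    have : ∀ᶠ z in 𝓝[≠] s, z ≠ 1 := by
      by_cases hs : s = 1
      · subst hs; exact self_mem_nhdsWithin
      · exact eventually_nhdsWithin_of_eventually_nhds (eventually_ne_nhds hs)
    filter_upwards [this] with z hz
    rw [← mul_assoc, inv_mul_cancel₀ (sub_ne_zero.2 hz), one_mul]
  refine hc ?_
  have hd : Differentiable ℂ (Function.update (fun s => (s - 1) * riemannZeta s) 1 1) := by
    intro z
    by_cases hz : z = 1
    · subst hz
      refine (Complex.analyticAt_of_differentiable_on_punctured_nhds_of_continuousAt ?_ ?_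
        ).differentiableAt
      · filter_upwards [self_mem_nhdsWithin] with w hw
        refine DifferentiableAt.congr_of_eventuallyEq (f := fun s => (s - 1) * riemannZeta s)
          ((by fun_prop : DifferentiableAt ℂ (fun s : ℂ => s - 1) w).mul
            (differentiableAt_riemannZeta hw)) ?_
        filter_upwards [eventually_ne_nhds hw] with v hv
        simp [Function.update_of_ne hv]
      · exact continuousAt_update_same.2 riemannZeta_residue_one
    · refine DifferentiableAt.congr_of_eventuallyEq (f := fun s => (s - 1) * riemannZeta s)
          ((by fun_prop : DifferentiableAt ℂ (fun s : ℂ => s - 1) z).mul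
            (differentiableAt_riemannZeta hz)) ?_
      filter_upwards [eventually_ne_nhds hz] with v hv
      simp [Function.update_of_ne hv]
  refine (hd.analyticAt s).meromorphicAt.congr ?_
  have : ∀ᶠ z in 𝓝[≠] s, z ≠ 1 := by
    by_cases hs : s = 1
    · subst hs; exact self_mem_nhdsWithin
    · exact eventually_nhdsWithin_of_eventually_nhds (eventually_ne_nhds hs)
  filter_upwards [this] with z hz
  simp [Function.update_of_ne hz]

lemma dirichletEta_of_ne {z : ℂ} (hz : z ≠ 1) :
    dirichletEta z = (1 - 2 ^ (1 - z)) * riemannZeta z := by simp [dirichletEta, hz]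

lemma differentiable_one_sub_two_cpow : Differentiable ℂ fun z : ℂ => 1 - (2 : ℂ) ^ (1 - z) := by
  have : Differentiable ℂ fun z : ℂ => (2 : ℂ) ^ (1 - z) := fun z =>
    (by fun_prop : DifferentiableAt ℂ (fun z : ℂ => 1 - z) z).const_cpow (Or.inl two_ne_zero)
  exact (differentiable_const _).sub this

lemma differentiableAt_statZeta (st : Statistics) {s : ℂ} (hs : s ≠ 1) :
    DifferentiableAt ℂ (statZeta st) s := by
  cases st with
  | bose => exact differentiableAt_riemannZeta hs
  | fermi =>
    refine DifferentiableAt.congr_of_eventuallyEq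
      (f := fun z => (1 - 2 ^ (1 - z)) * riemannZeta z)
      ((differentiable_one_sub_two_cpow s).mul (differentiableAt_riemannZeta hs)) ?_
    filter_upwards [eventually_ne_nhds hs] with z hz using dirichletEta_of_ne hz

lemma meromorphic_statZeta (st : Statistics) : Meromorphic (statZeta st) := by
  cases st with
  | bose => exact meromorphic_riemannZeta
  | fermi =>
    intro s
    have h : MeromorphicAt (fun z => (1 - 2 ^ (1 - z)) * riemannZeta z) s :=
      (differentiable_one_sub_two_cpow.analyticAt s).meromorphicAt.mul (meromorphic_riemannZeta s)
    refine h.congr ?_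
    have : ∀ᶠ z in 𝓝[≠] s, z ≠ 1 := by
      by_cases hs : s = 1
      · subst hs; exact self_mem_nhdsWithin
      · exact eventually_nhdsWithin_of_eventually_nhds (eventually_ne_nhds hs)
    filter_upwards [this] with z hz using (dirichletEta_of_ne hz).symm

/-- Termwise integration of the geometric series 1/(e^y - 1) = ∑ e^(-(n+1)y). -/
lemma mellin_occupation_bose {s : ℂ} (hs : 1 < s.re) :
    mellin (fun y => (occupation .bose y : ℂ)) s = Complex.Gamma s * riemannZeta s := by
  have h := hasSum_mellin (ι := ℕ) (a := fun _ => 1) (p := fun n => (n : ℝ) + 1)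
    (F := fun y => (occupation .bose y : ℂ)) (s := s) (fun i => Or.inr (by positivity))
    (by linarith) (fun t ht => ?_) ?_
  · have h2 := h.tsum_eq
    rw [← h2, zeta_eq_tsum_one_div_nat_add_one_cpow hs, ← tsum_mul_left]
    refine tsum_congr fun n => ?_
    push_cast; ring
  · have ht' : (0 : ℝ) < t := ht
    have hr : Real.exp (-t) < 1 := by simpa using ht'
    have hg := (hasSum_geometric_of_lt_one (Real.exp_nonneg (-t)) hr).mul_left (Real.exp (-t))
    have hg2 : HasSum (fun n : ℕ => Real.exp (-((n : ℝ) + 1) * t)) (occupation .bose t) := by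
      convert! hg using 1
      · ext n
        rw [← Real.exp_nat_mul, ← Real.exp_add]; congr 1; ring
      · have h3 : Real.exp t - 1 ≠ 0 := by
          have := Real.add_one_lt_exp ht'.ne'; linarith
        have h4 : 1 - Real.exp (-t) ≠ 0 := by linarith
        rw [Real.exp_neg] at h4 ⊢
        simp only [occupation]
        have := Real.exp_pos t
        field_simp
    simpa using Complex.hasSum_ofReal.2 hg2
  · have := (Real.summable_one_div_nat_add_rpow 1 s.re).2 hs
    refine this.congr fun n => ?_
    rw [abs_of_pos (by positivity)]; simp

lemma mellinConvergent_occupation (st : Statistics) {s : ℂ} (hs : 1 < s.re) :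
    MellinConvergent (fun y => (occupation st y : ℂ)) s := by
  have e : (fun y => (occupation st y : ℂ)) = occTruncC st 0 := by
    ext y; simp [occTruncC, occTrunc_zero]
  rw [e]
  refine mellinConvergent_of_isBigO_rpow (a := s.re + 1)
    ((continuousOn_occTruncC st _).locallyIntegrableOn measurableSet_Ioi)
    (isBigO_ofReal (occTrunc_isBigO_atTop st 0 (by simp)).1) (by linarith)
    (occTruncC_isBigO_zero st _) (by simpa using hs)

/-- The fermionic case follows from 1/(e^y + 1) = 1/(e^y - 1) - 2/(e^(2y) - 1): rescaling y produces
the factor 1 - 2^(1-s). -/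
lemma mellin_occupation (st : Statistics) {s : ℂ} (hs : 1 < s.re) :
    mellin (fun y => (occupation st y : ℂ)) s = Complex.Gamma s * statZeta st s := by
  cases st with
  | bose => exact mellin_occupation_bose hs
  | fermi =>
    have hc := mellinConvergent_occupation .bose hs
    have hc2 : MellinConvergent (fun y => (occupation .bose (2 * y) : ℂ)) s :=
      (MellinConvergent.comp_mul_left (f := fun y => (occupation .bose y : ℂ)) two_pos).2 hc
    have h := hasMellin_sub hc (hc2.const_smul (2 : ℂ))
    have e : mellin (fun y => (occupation .fermi y : ℂ)) s = mellin (fun y =>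
        (occupation .bose y : ℂ) - (2 : ℂ) • (occupation .bose (2 * y) : ℂ)) s := by
      refine setIntegral_congr_fun measurableSet_Ioi fun y (hy : 0 < y) => ?_
      have h1 : 1 < Real.exp y := by simpa using hy
      have h2 : occupation .fermi y = occupation .bose y - 2 * occupation .bose (2 * y) := by
        simp only [occupation]
        rw [two_mul y, Real.exp_add]
        have h3 : Real.exp y - 1 ≠ 0 := by linarith
        have h5 : Real.exp y + 1 ≠ 0 := by linarith
        have h4 : Real.exp y * Real.exp y - 1 = (Real.exp y - 1) * (Real.exp y + 1) := by ring
        rw [h4]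
        field_simp
        ring
      simp only [h2]
      push_cast; simp
    have hne : s ≠ 1 := fun h => by simp [h] at hs
    rw [e, h.2, mellin_const_smul, mellin_comp_mul_left (fun y => (occupation .bose y : ℂ)) s two_pos,
      mellin_occupation_bose hs]
    simp only [statZeta, dirichletEta_of_ne hne, smul_eq_mul]
    have : (2 : ℂ) ^ (1 - s) = 2 * 2 ^ (-s) := by
      rw [sub_eq_add_neg, Complex.cpow_add _ _ two_ne_zero, Complex.cpow_one]
    rw [this]; push_cast; ring

/-- The truncated occupation function up to `c`, and the full occupation function beyond. -/
def splitOcc (st : Statistics) (K : ℕ) (c y : ℝ) : ℂ :=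
  (occupation st y : ℂ) - Set.indicator (Set.Ioc 0 c) (fun y =>
    ∑ j ∈ Finset.range K, (occCoeff st j : ℂ) * (y : ℂ) ^ ((j : ℂ) - 1)) y

lemma occTruncC_eq (st : Statistics) (K : ℕ) {y : ℝ} : occTruncC st K y = (occupation st y : ℂ)
    - ∑ j ∈ Finset.range K, (occCoeff st j : ℂ) * (y : ℂ) ^ ((j : ℂ) - 1) := by
  simp only [occTruncC, occTrunc]
  push_cast
  congr 1
  refine Finset.sum_congr rfl fun j _ => ?_
  congr 1
  rw [← Complex.cpow_intCast]; push_cast; rfl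

lemma splitOcc_of_le (st : Statistics) (K : ℕ) {c y : ℝ} (hy : 0 < y) (hyc : y ≤ c) :
    splitOcc st K c y = occTruncC st K y := by
  rw [occTruncC_eq, splitOcc, Set.indicator_of_mem (Set.mem_Ioc.2 ⟨hy, hyc⟩)]

lemma splitOcc_of_gt (st : Statistics) (K : ℕ) {c y : ℝ} (hyc : c < y) :
    splitOcc st K c y = (occupation st y : ℂ) := by
  rw [splitOcc, Set.indicator_of_notMem (fun h => not_le.2 hyc h.2), sub_zero]

lemma splitOcc_eq (st : Statistics) (K : ℕ) (c y : ℝ) : splitOcc st K c y = (occupation st y : ℂ)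
    - ∑ j ∈ Finset.range K, (occCoeff st j : ℂ) •
      Set.indicator (Set.Ioc 0 c) (fun y : ℝ => (y : ℂ) ^ ((j : ℂ) - 1)) y := by
  rw [splitOcc]; congr 1
  by_cases hy : y ∈ Set.Ioc 0 c
  · simp [Set.indicator_of_mem hy]
  · simp [Set.indicator_of_notMem hy]

lemma continuousOn_occupation (st : Statistics) :
    ContinuousOn (fun y => (occupation st y : ℂ)) (Set.Ioi 0) := by
  have := continuousOn_occTruncC st 0
  have e : (fun y => (occupation st y : ℂ)) = occTruncC st 0 := by
    ext y; simp [occTruncC, occTrunc_zero]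
  rwa [e]

lemma locallyIntegrableOn_splitOcc (st : Statistics) (K : ℕ) (c : ℝ) :
    LocallyIntegrableOn (splitOcc st K c) (Set.Ioi 0) := by
  refine LocallyIntegrableOn.sub
    ((continuousOn_occupation st).locallyIntegrableOn measurableSet_Ioi) ?_
  have : LocallyIntegrableOn (fun y : ℝ =>
      ∑ j ∈ Finset.range K, (occCoeff st j : ℂ) * (y : ℂ) ^ ((j : ℂ) - 1)) (Set.Ioi 0) := by
    refine ContinuousOn.locallyIntegrableOn (continuousOn_finsetSum _ fun j _ =>
      continuousOn_const.mul ?_) measurableSet_Ioi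
    exact fun y hy => (Complex.continuousAt_ofReal_cpow_const y _
      (Or.inr (ne_of_gt hy))).continuousWithinAt
  intro x hx
  obtain ⟨t, ht, hi⟩ := this x hx
  exact ⟨t, ht, hi.indicator measurableSet_Ioc⟩

lemma splitOcc_isBigO_zero (st : Statistics) (K : ℕ) {c : ℝ} (hc : 0 < c) :
    splitOcc st K c =O[𝓝[>] 0] fun y : ℝ => y ^ (-(1 - (K : ℝ))) := by
  refine (occTruncC_isBigO_zero st K).congr' ?_ EventuallyEq.rfl
  filter_upwards [Ioc_mem_nhdsGT hc] with y hy
  exact (splitOcc_of_le st K hy.1 hy.2).symm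

lemma splitOcc_isBigO_atTop (st : Statistics) (K : ℕ) (c q : ℝ) :
    splitOcc st K c =O[atTop] fun y : ℝ => y ^ q := by
  refine (isBigO_ofReal (occupation_derivs_isBigO st q).1).congr' ?_ EventuallyEq.rfl
  filter_upwards [eventually_gt_atTop c] with y hy
  exact (splitOcc_of_gt st K hy).symm

lemma mellinConvergent_splitOcc (st : Statistics) (K : ℕ) {c : ℝ} (hc : 0 < c) {s : ℂ}
    (hs : 1 - (K : ℝ) < s.re) : MellinConvergent (splitOcc st K c) s :=
  mellinConvergent_of_isBigO_rpow (a := s.re + 1) (locallyIntegrableOn_splitOcc st K c)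
    (splitOcc_isBigO_atTop st K c _) (by linarith) (splitOcc_isBigO_zero st K hc) hs

lemma differentiableAt_mellin_splitOcc (st : Statistics) (K : ℕ) {c : ℝ} (hc : 0 < c) {s : ℂ}
    (hs : 1 - (K : ℝ) < s.re) : DifferentiableAt ℂ (mellin (splitOcc st K c)) s :=
  mellin_differentiableAt_of_isBigO_rpow (a := s.re + 1) (locallyIntegrableOn_splitOcc st K c)
    (splitOcc_isBigO_atTop st K c _) (by linarith) (splitOcc_isBigO_zero st K hc) hs

lemma hasMellin_sum {ι : Type*} (t : Finset ι) {f : ι → ℝ → ℂ} {s : ℂ} {m : ι → ℂ}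
    (h : ∀ i ∈ t, HasMellin (f i) s (m i)) :
    HasMellin (fun y => ∑ i ∈ t, f i y) s (∑ i ∈ t, m i) := by
  classical
  induction t using Finset.induction_on with
  | empty => simp [HasMellin, MellinConvergent, mellin]
  | insert i t hi ih =>
    have h1 := h i (Finset.mem_insert_self _ _)
    have h2 := ih fun j hj => h j (Finset.mem_insert_of_mem hj)
    have := hasMellin_add h1.1 h2.1
    simp only [Finset.sum_insert hi]
    rw [h1.2, h2.2] at this
    exact this

lemma hasMellin_smul {f : ℝ → ℂ} {s m : ℂ} (h : HasMellin f s m) (a : ℂ) :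
    HasMellin (fun y => a • f y) s (a * m) := by
  have := hasMellin_const_smul h.1 a
  rwa [h.2, smul_eq_mul] at this

/-- Analytic continuation of the Mellin transform of the occupation function, regularized by
cutting the singular terms at `c`. -/
theorem mellin_splitOcc (st : Statistics) (K : ℕ) {c : ℝ} (hc : 0 < c) {s : ℂ}
    (hs : 1 - (K : ℝ) < s.re) (hs' : ∀ j : ℤ, s ≠ j) :
    mellin (splitOcc st K c) s = Complex.Gamma s * statZeta st s
      - ∑ j ∈ Finset.range K, (occCoeff st j : ℂ) *
        ((c : ℂ) ^ (s + ((j : ℂ) - 1)) / (s + ((j : ℂ) - 1))) := by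
  have hU : IsOpen {z : ℂ | 1 - (K : ℝ) < z.re} := isOpen_lt continuous_const Complex.continuous_re
  have hcne : (c : ℂ) ≠ 0 := by exact_mod_cast hc.ne'
  have hpow : ∀ (j : ℕ), Differentiable ℂ fun z : ℂ => (c : ℂ) ^ (z + ((j : ℂ) - 1)) := fun j z =>
    (by fun_prop : DifferentiableAt ℂ (fun z : ℂ => z + ((j : ℂ) - 1)) z).const_cpow (Or.inl hcne)
  -- Both sides are meromorphic for Re s > 1 - K. Near s = 2 the occupation function and each cut
  -- power have convergent transforms, so the formula holds there termwise and extends to all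
  -- non-integer s.
  refine meromorphic_identity (g := fun s => Complex.Gamma s * statZeta st s
      - ∑ j ∈ Finset.range K, (occCoeff st j : ℂ) *
        ((c : ℂ) ^ (s + ((j : ℂ) - 1)) / (s + ((j : ℂ) - 1)))) (isPreconnected_re_gt (1 - (K : ℝ)))
    ?_ ?_ (z₀ := 2) ?_ ?_ hs (differentiableAt_mellin_splitOcc st K hc hs).continuousAt ?_
  · have : DifferentiableOn ℂ (mellin (splitOcc st K c)) {z : ℂ | 1 - (K : ℝ) < z.re} :=
      fun z hz => (differentiableAt_mellin_splitOcc st K hc hz).differentiableWithinAt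
    exact fun z hz => (this.analyticAt (hU.mem_nhds hz)).meromorphicAt
  · intro z _
    refine MeromorphicAt.sub ((Meromorphic.Gamma z).mul (meromorphic_statZeta st z)) ?_
    refine MeromorphicAt.fun_sum fun j _ => (MeromorphicAt.const _ _).mul (MeromorphicAt.div ?_ ?_)
    · exact ((hpow j).analyticAt z).meromorphicAt
    · exact (analyticAt_id.add analyticAt_const).meromorphicAt
  · simp only [Set.mem_ofPred_eq, Complex.re_ofNat]
    have : (0 : ℝ) ≤ K := by positivity
    linarith
  · have : ∀ᶠ z : ℂ in 𝓝 2, 1 < z.re :=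
      (isOpen_lt continuous_const Complex.continuous_re).mem_nhds (by simp)
    filter_upwards [this] with z hz
    have h1 := hasMellin_sum (Finset.range K) (s := z) (fun j _ =>
      hasMellin_smul (hasMellin_cpow_Ioc_of_pos hc ((j : ℂ) - 1) (s := z)
        (by simp; linarith [(Nat.cast_nonneg j : (0 : ℝ) ≤ j)])) (occCoeff st j : ℂ))
    have h2 := hasMellin_sub (mellinConvergent_occupation st hz) h1.1
    rw [h1.2, mellin_occupation st hz] at h2
    rw [← h2.2]
    congr 1
    ext y
    exact splitOcc_eq st K c y
  · refine ContinuousAt.sub (ContinuousAt.mul (Complex.continuousAt_Gamma s fun m => ?_)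
      (differentiableAt_statZeta st (by simpa using hs' 1)).continuousAt) ?_
    · simpa using hs' (-m)
    · refine tendsto_finsetSum _ fun j _ => ContinuousAt.mul continuousAt_const
        (ContinuousAt.div (hpow j s).continuousAt (by fun_prop) fun h => hs' (1 - j) ?_)
      push_cast; linear_combination h

/-- The Mellin transform of the truncated occupation function on its strip of convergence. -/
theorem mellin_occTruncC (st : Statistics) {x₀ : ℝ} (hx : ∀ l : ℤ, x₀ ≠ l) {s : ℂ}
    (hs : s.re = -x₀) :
    mellin (occTruncC st (truncOrder x₀)) s = Complex.Gamma s * statZeta st s := by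
  have hs' : ∀ j : ℤ, s ≠ j := fun j h => hx (-j) (by rw [h] at hs; push_cast; simp at hs; linarith)
  have hK : 1 - (truncOrder x₀ : ℝ) < s.re := by rw [hs]; linarith [truncOrder_gt (x₀ := x₀)]
  -- The cut is placed at 1. Removing the Laurent terms beyond 1 as well adds the opposite boundary
  -- values, and only Γ ζ_* survives.
  have h0 := mellin_splitOcc st (truncOrder x₀) one_pos hK hs'
  have h1 := hasMellin_sum (Finset.range (truncOrder x₀)) (s := s) (fun j hj =>
      hasMellin_smul (hasMellin_cpow_Ioi_of_pos one_pos ((j : ℂ) - 1) (s := s)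
        (by simp; linarith [lt_of_lt_truncOrder hx (Finset.mem_range.1 hj)])) (occCoeff st j : ℂ))
  have h2 := hasMellin_sub (mellinConvergent_splitOcc st _ one_pos hK) h1.1
  rw [h1.2, h0] at h2
  have e : mellin (occTruncC st (truncOrder x₀)) s = mellin (fun y => splitOcc st (truncOrder x₀) 1 y
      - ∑ j ∈ Finset.range (truncOrder x₀), (occCoeff st j : ℂ) •
        Set.indicator (Set.Ioi 1) (fun t : ℝ => (t : ℂ) ^ ((j : ℂ) - 1)) y) s := by
    refine setIntegral_congr_fun measurableSet_Ioi fun y (hy : 0 < y) => ?_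
    rcases le_or_gt y 1 with h | h
    · simp [splitOcc_of_le st _ hy h, Set.indicator_of_notMem (show y ∉ Set.Ioi 1 by simpa using h)]
    · simp [splitOcc_of_gt st _ h, Set.indicator_of_mem (show y ∈ Set.Ioi 1 from h), occTruncC_eq]
  rw [e, h2.2]
  simp

/-- Residue of Γ at -n, by induction from Γ(s) = Γ(s + 1)/s. -/
lemma tendsto_add_mul_Gamma (n : ℕ) :
    Tendsto (fun s : ℂ => (s + n) * Complex.Gamma s) (𝓝[≠] (-n : ℂ))
      (𝓝 ((-1) ^ n / (n.factorial : ℂ))) := by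
  induction n with
  | zero => simpa using Complex.tendsto_self_mul_Gamma_nhds_zero
  | succ n ih =>
    have h1 : Tendsto (fun s : ℂ => s + 1) (𝓝[≠] (-(n + 1 : ℕ) : ℂ)) (𝓝[≠] (-n : ℂ)) := by
      refine tendsto_nhdsWithin_iff.2 ⟨?_, ?_⟩
      · have : Tendsto (fun s : ℂ => s + 1) (𝓝 (-(n + 1 : ℕ) : ℂ)) (𝓝 (-(n + 1 : ℕ) + 1)) :=
          (by fun_prop : Continuous fun s : ℂ => s + 1).tendsto _
        have e : (-(n + 1 : ℕ) + 1 : ℂ) = -n := by push_cast; ring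
        rw [e] at this
        exact this.mono_left nhdsWithin_le_nhds
      · filter_upwards [self_mem_nhdsWithin] with s hs h
        refine hs ?_
        simp only [Set.mem_singleton_iff] at h ⊢
        push_cast; linear_combination h
    have h2 : Tendsto (fun s : ℂ => s) (𝓝[≠] (-(n + 1 : ℕ) : ℂ)) (𝓝 (-(n + 1 : ℕ) : ℂ)) :=
      tendsto_id.mono_left nhdsWithin_le_nhds
    have hne : (-(n + 1 : ℕ) : ℂ) ≠ 0 := by
      rw [neg_ne_zero]; exact_mod_cast Nat.succ_ne_zero n
    have h3 := (ih.comp h1).div h2 hne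
    have e : (-1 : ℂ) ^ n / (n.factorial : ℂ) / (-(n + 1 : ℕ) : ℂ)
        = (-1) ^ (n + 1) / ((n + 1).factorial : ℂ) := by
      rw [Nat.factorial_succ]; push_cast
      have : (n.factorial : ℂ) ≠ 0 := by exact_mod_cast n.factorial_ne_zero
      have : (n + 1 : ℂ) ≠ 0 := by exact_mod_cast Nat.succ_ne_zero n
      field_simp
      ring
    rw [e] at h3
    refine h3.congr' ?_
    have : ∀ᶠ z : ℂ in 𝓝[≠] (-(n + 1 : ℕ) : ℂ), z ≠ 0 :=
      eventually_nhdsWithin_of_eventually_nhds (eventually_ne_nhds hne)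
    filter_upwards [this] with z hz
    simp only [Pi.div_apply, Function.comp_apply]
    rw [Complex.Gamma_add_one z hz]
    push_cast; field_simp; ring

lemma eventually_ne_intCast (s₀ : ℂ) : ∀ᶠ z : ℂ in 𝓝[≠] s₀, ∀ j : ℤ, z ≠ j := by
  have hcl : IsClosed (Set.range ((↑) : ℤ → ℂ) \ {s₀}) := by
    have h := Complex.isClosedEmbedding_intCast.isClosedMap (((↑) : ℤ → ℂ) ⁻¹' {s₀}ᶜ)
      (isClosed_discrete _)
    convert! h using 1
    ext z
    simp only [Set.mem_sdiff, Set.mem_range, Set.mem_singleton_iff, Set.mem_image,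
      Set.mem_preimage, Set.mem_compl_iff]
    constructor
    · rintro ⟨⟨j, rfl⟩, h⟩; exact ⟨j, h, rfl⟩
    · rintro ⟨j, h, rfl⟩; exact ⟨⟨j, rfl⟩, h⟩
  have h1 := hcl.isOpen_compl.mem_nhds (show s₀ ∈ (Set.range ((↑) : ℤ → ℂ) \ {s₀})ᶜ by simp)
  filter_upwards [eventually_nhdsWithin_of_eventually_nhds h1, self_mem_nhdsWithin] with z hz hz' j hj
  exact hz ⟨⟨j, hj.symm⟩, hz'⟩

/-- The regularized transform in `mellin_splitOcc` with K = n + 2 is analytic at s = -n, so the pole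
of Γ ζ_* there must cancel that of the boundary term with j = n + 1, whose residue is the Laurent
coefficient. The order n + 2 is the least for which -n lies in the half-plane. The coefficient of
1/y is evaluated directly. -/
theorem occCoeff_eq (st : Statistics) (j : ℕ) :
    (occCoeff st j : ℂ) = integerCoeff st ((j : ℤ) - 1) := by
  cases j with
  | zero =>
    cases st with
    | bose => simp [occCoeff, taylorRem, regOcc, integerCoeff, dslope_same]
    | fermi => simp [occCoeff, taylorRem, regOcc, integerCoeff]
  | succ n =>
    have hic : integerCoeff st (((n + 1 : ℕ) : ℤ) - 1) =
        (-1) ^ n / (n.factorial : ℂ) * statZeta st (-n) := by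
      have e : (((n + 1 : ℕ) : ℤ) - 1) = (n : ℤ) := by push_cast; ring
      have hn : ¬ ((n : ℤ) = -1) := by omega
      rw [e]
      cases st with
      | bose =>
        simp only [integerCoeff, statZeta, if_neg hn]
        push_cast
        rw [Complex.Gamma_nat_eq_factorial, zpow_natCast]; ring
      | fermi =>
        simp only [integerCoeff, statZeta]
        push_cast
        rw [Complex.Gamma_nat_eq_factorial, zpow_natCast]; ring
    rw [hic]
    set s₀ : ℂ := -n with hs₀
    have hne1 : s₀ ≠ 1 := fun h => by
      have := congrArg Complex.re h
      simp [hs₀] at this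
      linarith [(Nat.cast_nonneg n : (0 : ℝ) ≤ n)]
    have hL : Tendsto (fun s : ℂ => (s + n) * Complex.Gamma s * statZeta st s) (𝓝[≠] s₀)
        (𝓝 ((-1) ^ n / (n.factorial : ℂ) * statZeta st (-n))) :=
      (tendsto_add_mul_Gamma n).mul
        ((differentiableAt_statZeta st hne1).continuousAt.tendsto.mono_left nhdsWithin_le_nhds)
    have hre : 1 - ((n + 2 : ℕ) : ℝ) < s₀.re := by simp [hs₀]; linarith
    have hz : Tendsto (fun s : ℂ => s + n) (𝓝[≠] s₀) (𝓝 0) := by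
      have : Tendsto (fun s : ℂ => s + n) (𝓝 s₀) (𝓝 (s₀ + n)) :=
        (by fun_prop : Continuous fun s : ℂ => s + n).tendsto _
      simp only [hs₀, neg_add_cancel] at this
      exact this.mono_left nhdsWithin_le_nhds
    -- After multiplication by s + n, the analytic transform and all boundary terms with j ≤ n
    -- disappear in the limit.
    have hA : Tendsto (fun s : ℂ => (s + n) * mellin (splitOcc st (n + 2) 1) s) (𝓝[≠] s₀) (𝓝 0) := by
      have := hz.mul ((differentiableAt_mellin_splitOcc st (n + 2) one_pos hre
        ).continuousAt.tendsto.mono_left nhdsWithin_le_nhds)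
      simpa using this
    have hB : Tendsto (fun s : ℂ => ∑ j ∈ Finset.range (n + 1), (occCoeff st j : ℂ) *
        ((s + n) / (s + ((j : ℂ) - 1)))) (𝓝[≠] s₀) (𝓝 0) := by
      have h0 : (0 : ℂ) = ∑ j ∈ Finset.range (n + 1), (occCoeff st j : ℂ) *
        (0 / (s₀ + ((j : ℂ) - 1))) := by simp
      rw [h0]
      refine tendsto_finsetSum _ fun j hj => Tendsto.const_mul _ (hz.div ?_ ?_)
      · exact ((by fun_prop : Continuous fun s : ℂ => s + ((j : ℂ) - 1)).tendsto _).mono_left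
          nhdsWithin_le_nhds
      · intro h
        have h1 : (j : ℂ) = ((n + 1 : ℕ) : ℂ) := by push_cast; linear_combination h
        have h2 : j = n + 1 := by exact_mod_cast h1
        have := Finset.mem_range.1 hj
        omega
    have hR := (hA.add hB).add_const (occCoeff st (n + 1) : ℂ)
    rw [zero_add, zero_add] at hR
    refine tendsto_nhds_unique (hR.congr' ?_) hL
    have hev : ∀ᶠ z : ℂ in 𝓝[≠] s₀, 1 - ((n + 2 : ℕ) : ℝ) < z.re :=
      eventually_nhdsWithin_of_eventually_nhds
        ((isOpen_lt continuous_const Complex.continuous_re).mem_nhds hre)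
    filter_upwards [hev, eventually_ne_intCast s₀] with s h1 h2
    have h3 := mellin_splitOcc st (n + 2) one_pos h1 h2
    have hsn : s + n ≠ 0 := fun h => h2 (-n) (by push_cast; linear_combination h)
    have e1 : (s + n) * ((occCoeff st (n + 1) : ℂ) * (((1 : ℝ) : ℂ) ^ (s + (((n + 1 : ℕ) : ℂ) - 1))
        / (s + (((n + 1 : ℕ) : ℂ) - 1)))) = occCoeff st (n + 1) := by
      have : s + (((n + 1 : ℕ) : ℂ) - 1) = s + n := by push_cast; ring
      rw [this]; simp; field_simp
    have e2 : ∑ j ∈ Finset.range (n + 1), (occCoeff st j : ℂ) * ((s + n) / (s + ((j : ℂ) - 1)))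
        = (s + n) * ∑ j ∈ Finset.range (n + 1), (occCoeff st j : ℂ) *
          (((1 : ℝ) : ℂ) ^ (s + ((j : ℂ) - 1)) / (s + ((j : ℂ) - 1))) := by
      rw [Finset.mul_sum]
      refine Finset.sum_congr rfl fun j _ => ?_
      simp only [Complex.ofReal_one, Complex.one_cpow]; ring
    rw [e2, h3, Finset.sum_range_succ _ (n + 1)]
    linear_combination -e1

end HighTemp

end

/-! ### Integrals of functions with a power tail against the occupation function -/

noncomputable section

namespace HighTemp

/-- `∑_{m<n} e_m x^{α - m}`. -/
def powTrunc (α : ℂ) (e : ℕ → ℂ) (n : ℕ) (x : ℝ) : ℂ :=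
  ∑ m ∈ Finset.range n, e m * (x : ℂ) ^ (α - m)

/-- A function that vanishes up to `δ` and has `n` terms of a power expansion at infinity. -/
structure PowerTail (g : ℝ → ℂ) (δ : ℝ) (α : ℂ) (e : ℕ → ℂ) (n : ℕ) : Prop where
  pos : 0 < δ
  vanishes : ∀ x ≤ δ, g x = 0
  locallyIntegrable : LocallyIntegrableOn g (Set.Ioi 0) volume
  isBigO : (fun x => g x - powTrunc α e n x) =O[atTop] fun x : ℝ => x ^ (α.re - n)

/-- The part of `g - powTrunc` beyond `δ`. -/
def tailPart (g : ℝ → ℂ) (δ : ℝ) (α : ℂ) (e : ℕ → ℂ) (n : ℕ) : ℝ → ℂ :=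
  Set.indicator (Set.Ioi δ) fun x => g x - powTrunc α e n x

/-- The meromorphic continuation of `s ↦ ∫_0^∞ x^s g(x) dx`. -/
def sigmaExt (g : ℝ → ℂ) (δ : ℝ) (α : ℂ) (e : ℕ → ℂ) (n : ℕ) (s : ℂ) : ℂ :=
  mellin (tailPart g δ α e n) (s + 1)
    - ∑ m ∈ Finset.range n, e m * ((δ : ℂ) ^ (s + 1 + (α - m)) / (s + 1 + (α - m)))

variable {g : ℝ → ℂ} {δ : ℝ} {α : ℂ} {e : ℕ → ℂ} {n : ℕ}

lemma continuousOn_powTrunc (α : ℂ) (e : ℕ → ℂ) (n : ℕ) :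
    ContinuousOn (powTrunc α e n) (Set.Ioi 0) :=
  continuousOn_finsetSum _ fun _ _ => continuousOn_const.mul fun y hy =>
    (Complex.continuousAt_ofReal_cpow_const y _ (Or.inr (ne_of_gt hy))).continuousWithinAt

lemma PowerTail.locallyIntegrable_excess (h : PowerTail g δ α e n) :
    LocallyIntegrableOn (fun x => g x - powTrunc α e n x) (Set.Ioi 0) volume :=
  h.locallyIntegrable.sub
    ((continuousOn_powTrunc α e n).locallyIntegrableOn measurableSet_Ioi)

lemma PowerTail.locallyIntegrable_tailPart (h : PowerTail g δ α e n) :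
    LocallyIntegrableOn (tailPart g δ α e n) (Set.Ioi 0) volume := by
  intro x hx
  obtain ⟨t, ht, hi⟩ := h.locallyIntegrable_excess x hx
  exact ⟨t, ht, hi.indicator measurableSet_Ioi⟩

lemma PowerTail.tailPart_isBigO_atTop (h : PowerTail g δ α e n) :
    tailPart g δ α e n =O[atTop] fun x : ℝ => x ^ (-(n - α.re)) := by
  have h1 := h.isBigO
  rw [show α.re - n = -(n - α.re) by ring] at h1
  refine h1.congr' ?_ EventuallyEq.rfl
  filter_upwards [eventually_gt_atTop δ] with x hx
  rw [tailPart, Set.indicator_of_mem (Set.mem_Ioi.2 hx)]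

lemma PowerTail.tailPart_isBigO_zero (h : PowerTail g δ α e n) (b : ℝ) :
    tailPart g δ α e n =O[𝓝[>] 0] fun x : ℝ => x ^ (-b) := by
  refine (isBigO_zero _ _).congr' ?_ EventuallyEq.rfl
  filter_upwards [Ioc_mem_nhdsGT h.pos] with x hx
  rw [tailPart, Set.indicator_of_notMem (show x ∉ Set.Ioi δ from fun hx' => not_le.2 hx' hx.2)]

lemma PowerTail.mellinConvergent_tailPart (h : PowerTail g δ α e n) {s : ℂ}
    (hs : s.re + α.re < n) : MellinConvergent (tailPart g δ α e n) s :=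
  mellinConvergent_of_isBigO_rpow (b := s.re - 1) h.locallyIntegrable_tailPart
    h.tailPart_isBigO_atTop (by linarith) (h.tailPart_isBigO_zero _) (by linarith)

lemma PowerTail.differentiableAt_mellin_tailPart (h : PowerTail g δ α e n) {s : ℂ}
    (hs : s.re + α.re < n) : DifferentiableAt ℂ (mellin (tailPart g δ α e n)) s :=
  mellin_differentiableAt_of_isBigO_rpow (b := s.re - 1) h.locallyIntegrable_tailPart
    h.tailPart_isBigO_atTop (by linarith) (h.tailPart_isBigO_zero _) (by linarith)

lemma indicator_powTrunc (S : Set ℝ) (x : ℝ) : Set.indicator S (powTrunc α e n) x =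
    ∑ m ∈ Finset.range n, e m • Set.indicator S (fun x : ℝ => (x : ℂ) ^ (α - m)) x := by
  by_cases hx : x ∈ S
  · simp [Set.indicator_of_mem hx, powTrunc]
  · simp [Set.indicator_of_notMem hx]

/-- Far to the left every power beyond δ is integrable by itself, and its integral is the boundary
term in `sigmaExt`; so `sigmaExt` starts as the genuine moment of g. -/
lemma PowerTail.hasMellin_of_re_lt (h : PowerTail g δ α e n) {s : ℂ}
    (hs : s.re + 1 + α.re < 0) : HasMellin g (s + 1) (sigmaExt g δ α e n s) := by
  have hn : (0 : ℝ) ≤ n := n.cast_nonneg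
  have h1 := hasMellin_sum (Finset.range n) (s := s + 1) (fun m _ =>
    hasMellin_smul (hasMellin_cpow_Ioi_of_pos h.pos (α - m) (s := s + 1)
      (by simp; linarith [(Nat.cast_nonneg m : (0 : ℝ) ≤ m)])) (e m))
  have h2 := hasMellin_add (h.mellinConvergent_tailPart (s := s + 1) (by simp; linarith)) h1.1
  rw [h1.2] at h2
  have e1 : (fun x => tailPart g δ α e n x + ∑ m ∈ Finset.range n, e m •
      Set.indicator (Set.Ioi δ) (fun x : ℝ => (x : ℂ) ^ (α - m)) x) = g := by
    ext x
    rw [← indicator_powTrunc, tailPart]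
    by_cases hx : x ∈ Set.Ioi δ
    · simp [Set.indicator_of_mem hx]
    · simp [Set.indicator_of_notMem hx, h.vanishes x (not_lt.1 hx)]
  rw [e1] at h2
  convert h2 using 1
  simp [sigmaExt, sub_eq_add_neg]

/-- Further right the same boundary terms are integrals of the powers over (0, δ], where g vanishes.
Hence in this strip the continued moment of g is the convergent Mellin transform of g minus its
power expansion. -/
lemma PowerTail.hasMellin_excess (h : PowerTail g δ α e n) {s : ℂ}
    (hs : ∀ m < n, (m : ℝ) < s.re + 1 + α.re) (hs' : s.re + 1 + α.re < n) :
    HasMellin (fun x => g x - powTrunc α e n x) (s + 1) (sigmaExt g δ α e n s) := by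
  have h1 := hasMellin_sum (Finset.range n) (s := s + 1) (fun m hm =>
    hasMellin_smul (hasMellin_cpow_Ioc_of_pos h.pos (α - m) (s := s + 1)
      (by simp; linarith [hs m (Finset.mem_range.1 hm)])) (e m))
  have h2 := hasMellin_sub (h.mellinConvergent_tailPart (s := s + 1) (by simpa using hs')) h1.1
  rw [h1.2] at h2
  have e1 : ∀ x ∈ Set.Ioi (0 : ℝ), tailPart g δ α e n x - ∑ m ∈ Finset.range n, e m •
      Set.indicator (Set.Ioc 0 δ) (fun x : ℝ => (x : ℂ) ^ (α - m)) x
      = g x - powTrunc α e n x := by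
    intro x (hx0 : 0 < x)
    rw [← indicator_powTrunc, tailPart]
    by_cases hx : x ∈ Set.Ioi δ
    · rw [Set.indicator_of_mem hx, Set.indicator_of_notMem (fun h' => not_le.2 hx h'.2), sub_zero]
    · rw [Set.indicator_of_notMem hx, Set.indicator_of_mem (show x ∈ Set.Ioc 0 δ from ⟨hx0, not_lt.1 hx⟩),
        h.vanishes x (not_lt.1 hx)]
  refine ⟨(integrableOn_congr_fun (fun x hx => ?_) measurableSet_Ioi).1 h2.1,
    (setIntegral_congr_fun measurableSet_Ioi fun x hx => ?_).trans h2.2⟩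
  · simp only [e1 x hx]
  · simp only [e1 x hx]

lemma norm_ofReal_cpow {x : ℝ} (hx : 0 < x) (s : ℂ) : ‖(x : ℂ) ^ s‖ = x ^ s.re :=
  Complex.norm_cpow_eq_rpow_re_of_pos hx s

/-- The excess is integrable with the weight `x ^ x₀`. -/
lemma PowerTail.integrable_norm_excess (h : PowerTail g δ α e n) {x₀ : ℝ}
    (hs : ∀ m < n, (m : ℝ) < x₀ + 1 + α.re) (hs' : x₀ + 1 + α.re < n) :
    IntegrableOn (fun x => ‖g x - powTrunc α e n x‖ * x ^ x₀) (Set.Ioi 0) volume := by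
  have h1 := (h.hasMellin_excess (s := x₀) (by simpa using hs) (by simpa using hs')).1
  refine (integrableOn_congr_fun (fun x hx => ?_) measurableSet_Ioi).1 h1.norm
  simp only [norm_smul]
  rw [norm_ofReal_cpow hx, mul_comm]; simp

lemma PowerTail.integrable_excess_mul (h : PowerTail g δ α e n) {x₀ : ℝ}
    (hs : ∀ m < n, (m : ℝ) < x₀ + 1 + α.re) (hs' : x₀ + 1 + α.re < n) {w : ℝ → ℂ}
    (hw : ContinuousOn w (Set.Ioi 0)) {C : ℝ} (hC : ∀ x, 0 < x → ‖w x‖ ≤ C * x ^ x₀) :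
    IntegrableOn (fun x => (g x - powTrunc α e n x) * w x) (Set.Ioi 0) volume := by
  refine ((h.integrable_norm_excess hs hs').const_mul C).mono'
    (h.locallyIntegrable_excess.aestronglyMeasurable.mul
      (hw.aestronglyMeasurable measurableSet_Ioi)) ?_
  filter_upwards [ae_restrict_mem measurableSet_Ioi] with x hx
  rw [norm_mul]
  calc _ ≤ ‖g x - powTrunc α e n x‖ * (C * x ^ x₀) := by gcongr; exact hC x hx
    _ = _ := by ring

lemma bound_occTruncC_mul {st : Statistics} {x₀ β C : ℝ} (hβ : 0 < β)
    (hC : ∀ y, 0 < y → ‖occTruncC st (truncOrder x₀) y‖ ≤ C * y ^ x₀) {x : ℝ} (hx : 0 < x) :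
    ‖occTruncC st (truncOrder x₀) (β * x)‖ ≤ (C * β ^ x₀) * x ^ x₀ := by
  refine (hC _ (by positivity)).trans (le_of_eq ?_)
  rw [Real.mul_rpow hβ.le hx.le]; ring

lemma continuousOn_comp_mul_left {w : ℝ → ℂ} (hw : ContinuousOn w (Set.Ioi 0)) {β : ℝ}
    (hβ : 0 < β) : ContinuousOn (fun x => w (β * x)) (Set.Ioi 0) :=
  hw.comp (by fun_prop) fun x hx => mul_pos hβ hx

/-- The remainder of the high-temperature expansion. -/
def remainder (st : Statistics) (g : ℝ → ℂ) (α : ℂ) (e : ℕ → ℂ) (n : ℕ) (x₀ β : ℝ) : ℂ :=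
  ∫ x in Set.Ioi (0 : ℝ), (g x - powTrunc α e n x) * occTruncC st (truncOrder x₀) (β * x)

lemma PowerTail.integrable_remainder (h : PowerTail g δ α e n) (st : Statistics) {x₀ : ℝ}
    (hx : ∀ l : ℤ, x₀ ≠ l) (hs : ∀ m < n, (m : ℝ) < x₀ + 1 + α.re) (hs' : x₀ + 1 + α.re < n)
    {β : ℝ} (hβ : 0 < β) :
    IntegrableOn (fun x => (g x - powTrunc α e n x) * occTruncC st (truncOrder x₀) (β * x))
      (Set.Ioi 0) volume := by
  obtain ⟨C, -, hC⟩ := exists_bound_occTruncC st hx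
  exact h.integrable_excess_mul hs hs' (continuousOn_comp_mul_left (continuousOn_occTruncC st _) hβ)
    fun x hx => bound_occTruncC_mul hβ hC hx

/-- Since |n_tr(βx)| ≤ C β^x₀ x^x₀ uniformly in β and x, the whole dependence on β factors out of a
convergent integral. -/
lemma PowerTail.remainder_bound (h : PowerTail g δ α e n) (st : Statistics) {x₀ : ℝ}
    (hx : ∀ l : ℤ, x₀ ≠ l) (hs : ∀ m < n, (m : ℝ) < x₀ + 1 + α.re) (hs' : x₀ + 1 + α.re < n) :
    ∃ C, ∀ β, 0 < β → ‖remainder st g α e n x₀ β‖ ≤ C * β ^ x₀ := by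
  obtain ⟨C, hC0, hC⟩ := exists_bound_occTruncC st hx
  refine ⟨C * ∫ x in Set.Ioi (0 : ℝ), ‖g x - powTrunc α e n x‖ * x ^ x₀, fun β hβ => ?_⟩
  have h1 := (h.integrable_norm_excess hs hs').const_mul (C * β ^ x₀)
  have h2 : ‖remainder st g α e n x₀ β‖ ≤ ∫ x in Set.Ioi (0 : ℝ),
      (C * β ^ x₀) * (‖g x - powTrunc α e n x‖ * x ^ x₀) := by
    refine norm_integral_le_of_norm_le h1 ?_
    filter_upwards [ae_restrict_mem measurableSet_Ioi] with x hx
    rw [norm_mul]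
    calc _ ≤ ‖g x - powTrunc α e n x‖ * ((C * β ^ x₀) * x ^ x₀) := by
          gcongr; exact bound_occTruncC_mul hβ hC hx
      _ = _ := by ring
  rw [integral_const_mul] at h2
  linarith

lemma PowerTail.mellin_tailPart_nat (h : PowerTail g δ α e n) {j : ℕ} (hj : (j : ℝ) + α.re < n) :
    IntegrableOn (fun x : ℝ => (x : ℂ) ^ ((j : ℂ) - 1) * tailPart g δ α e n x) (Set.Ioi 0) volume :=
  h.mellinConvergent_tailPart (s := j) (by simpa using hj)

/-- The integral against the occupation function in terms of the coefficients of the power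
expansion, the continued moments, and the remainder. -/
theorem PowerTail.integral_occupation (h : PowerTail g δ α e n) (st : Statistics) {x₀ : ℝ}
    (hx : ∀ l : ℤ, x₀ ≠ l) (hs : ∀ m < n, (m : ℝ) < x₀ + 1 + α.re) (hs' : x₀ + 1 + α.re < n)
    (hα : ∀ j : ℤ, α ≠ j) {β : ℝ} (hβ : 0 < β) :
    ∫ x in Set.Ioi (0 : ℝ), g x * (occupation st (β * x) : ℂ) =
      ∑ m ∈ Finset.range n, e m * ((β : ℂ) ^ (-(α - m + 1)) *
        (Complex.Gamma (α - m + 1) * statZeta st (α - m + 1)))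
      + ∑ j ∈ Finset.range (truncOrder x₀), integerCoeff st ((j : ℤ) - 1) *
        sigmaExt g δ α e n ((j : ℂ) - 1) * (β : ℂ) ^ ((j : ℂ) - 1)
      + remainder st g α e n x₀ β := by
  set K := truncOrder x₀ with hK
  have hβc : (β : ℂ) ≠ 0 := by exact_mod_cast hβ.ne'
  have hre : ∀ m < n, 1 - (K : ℝ) < (α - m + 1).re := fun m hm => by
    have := hs m hm
    have := truncOrder_gt (x₀ := x₀)
    simp; linarith
  -- For x ≤ δ both g and its tail vanish and the split occupation function is the truncated one, so
  -- the right-hand side cancels. For x > δ it is P n + (g - P) ∑ + (g - P)(n - ∑) = g n, where ∑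
  -- denotes the Laurent terms.
  have hpt : ∀ x ∈ Set.Ioi (0 : ℝ), g x * (occupation st (β * x) : ℂ) =
      (∑ m ∈ Finset.range n, e m * ((x : ℂ) ^ (α - m + 1 - 1) • splitOcc st K (β * δ) (β * x)) +
        ∑ j ∈ Finset.range K, ((occCoeff st j : ℂ) * (β : ℂ) ^ ((j : ℂ) - 1)) *
          ((x : ℂ) ^ ((j : ℂ) - 1) * tailPart g δ α e n x)) +
      (g x - powTrunc α e n x) * occTruncC st K (β * x) := by
    intro x (hx0 : 0 < x)
    have e1 : ∑ m ∈ Finset.range n, e m * ((x : ℂ) ^ (α - m + 1 - 1) •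
        splitOcc st K (β * δ) (β * x)) = powTrunc α e n x * splitOcc st K (β * δ) (β * x) := by
      rw [powTrunc, Finset.sum_mul]
      refine Finset.sum_congr rfl fun m _ => ?_
      rw [add_sub_cancel_right, smul_eq_mul, mul_assoc]
    have e2 : ∑ j ∈ Finset.range K, ((occCoeff st j : ℂ) * (β : ℂ) ^ ((j : ℂ) - 1)) *
          ((x : ℂ) ^ ((j : ℂ) - 1) * tailPart g δ α e n x) =
        (∑ j ∈ Finset.range K, (occCoeff st j : ℂ) * ((β * x : ℝ) : ℂ) ^ ((j : ℂ) - 1)) *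
          tailPart g δ α e n x := by
      rw [Finset.sum_mul]
      refine Finset.sum_congr rfl fun j _ => ?_
      rw [Complex.ofReal_mul, Complex.mul_cpow_ofReal_nonneg hβ.le hx0.le]; ring
    rw [e1, e2, occTruncC_eq]
    rcases le_or_gt x δ with hxδ | hxδ
    · rw [splitOcc_of_le st K (by positivity) (by gcongr), h.vanishes x hxδ, tailPart,
        Set.indicator_of_notMem (by simpa using hxδ), occTruncC_eq]
      ring
    · rw [splitOcc_of_gt st K (by gcongr), tailPart, Set.indicator_of_mem (by simpa using hxδ)]
      ring
  have hi1 : ∀ m ∈ Finset.range n, Integrable (fun x : ℝ => e m *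
      ((x : ℂ) ^ (α - m + 1 - 1) • splitOcc st K (β * δ) (β * x)))
      (volume.restrict (Set.Ioi 0)) := fun m hm => by
    refine Integrable.const_mul ?_ _
    exact (MellinConvergent.comp_mul_left (f := splitOcc st K (β * δ)) hβ).2
      (mellinConvergent_splitOcc st K (mul_pos hβ h.pos) (hre m (Finset.mem_range.1 hm)))
  have hi2 : ∀ j ∈ Finset.range K, Integrable (fun x : ℝ =>
      ((occCoeff st j : ℂ) * (β : ℂ) ^ ((j : ℂ) - 1)) *
          ((x : ℂ) ^ ((j : ℂ) - 1) * tailPart g δ α e n x))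
      (volume.restrict (Set.Ioi 0)) := fun j hj => by
    have := lt_of_lt_truncOrder hx (Finset.mem_range.1 hj)
    exact (h.mellin_tailPart_nat (by linarith)).const_mul _
  have hi12 : Integrable (fun x : ℝ =>
      ∑ m ∈ Finset.range n, e m * ((x : ℂ) ^ (α - m + 1 - 1) • splitOcc st K (β * δ) (β * x)) +
        ∑ j ∈ Finset.range K, ((occCoeff st j : ℂ) * (β : ℂ) ^ ((j : ℂ) - 1)) *
          ((x : ℂ) ^ ((j : ℂ) - 1) * tailPart g δ α e n x)) (volume.restrict (Set.Ioi 0)) :=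
    (integrable_finsetSum _ hi1).add (integrable_finsetSum _ hi2)
  rw [setIntegral_congr_fun measurableSet_Ioi hpt, integral_add hi12
    (h.integrable_remainder st hx hs hs' hβ), integral_add (integrable_finsetSum _ hi1)
    (integrable_finsetSum _ hi2), integral_finsetSum _ hi1, integral_finsetSum _ hi2]
  simp only [integral_const_mul]
  change ∑ m ∈ Finset.range n, e m * mellin (fun x => splitOcc st K (β * δ) (β * x)) (α - m + 1) +
    ∑ j ∈ Finset.range K, ((occCoeff st j : ℂ) * (β : ℂ) ^ ((j : ℂ) - 1)) *
      mellin (tailPart g δ α e n) j + remainder st g α e n x₀ β = _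
  congr 1
  -- The cut at δ in x is a cut at βδ in y = βx; splitting the power of βδ shows that each boundary
  -- term carries β^(j-1).
  have e3 : ∀ m ∈ Finset.range n, e m * mellin (fun x => splitOcc st K (β * δ) (β * x)) (α - m + 1)
      = e m * ((β : ℂ) ^ (-(α - m + 1)) * (Complex.Gamma (α - m + 1) * statZeta st (α - m + 1)))
      - ∑ j ∈ Finset.range K, (occCoeff st j : ℂ) * (β : ℂ) ^ ((j : ℂ) - 1) *
        (e m * ((δ : ℂ) ^ ((j : ℂ) + (α - m)) / ((j : ℂ) + (α - m)))) := by
    intro m hm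
    rw [mellin_comp_mul_left _ _ hβ, mellin_splitOcc st K (mul_pos hβ h.pos)
      (hre m (Finset.mem_range.1 hm)) (fun j hj => hα (j + m - 1) ?_)]
    · rw [smul_eq_mul, mul_sub, mul_sub, Finset.mul_sum, Finset.mul_sum]
      congr 1
      refine Finset.sum_congr rfl fun j _ => ?_
      have e4 : α - m + 1 + ((j : ℂ) - 1) = (j : ℂ) + (α - m) := by ring
      rw [e4, Complex.ofReal_mul, Complex.mul_cpow_ofReal_nonneg hβ.le h.pos.le]
      have e5 : (β : ℂ) ^ ((j : ℂ) - 1) = (β : ℂ) ^ (-(α - m + 1)) * (β : ℂ) ^ ((j : ℂ) + (α - m)) := by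
        rw [← Complex.cpow_add _ _ hβc]; congr 1; ring
      rw [e5]; ring
    · push_cast; linear_combination hj
  -- Exchanging the sums moves the boundary terms to the moments of the tail with the same j;
  -- together they are `sigmaExt` at s = j - 1.
  rw [Finset.sum_congr rfl e3, Finset.sum_sub_distrib, Finset.sum_comm, sub_add_eq_add_sub,
    add_sub_assoc, ← Finset.sum_sub_distrib]
  congr 1
  refine Finset.sum_congr rfl fun j _ => ?_
  rw [← occCoeff_eq, sigmaExt, sub_add_cancel, ← Finset.mul_sum]
  ring

/-- Here g is its tail part plus the powers beyond δ. The occupation function is at most C y^p for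
every p ≤ -1, and a sufficiently negative p makes the tail part integrable. -/
lemma PowerTail.integrableOn_mul_occupation (h : PowerTail g δ α e n) (st : Statistics) {β : ℝ}
    (hβ : 0 < β) :
    IntegrableOn (fun x => g x * (occupation st (β * x) : ℂ)) (Set.Ioi 0) volume := by
  have h1 : IntegrableOn (fun x => tailPart g δ α e n x * (occupation st (β * x) : ℂ))
      (Set.Ioi 0) volume := by
    have hb : ∃ C, 0 ≤ C ∧ ∀ y, 0 < y → ‖(occupation st y : ℂ)‖ ≤ C * y ^ (min (-1) (n - α.re - 2)) :=
      exists_bound_rpow (continuousOn_occupation st)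
        (isBigO_ofReal (occupation_derivs_isBigO st _).1)
        (p := -1) (by
          have := isBigO_ofReal (occTrunc_isBigO_zero st 0).1
          rw [occTrunc_zero] at this
          simpa using this)
        le_rfl (min_le_left _ _)
    obtain ⟨C, -, hC⟩ := hb
    have h2 := h.mellinConvergent_tailPart (s := (min (-1) (n - α.re - 2) + 1 : ℝ))
      (by simp only [Complex.ofReal_re]; linarith [min_le_right (-1 : ℝ) (n - α.re - 2)])
    refine (h2.norm.const_mul (C * β ^ (min (-1) (n - α.re - 2)))).mono'
      (h.locallyIntegrable_tailPart.aestronglyMeasurable.mul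
        ((continuousOn_comp_mul_left (continuousOn_occupation st) hβ).aestronglyMeasurable
          measurableSet_Ioi)) ?_
    filter_upwards [ae_restrict_mem measurableSet_Ioi] with x hx
    have hx' : 0 < x := hx
    rw [norm_mul, norm_smul, norm_ofReal_cpow hx]
    have h3 := hC (β * x) (by positivity)
    rw [Real.mul_rpow hβ.le hx'.le] at h3
    have h4 : ((min (-1) (n - α.re - 2) + 1 : ℝ) - 1 : ℂ).re = min (-1) (n - α.re - 2) := by
      simp [-Complex.ofReal_add]
    push_cast at h4 ⊢
    rw [h4]
    calc _ ≤ ‖tailPart g δ α e n x‖ * (C * (β ^ (min (-1) (n - α.re - 2)) *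
          x ^ (min (-1) (n - α.re - 2)))) := by gcongr
      _ = _ := by ring
  have h2 : IntegrableOn (fun x => Set.indicator (Set.Ioi δ) (powTrunc α e n) x *
      (occupation st (β * x) : ℂ)) (Set.Ioi 0) volume := by
    have : ∀ m ∈ Finset.range n, Integrable (fun x : ℝ => e m * ((x : ℂ) ^ (α - m + 1 - 1) •
        splitOcc st 0 (β * δ) (β * x))) (volume.restrict (Set.Ioi δ)) := fun m hm => by
      refine Integrable.const_mul ?_ _
      -- Beyond δ the split function does not depend on K; a large K only secures convergence at 0.
      obtain ⟨K, hK⟩ := exists_nat_gt (1 - (α - m + 1).re)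
      have h3 := (MellinConvergent.comp_mul_left (f := splitOcc st K (β * δ)) hβ).2
        (mellinConvergent_splitOcc st K (mul_pos hβ h.pos) (s := α - m + 1) (by linarith))
      refine (integrableOn_congr_fun (fun x hx => ?_) measurableSet_Ioi).1
        (h3.mono_set (Set.Ioi_subset_Ioi h.pos.le))
      have : β * δ < β * x := by have : δ < x := hx; gcongr
      simp only [splitOcc_of_gt st _ this]
    have h4 := integrable_finsetSum _ this
    have h5 : IntegrableOn (fun x => powTrunc α e n x * (occupation st (β * x) : ℂ))
        (Set.Ioi δ) volume := by
      refine (integrableOn_congr_fun (fun x hx => ?_) measurableSet_Ioi).1 h4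
      have : β * δ < β * x := by have : δ < x := hx; gcongr
      simp only [splitOcc_of_gt st _ this, powTrunc, Finset.sum_mul, add_sub_cancel_right,
        smul_eq_mul, mul_assoc]
    have h6 := (integrable_indicator_iff measurableSet_Ioi).2 h5
    refine (h6.integrableOn (s := Set.Ioi 0)).congr (Eventually.of_forall fun x => ?_)
    by_cases hx : x ∈ Set.Ioi δ
    · simp [Set.indicator_of_mem hx]
    · simp [Set.indicator_of_notMem hx]
  refine (h1.add h2).congr (Eventually.of_forall fun x => ?_)
  simp only [Pi.add_apply, tailPart]
  by_cases hx : x ∈ Set.Ioi δ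
  · simp only [Set.indicator_of_mem hx]; ring
  · simp [Set.indicator_of_notMem hx, h.vanishes x (not_lt.1 hx)]

/-- The remainder as an integral over a vertical line. -/
theorem PowerTail.remainder_eq_contour (h : PowerTail g δ α e n) (st : Statistics) {x₀ : ℝ}
    (hx : ∀ l : ℤ, x₀ ≠ l) (hs : ∀ m < n, (m : ℝ) < x₀ + 1 + α.re) (hs' : x₀ + 1 + α.re < n)
    {β : ℝ} (hβ : 0 < β) :
    Integrable (fun t : ℝ => Complex.Gamma (-(x₀ + t * Complex.I)) *
      statZeta st (-(x₀ + t * Complex.I)) * sigmaExt g δ α e n (x₀ + t * Complex.I) *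
      (β : ℂ) ^ (x₀ + t * Complex.I)) volume ∧
    remainder st g α e n x₀ β = 1 / (2 * Real.pi : ℂ) * ∫ t : ℝ,
      Complex.Gamma (-(x₀ + t * Complex.I)) *
      statZeta st (-(x₀ + t * Complex.I)) * sigmaExt g δ α e n (x₀ + t * Complex.I) *
      (β : ℂ) ^ (x₀ + t * Complex.I) := by
  set K := truncOrder x₀
  set M : ℝ → ℂ := fun t => mellin (occTruncC st K) (-(x₀ + t * Complex.I)) with hM
  set H : ℝ → ℂ := fun x => g x - powTrunc α e n x with hH
  have hMi : Integrable M := by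
    have h1 := (verticalIntegrable_occTruncC st hx).comp_neg
    refine h1.congr (Eventually.of_forall fun t => ?_)
    simp only [hM]
    congr 1; push_cast; ring
  have hMeq : ∀ t, M t = Complex.Gamma (-(x₀ + t * Complex.I)) *
      statZeta st (-(x₀ + t * Complex.I)) := fun t => by
    simp only [hM]
    exact mellin_occTruncC st hx (by simp)
  have hHi : Integrable (fun x : ℝ => (x : ℂ) ^ (x₀ : ℂ) * H x) (volume.restrict (Set.Ioi 0)) := by
    have := (h.hasMellin_excess (s := x₀) (by simpa using hs) (by simpa using hs')).1
    simpa [MellinConvergent] using! this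
  have hprod := hHi.mul_prod hMi
  -- Fubini's kernel: the t-integral of F is Mellin inversion of n_tr, the x-integral is the Mellin
  -- transform of the excess.
  set F : ℝ × ℝ → ℂ := fun p => H p.1 * (((β * p.1 : ℝ) : ℂ) ^ (x₀ + p.2 * Complex.I) * M p.2)
    with hF
  have hmem : ∀ᵐ p : ℝ × ℝ ∂((volume.restrict (Set.Ioi 0)).prod volume), 0 < p.1 := by
    have : (volume.restrict (Set.Ioi (0 : ℝ))).prod (volume : Measure ℝ) =
        (volume.prod volume).restrict (Set.Ioi 0 ×ˢ Set.univ) := by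
      rw [← Measure.prod_restrict, Measure.restrict_univ]
    rw [this]
    filter_upwards [ae_restrict_mem (measurableSet_Ioi.prod MeasurableSet.univ)] with p hp using hp.1
  -- F is the integrable product x^x₀ H(x) M(t) times β^(x₀+it) x^(it), a factor of constant modulus
  -- β^x₀.
  have hmeas : Measurable fun p : ℝ × ℝ => (β : ℂ) ^ (x₀ + p.2 * Complex.I) *
      Complex.exp (p.2 * Real.log p.1 * Complex.I) := by
    have h1 : Measurable fun p : ℝ × ℝ => (β : ℂ) ^ (x₀ + p.2 * Complex.I) := by
      have : Continuous fun p : ℝ × ℝ => (β : ℂ) ^ ((x₀ : ℂ) + p.2 * Complex.I) :=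
        Continuous.const_cpow (by fun_prop) (Or.inl (by exact_mod_cast hβ.ne'))
      exact this.measurable
    have h2 : Measurable fun p : ℝ × ℝ => ((p.2 : ℂ) * Real.log p.1 * Complex.I) :=
      ((Complex.measurable_ofReal.comp measurable_snd).mul
        (Complex.measurable_ofReal.comp (Real.measurable_log.comp measurable_fst))).mul_const _
    exact h1.mul (Complex.measurable_exp.comp h2)
  have hFi : Integrable F ((volume.restrict (Set.Ioi 0)).prod volume) := by
    have h1 := hprod.bdd_mul (c := β ^ x₀) hmeas.aestronglyMeasurable
      (Eventually.of_forall fun p => by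
        rw [norm_mul, norm_ofReal_cpow hβ, Complex.norm_exp]; simp)
    refine h1.congr ?_
    filter_upwards [hmem] with p hp
    have hpc : (p.1 : ℂ) ≠ 0 := by exact_mod_cast hp.ne'
    simp only [hF]
    rw [Complex.ofReal_mul, Complex.mul_cpow_ofReal_nonneg hβ.le hp.le, Complex.cpow_add (x := (p.1 : ℂ)) _ _ hpc,
      Complex.cpow_def_of_ne_zero hpc (p.2 * Complex.I), ← Complex.ofReal_log hp.le]
    rw [show ((Real.log p.1 : ℝ) : ℂ) * (p.2 * Complex.I) = p.2 * Real.log p.1 * Complex.I by ring]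
    ring
  have hinner : ∀ t : ℝ, ∫ x in Set.Ioi (0 : ℝ), F (x, t) =
      Complex.Gamma (-(x₀ + t * Complex.I)) * statZeta st (-(x₀ + t * Complex.I)) *
      sigmaExt g δ α e n (x₀ + t * Complex.I) * (β : ℂ) ^ (x₀ + t * Complex.I) := by
    intro t
    have h1 := (h.hasMellin_excess (s := x₀ + t * Complex.I) (by simpa using hs)
      (by simpa using hs')).2
    rw [← hMeq, ← h1, mellin]
    have h2 : ∀ x ∈ Set.Ioi (0 : ℝ), F (x, t) = (M t * (β : ℂ) ^ (x₀ + t * Complex.I)) *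
        ((x : ℂ) ^ (x₀ + t * Complex.I + 1 - 1) • H x) := by
      intro x (hx0 : 0 < x)
      simp only [hF]
      rw [Complex.ofReal_mul, Complex.mul_cpow_ofReal_nonneg hβ.le hx0.le, add_sub_cancel_right,
        smul_eq_mul]
      ring
    rw [setIntegral_congr_fun measurableSet_Ioi h2, integral_const_mul]
    ring
  refine ⟨(hFi.integral_prod_right).congr (Eventually.of_forall hinner), ?_⟩
  have h3 : remainder st g α e n x₀ β = ∫ x in Set.Ioi (0 : ℝ), 1 / (2 * Real.pi : ℂ) *
      ∫ t : ℝ, F (x, t) := by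
    refine setIntegral_congr_fun measurableSet_Ioi fun x (hx0 : 0 < x) => ?_
    rw [occTruncC_eq_integral st hx (mul_pos hβ hx0), mul_left_comm, ← integral_const_mul]
  rw [h3, integral_const_mul, integral_integral_swap hFi]
  simp only [hinner]

end HighTemp

end

/-! ### Translation by μ and uniqueness of the continued moments -/

noncomputable section

namespace HighTemp

/-- The generalized binomial coefficient `a (a - 1) ⋯ (a - n + 1) / n!`. -/
def genBinom : ℕ → ℂ → ℂ
  | 0, _ => 1
  | n + 1, a => genBinom n (a - 1) * a / (n + 1)

lemma continuous_genBinom (n : ℕ) : Continuous (genBinom n) := by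
  induction n with
  | zero => exact continuous_const
  | succ n ih =>
    have := ih.comp (by fun_prop : Continuous fun a : ℂ => a - 1)
    exact (this.mul continuous_id).div_const _

/-- It absorbs the binomial coefficients of the shift into Gamma factors, which produces Γ(D - 2ν -
m + n)/n! in the exact formula. -/
lemma Gamma_add_nat (n : ℕ) (a : ℂ) (ha : ∀ j : ℤ, a ≠ j) :
    Complex.Gamma (a + 1 + n) = n.factorial * genBinom n (a + n) * Complex.Gamma (a + 1) := by
  induction n with
  | zero => simp [genBinom]
  | succ n ih =>
    have hne : a + 1 + n ≠ 0 := fun h => ha (-1 - n) (by push_cast; linear_combination h)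
    have h1 : a + 1 + ((n + 1 : ℕ) : ℂ) = (a + 1 + n) + 1 := by push_cast; ring
    rw [h1, Complex.Gamma_add_one _ hne, ih, genBinom, Nat.factorial_succ]
    have h2 : a + ((n + 1 : ℕ) : ℂ) - 1 = a + n := by push_cast; ring
    have h3 : (n + 1 : ℂ) ≠ 0 := by exact_mod_cast Nat.succ_ne_zero n
    rw [h2]; push_cast; field_simp; ring

lemma one_add_rpow_le {u p : ℝ} (hu : |u| ≤ 1 / 2) : (1 + u) ^ p ≤ 2 ^ |p| := by
  obtain ⟨h1, h2⟩ := abs_le.1 hu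
  rcases le_total 0 p with hp | hp
  · rw [abs_of_nonneg hp]
    exact Real.rpow_le_rpow (by linarith) (by linarith) hp
  · rw [abs_of_nonpos hp]
    calc (1 + u) ^ p ≤ (1 / 2 : ℝ) ^ p :=
          Real.rpow_le_rpow_of_nonpos (by norm_num) (by linarith) hp
      _ = 2 ^ (-p) := by rw [one_div, Real.inv_rpow (by norm_num), Real.rpow_neg (by norm_num)]

lemma one_add_ofReal_mem_slitPlane {u : ℝ} (hu : |u| ≤ 1 / 2) : (1 + (u : ℂ)) ∈ Complex.slitPlane := by
  refine Or.inl ?_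
  simp; linarith [(abs_le.1 hu).1]

/-- Taylor's formula for `(1 + u)^a`, uniformly for bounded exponents. -/
lemma binomial_remainder (J : ℕ) : ∀ A : ℝ, ∃ C, 0 ≤ C ∧ ∀ a : ℂ, ‖a‖ ≤ A → ∀ u : ℝ, |u| ≤ 1 / 2 →
    ‖(1 + (u : ℂ)) ^ a - ∑ n ∈ Finset.range J, genBinom n a * (u : ℂ) ^ n‖ ≤ C * |u| ^ J := by
  induction J with
  | zero =>
    intro A
    refine ⟨2 ^ A, by positivity, fun a ha u hu => ?_⟩
    have h1 : (1 + (u : ℂ)) = ((1 + u : ℝ) : ℂ) := by push_cast; rfl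
    simp only [Finset.range_zero, Finset.sum_empty, sub_zero, pow_zero, mul_one]
    rw [h1, norm_ofReal_cpow (by linarith [(abs_le.1 hu).1])]
    exact (one_add_rpow_le hu).trans (Real.rpow_le_rpow_of_exponent_le (by norm_num)
      ((Complex.abs_re_le_norm a).trans ha))
  | succ J ih =>
    intro A
    -- The derivative in u of the remainder of order J + 1 at exponent a is a times the remainder of
    -- order J at a - 1, whence the bound A + 1; the mean value inequality then gains one power of
    -- |u|.
    obtain ⟨C, hC0, hC⟩ := ih (A + 1)
    refine ⟨|A| * C, by positivity, fun a ha u hu => ?_⟩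
    have hd : ∀ v : ℝ, |v| ≤ 1 / 2 → HasDerivAt (fun v : ℝ => (1 + (v : ℂ)) ^ a -
        ∑ n ∈ Finset.range (J + 1), genBinom n a * (v : ℂ) ^ n)
        (a * ((1 + (v : ℂ)) ^ (a - 1) - ∑ n ∈ Finset.range J, genBinom n (a - 1) * (v : ℂ) ^ n)) v := by
      intro v hv
      have h1 : HasDerivAt (fun z : ℂ => (1 + z) ^ a) (a * (1 + (v : ℂ)) ^ (a - 1) * 1) (v : ℂ) :=
        HasDerivAt.cpow_const ((hasDerivAt_id _).const_add 1) (one_add_ofReal_mem_slitPlane hv)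
      have h2 : HasDerivAt (fun z : ℂ => ∑ n ∈ Finset.range (J + 1), genBinom n a * z ^ n)
          (∑ n ∈ Finset.range (J + 1), genBinom n a * (n * (v : ℂ) ^ (n - 1))) (v : ℂ) :=
        HasDerivAt.fun_sum fun n _ => (hasDerivAt_pow n _).const_mul _
      have h3 := (h1.sub h2).comp_ofReal
      convert! h3 using 1
      rw [Finset.sum_range_succ', mul_sub, Finset.mul_sum]
      simp only [Nat.cast_zero, zero_mul, mul_zero, add_zero, mul_one, genBinom]
      congr 1
      refine Finset.sum_congr rfl fun n _ => ?_
      have h3 : (n + 1 : ℂ) ≠ 0 := by exact_mod_cast Nat.succ_ne_zero n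
      push_cast; field_simp
      try simp
    have hmv := Convex.norm_image_sub_le_of_norm_hasDerivWithin_le (𝕜 := ℝ)
      (s := Set.Icc (-|u|) |u|) (C := |A| * C * |u| ^ J)
      (fun v hv => (hd v ((abs_le.2 hv).trans hu)).hasDerivWithinAt) (fun v hv => ?_)
      (convex_Icc _ _) (x := 0) (y := u) (by simp) (abs_le.1 le_rfl)
    · have h0 : (1 + ((0 : ℝ) : ℂ)) ^ a -
          ∑ n ∈ Finset.range (J + 1), genBinom n a * ((0 : ℝ) : ℂ) ^ n = 0 := by
        rw [Finset.sum_range_succ']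
        simp [genBinom]
      rw [h0, sub_zero, sub_zero, Real.norm_eq_abs] at hmv
      rw [pow_succ, ← mul_assoc]
      exact hmv
    · have hv' : |v| ≤ |u| := abs_le.2 hv
      rw [norm_mul]
      have h1 := hC (a - 1) ((norm_sub_le _ _).trans (by simpa using ha)) v (hv'.trans hu)
      calc _ ≤ |A| * (C * |v| ^ J) := by gcongr; exact ha.trans (le_abs_self A)
        _ ≤ |A| * (C * |u| ^ J) := by gcongr
        _ = _ := by ring

/-- The coefficients of the power expansion of `x ↦ f (x + μ)`. -/
def shiftCoeff (α : ℂ) (c : ℕ → ℂ) (μ : ℝ) (m : ℕ) : ℂ :=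
  ∑ k ∈ Finset.range (m + 1), c k * genBinom (m - k) (α - k) * (μ : ℂ) ^ (m - k)

/-- Power expansions may be translated, uniformly for bounded exponents and coefficients. -/
lemma shift_expansion (A B C R μ : ℝ) (N : ℕ) : ∃ C' R' : ℝ, 0 < R' ∧ ∀ (α : ℂ) (c : ℕ → ℂ)
    (f : ℝ → ℂ), ‖α‖ ≤ A → (∀ k < N, ‖c k‖ ≤ B) →
    (∀ ω, R ≤ ω → ‖f ω - powTrunc α c N ω‖ ≤ C * ω ^ (α.re - N)) →
    ∀ x, R' ≤ x → ‖f (x + μ) - powTrunc α (shiftCoeff α c μ) N x‖ ≤ C' * x ^ (α.re - N) := by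
  -- The k-th power already carries x^(-k), so N - k binomial terms suffice, and its exponent is
  -- bounded by A + k.
  choose Cb hCb0 hCb using fun k : ℕ => binomial_remainder (N - k) (A + k)
  refine ⟨|C| * 2 ^ (A + N) + ∑ k ∈ Finset.range N, |B| * (Cb k * |μ| ^ (N - k)),
    -- For x ≥ 2|μ| the ratio u = μ/x is at most 1/2 in modulus; for x ≥ R + |μ| the point x + μ
    -- lies where the expansion of f holds.
    max 1 (max (2 * |μ|) (R + |μ|)), by positivity, fun α c f hα hc hf x hx => ?_⟩
  have hx1 : 1 ≤ x := (le_max_left _ _).trans hx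
  have hx2 : 2 * |μ| ≤ x := ((le_max_left _ _).trans (le_max_right _ _)).trans hx
  have hx3 : R + |μ| ≤ x := ((le_max_right _ _).trans (le_max_right _ _)).trans hx
  have hx0 : 0 < x := by linarith
  have hxc : (x : ℂ) ≠ 0 := by exact_mod_cast hx0.ne'
  set u : ℝ := μ / x with hu
  have hu2 : |u| ≤ 1 / 2 := by
    rw [hu, abs_div, abs_of_pos hx0, div_le_iff₀ hx0]; linarith
  have hu1 : 0 < 1 + u := by linarith [(abs_le.1 hu2).1]
  have hω : x + μ = x * (1 + u) := by rw [hu]; field_simp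
  have hpow : ∀ b : ℂ, ((x + μ : ℝ) : ℂ) ^ b = (x : ℂ) ^ b * (1 + (u : ℂ)) ^ b := fun b => by
    rw [hω, Complex.ofReal_mul, Complex.mul_cpow_ofReal_nonneg hx0.le hu1.le]; push_cast; rfl
  -- Summing over k and the binomial index i with k + i = m fixed gives exactly the shifted
  -- coefficients.
  have hP : powTrunc α (shiftCoeff α c μ) N x = ∑ k ∈ Finset.range N, c k * (x : ℂ) ^ (α - k) *
      ∑ i ∈ Finset.range (N - k), genBinom i (α - k) * (u : ℂ) ^ i := by
    have h1 := Finset.sum_range_diag_flip N fun k i =>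
      c k * (genBinom i (α - k) * (μ : ℂ) ^ i) * (x : ℂ) ^ (α - k - i)
    have h2 : powTrunc α (shiftCoeff α c μ) N x = ∑ m ∈ Finset.range N, ∑ k ∈ Finset.range (m + 1),
        c k * (genBinom (m - k) (α - k) * (μ : ℂ) ^ (m - k)) *
          (x : ℂ) ^ (α - k - ((m - k : ℕ) : ℂ)) := by
      refine Finset.sum_congr rfl fun m _ => ?_
      rw [shiftCoeff, Finset.sum_mul]
      refine Finset.sum_congr rfl fun k hk => ?_
      rw [Nat.cast_sub (by have := Finset.mem_range.1 hk; omega)]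
      have : α - k - ((m : ℂ) - k) = α - m := by ring
      rw [this]; ring
    rw [h2, h1]
    refine Finset.sum_congr rfl fun k _ => ?_
    rw [Finset.mul_sum]
    refine Finset.sum_congr rfl fun i _ => ?_
    rw [hu, Complex.cpow_sub _ _ hxc, Complex.cpow_natCast]
    push_cast; rw [div_pow]; ring
  have hsplit : f (x + μ) - powTrunc α (shiftCoeff α c μ) N x =
      (f (x + μ) - powTrunc α c N (x + μ)) + ∑ k ∈ Finset.range N, c k * (x : ℂ) ^ (α - k) *
        ((1 + (u : ℂ)) ^ (α - k) - ∑ i ∈ Finset.range (N - k), genBinom i (α - k) * (u : ℂ) ^ i) := by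
    simp only [mul_sub, Finset.sum_sub_distrib]
    rw [← hP]
    have : powTrunc α c N (x + μ) =
        ∑ k ∈ Finset.range N, c k * (x : ℂ) ^ (α - k) * (1 + (u : ℂ)) ^ (α - k) := by
      refine Finset.sum_congr rfl fun k _ => ?_
      rw [hpow, mul_assoc]
    rw [this]; ring
  rw [hsplit, add_mul]
  refine (norm_add_le _ _).trans (add_le_add ?_ ?_)
  · have h1 := hf (x + μ) (by linarith [neg_abs_le μ])
    refine h1.trans ?_
    rw [hω, Real.mul_rpow hx0.le hu1.le]
    have h2 : |α.re - N| ≤ A + N := by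
      refine (abs_sub _ _).trans (add_le_add ((Complex.abs_re_le_norm α).trans hα) ?_)
      rw [abs_of_nonneg (by positivity)]
    calc C * (x ^ (α.re - N) * (1 + u) ^ (α.re - N))
        ≤ |C| * (x ^ (α.re - N) * 2 ^ (A + N)) := by
          gcongr
          · exact le_abs_self C
          · exact (one_add_rpow_le hu2).trans
              (Real.rpow_le_rpow_of_exponent_le (by norm_num) h2)
      _ = _ := by ring
  · rw [Finset.sum_mul]
    refine (norm_sum_le _ _).trans (Finset.sum_le_sum fun k hk => ?_)
    have hkN := Finset.mem_range.1 hk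
    rw [norm_mul, norm_mul, norm_ofReal_cpow hx0]
    have h1 := hCb k (α - k) ((norm_sub_le _ _).trans (by simpa using hα)) u hu2
    have h2 : x ^ (α - k).re * |u| ^ (N - k) = |μ| ^ (N - k) * x ^ (α.re - N) := by
      rw [hu, abs_div, abs_of_pos hx0, div_pow, ← Real.rpow_natCast x, mul_div_assoc',
        mul_comm (x ^ (α - k).re), mul_div_assoc, ← Real.rpow_sub hx0, Nat.cast_sub hkN.le]
      congr 2
      simp
    calc ‖c k‖ * x ^ (α - k).re * _ ≤ |B| * x ^ (α - k).re * (Cb k * |u| ^ (N - k)) := by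
          gcongr; exact (hc k hkN).trans (le_abs_self B)
      _ = |B| * Cb k * (x ^ (α - k).re * |u| ^ (N - k)) := by ring
      _ = _ := by rw [h2]; ring

/-- The function `x ↦ f (x + μ)`, cut off at `x = ω₀ - μ`. -/
def shifted (f : ℝ → ℂ) (ω₀ μ : ℝ) : ℝ → ℂ :=
  Set.indicator (Set.Ioi (ω₀ - μ)) fun x => f (x + μ)

variable {f : ℝ → ℂ} {ω₀ μ : ℝ}

lemma shifted_of_gt {x : ℝ} (hx : ω₀ - μ < x) : shifted f ω₀ μ x = f (x + μ) :=
  Set.indicator_of_mem (show x ∈ Set.Ioi (ω₀ - μ) from hx) _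

lemma shifted_of_le {x : ℝ} (hx : x ≤ ω₀ - μ) : shifted f ω₀ μ x = 0 :=
  Set.indicator_of_notMem (show x ∉ Set.Ioi (ω₀ - μ) from not_lt.2 hx) _

/-- On (0, ω₀] the function f is zero, so cutting at ω₀ instead of 0 changes nothing; for ω ≤ 0 the
values of f are unconstrained and both sides discard them. -/
lemma indicator_eq_shifted (hf : Admissible f ω₀) (hω : 0 < ω₀) (F : ℝ → ℂ) (ω : ℝ) :
    Set.indicator (Set.Ioi 0) (fun ω => f ω * F (ω - μ)) ω =
      shifted f ω₀ μ (ω - μ) * F (ω - μ) := by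
  rcases lt_or_ge ω₀ ω with h | h
  · rw [Set.indicator_of_mem (show ω ∈ Set.Ioi 0 from hω.trans h), shifted_of_gt (by linarith),
      sub_add_cancel]
  · rw [shifted_of_le (by linarith), zero_mul]
    rcases lt_or_ge 0 ω with h0 | h0
    · rw [Set.indicator_of_mem (show ω ∈ Set.Ioi 0 from h0), hf.vanishes ω ⟨h0.le, h⟩, zero_mul]
    · exact Set.indicator_of_notMem (show ω ∉ Set.Ioi 0 from not_lt.2 h0) _

lemma indicator_shifted_mul (hμ : μ < ω₀) (F : ℝ → ℂ) :
    Set.indicator (Set.Ioi 0) (fun x => shifted f ω₀ μ x * F x) =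
      fun x => shifted f ω₀ μ x * F x := by
  ext x
  rcases lt_or_ge 0 x with h0 | h0
  · exact Set.indicator_of_mem (show x ∈ Set.Ioi 0 from h0) _
  · rw [Set.indicator_of_notMem (show x ∉ Set.Ioi 0 from not_lt.2 h0),
      shifted_of_le (by linarith), zero_mul]

lemma integral_shifted (hf : Admissible f ω₀) (hω : 0 < ω₀) (hμ : μ < ω₀) (F : ℝ → ℂ) :
    ∫ ω in Set.Ioi (0 : ℝ), f ω * F (ω - μ) = ∫ x in Set.Ioi (0 : ℝ), shifted f ω₀ μ x * F x := by
  rw [← integral_indicator measurableSet_Ioi, ← integral_indicator measurableSet_Ioi,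
    indicator_shifted_mul hμ]
  simp only [indicator_eq_shifted hf hω]
  exact integral_sub_right_eq_self (fun x => shifted f ω₀ μ x * F x) μ

lemma integrableOn_shifted_iff (hf : Admissible f ω₀) (hω : 0 < ω₀) (hμ : μ < ω₀) (F : ℝ → ℂ) :
    IntegrableOn (fun ω => f ω * F (ω - μ)) (Set.Ioi 0) volume ↔
      IntegrableOn (fun x => shifted f ω₀ μ x * F x) (Set.Ioi 0) volume := by
  rw [← integrable_indicator_iff measurableSet_Ioi, ← integrable_indicator_iff measurableSet_Ioi,
    indicator_shifted_mul hμ]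
  have : Set.indicator (Set.Ioi 0) (fun ω => f ω * F (ω - μ)) =
      fun ω => (fun x => shifted f ω₀ μ x * F x) (ω - μ) := funext (indicator_eq_shifted hf hω F)
  rw [this]
  refine ⟨fun h => ?_, fun h => h.comp_sub_right μ⟩
  simpa using h.comp_add_right μ

lemma locallyIntegrable_shifted (hf : Admissible f ω₀) :
    LocallyIntegrable (shifted f ω₀ μ) volume := by
  rw [locallyIntegrable_iff]
  intro k hk
  obtain ⟨r, hr⟩ := hk.isBounded.subset_closedBall 0
  rw [Real.closedBall_eq_Icc] at hr
  refine IntegrableOn.mono_set ?_ hr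
  have h1 : IntegrableOn f (Set.Icc (0 - r + μ) (0 + r + μ) ∩ Set.Ici ω₀) volume :=
    hf.locallyIntegrable.integrableOn_compact_subset Set.inter_subset_right
      (isCompact_Icc.inter_right isClosed_Ici)
  have h2 : IntegrableOn (Set.indicator (Set.Ioi ω₀) f) (Set.Icc (0 - r + μ) (0 + r + μ)) volume := by
    have := (h1.mono_set (Set.inter_subset_inter_right _ Set.Ioi_subset_Ici_self))
    rw [Set.inter_comm] at this
    rw [IntegrableOn, integrable_indicator_iff measurableSet_Ioi, IntegrableOn,
      Measure.restrict_restrict measurableSet_Ioi]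
    exact this
  have h3 := (MeasurePreserving.integrableOn_comp_preimage
    (measurePreserving_add_right (volume : Measure ℝ) μ)
    (MeasurableEquiv.addRight μ).measurableEmbedding).2 h2
  have h4 : (fun x => x + μ) ⁻¹' Set.Icc (0 - r + μ) (0 + r + μ) = Set.Icc (0 - r) (0 + r) := by
    ext x; simp
  rw [h4] at h3
  refine h3.congr (Eventually.of_forall fun x => ?_)
  simp only [Function.comp_apply]
  rcases lt_or_ge ω₀ (x + μ) with h | h
  · rw [Set.indicator_of_mem (show x + μ ∈ Set.Ioi ω₀ from h), shifted_of_gt (by linarith)]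
  · rw [Set.indicator_of_notMem (show x + μ ∉ Set.Ioi ω₀ from not_lt.2 h),
      shifted_of_le (by linarith)]

lemma powerTail_of_bound (hf : Admissible f ω₀) (hμ : μ < ω₀) {α : ℂ} {c : ℕ → ℂ} {n : ℕ}
    {C R : ℝ} (h : ∀ x, R ≤ x → ‖f (x + μ) - powTrunc α (shiftCoeff α c μ) n x‖
      ≤ C * x ^ (α.re - n)) :
    PowerTail (shifted f ω₀ μ) (ω₀ - μ) α (shiftCoeff α c μ) n where
  pos := by linarith
  vanishes x hx := shifted_of_le hx
  locallyIntegrable := (locallyIntegrable_shifted hf).locallyIntegrableOn _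
  isBigO := by
    refine IsBigO.of_bound C ?_
    filter_upwards [eventually_ge_atTop R, eventually_gt_atTop (ω₀ - μ)] with x h1 h2
    have h3 : 0 < x := by linarith
    rw [shifted_of_gt h2, Real.norm_of_nonneg (by positivity)]
    exact h x h1

/-- The shifted function inherits the power expansion. -/
theorem powerTail_shifted (hf : Admissible f ω₀) (hμ : μ < ω₀) {d : ℕ} {ν : ℂ} {c : ℕ → ℂ}
    {N : ℕ} (h : HasPowerExpansion f d ν c N) :
    PowerTail (shifted f ω₀ μ) (ω₀ - μ) (d - 2 * ν) (shiftCoeff (d - 2 * ν) c μ) (N + 1) := by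
  obtain ⟨C, hC⟩ := h.bound
  obtain ⟨R, hR⟩ := eventually_atTop.1 hC
  -- At fixed ν uniformity is not at stake, so the bounds are taken from the given exponent and
  -- coefficients.
  obtain ⟨C', R', -, h'⟩ := shift_expansion ‖(d : ℂ) - 2 * ν‖ (∑ k ∈ Finset.range (N + 1), ‖c k‖)
    C (max R 0) μ (N + 1)
  have hb := h' (d - 2 * ν) c f le_rfl
    (fun k hk => Finset.single_le_sum (f := fun k => ‖c k‖) (fun _ _ => norm_nonneg _)
      (Finset.mem_range.2 hk)) (fun ω hω => ?_)
  · exact powerTail_of_bound hf hμ hb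
  · have := hR ω ((le_max_left _ _).trans hω)
    have hω0 : 0 ≤ ω := (le_max_right _ _).trans hω
    rw [Real.norm_of_nonneg (by positivity)] at this
    have e : ((d : ℂ) - 2 * ν).re - ((N + 1 : ℕ) : ℝ) = (d : ℝ) - 2 * ν.re - N - 1 := by
      simp; ring
    rw [e]
    exact this

/-- The chosen value comes from some continuation; it agrees with G far to the left, hence, by the
identity theorem, at every common point of analyticity in the smaller of the two half-planes. -/
lemma continuation_eq {F G : ℂ → ℂ} {a b : ℝ} {s : ℂ} (hs : s.re < b)
    (hG : MeromorphicOn G {z : ℂ | z.re < b}) (hGF : ∀ z : ℂ, z.re < a → G z = F z)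
    (hGs : AnalyticAt ℂ G s) : continuation F a s = G s := by
  have hex : ∃ w : ℂ, ∃ (b : ℝ) (g : ℂ → ℂ), s.re < b ∧
    MeromorphicOn g {z : ℂ | z.re < b} ∧ (∀ z : ℂ, z.re < a → g z = F z) ∧
    AnalyticAt ℂ g s ∧ g s = w := ⟨G s, b, G, hs, hG, hGF, hGs, rfl⟩
  obtain ⟨b', g, hs', hg, hgF, hgs, hw⟩ := Classical.epsilon_spec hex
  rw [continuation, ← hw]
  have hlt : ((min a (min b b') - 1 : ℝ) : ℂ).re < min a (min b b') := by
    rw [Complex.ofReal_re]; linarith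
  refine meromorphic_identity (isPreconnected_re_lt (min b b'))
    (hg.mono_set fun z (hz : z.re < _) => lt_of_lt_of_le hz (min_le_right _ _))
    (hG.mono_set fun z (hz : z.re < _) => lt_of_lt_of_le hz (min_le_left _ _))
    (z₀ := ((min a (min b b') - 1 : ℝ) : ℂ)) (lt_of_lt_of_le hlt (min_le_right _ _)) ?_
    (lt_min hs hs') hgs.continuousAt hGs.continuousAt
  filter_upwards [(isOpen_lt Complex.continuous_re continuous_const).mem_nhds
    (lt_of_lt_of_le hlt (min_le_left _ _))] with z hz
  rw [hgF z hz, hGF z hz]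

lemma PowerTail.meromorphicOn_sigmaExt {g : ℝ → ℂ} {δ : ℝ} {α : ℂ} {e : ℕ → ℂ} {n : ℕ}
    (h : PowerTail g δ α e n) :
    MeromorphicOn (sigmaExt g δ α e n) {z : ℂ | z.re < n - α.re - 1} := by
  have hδ : (δ : ℂ) ≠ 0 := by exact_mod_cast h.pos.ne'
  have hd : DifferentiableOn ℂ (fun s => mellin (tailPart g δ α e n) (s + 1))
      {z : ℂ | z.re < n - α.re - 1} := fun z (hz : z.re < _) => by
    have h1 := h.differentiableAt_mellin_tailPart (s := z + 1) (by simp; linarith)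
    exact (h1.comp z (by fun_prop : DifferentiableAt ℂ (fun s : ℂ => s + 1) z)
      ).differentiableWithinAt
  intro z hz
  refine MeromorphicAt.sub (hd.analyticAt ((isOpen_lt Complex.continuous_re
    continuous_const).mem_nhds hz)).meromorphicAt ?_
  refine MeromorphicAt.fun_sum fun m _ => (MeromorphicAt.const _ _).mul (MeromorphicAt.div ?_ ?_)
  · have : Differentiable ℂ fun s : ℂ => (δ : ℂ) ^ (s + 1 + (α - m)) := fun s =>
      (by fun_prop : DifferentiableAt ℂ (fun s : ℂ => s + 1 + (α - m)) s).const_cpow (Or.inl hδ)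
    exact (this.analyticAt z).meromorphicAt
  · exact (by fun_prop : Differentiable ℂ fun s : ℂ => s + 1 + (α - m)).analyticAt z |>.meromorphicAt

lemma PowerTail.differentiableAt_sigmaExt {g : ℝ → ℂ} {δ : ℝ} {α : ℂ} {e : ℕ → ℂ} {n : ℕ}
    (h : PowerTail g δ α e n) {s : ℂ} (hs : s.re < n - α.re - 1)
    (hs' : ∀ m < n, s + 1 + (α - m) ≠ 0) :
    DifferentiableAt ℂ (sigmaExt g δ α e n) s := by
  have hδ : (δ : ℂ) ≠ 0 := by exact_mod_cast h.pos.ne'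
  have h1 := h.differentiableAt_mellin_tailPart (s := s + 1) (by simp; linarith)
  have h2 : DifferentiableAt ℂ (fun s => mellin (tailPart g δ α e n) (s + 1)) s :=
    DifferentiableAt.comp (g := mellin (tailPart g δ α e n)) (f := fun s => s + 1) s h1
      (by fun_prop)
  refine h2.fun_sub ?_
  refine DifferentiableAt.fun_sum fun m hm => DifferentiableAt.const_mul ?_ _
  have h3 : DifferentiableAt ℂ (fun s : ℂ => s + 1 + (α - m)) s := by fun_prop
  exact (h3.const_cpow (Or.inl hδ)).fun_div h3 (hs' m (Finset.mem_range.1 hm))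

lemma powerIntegral_eq (hf : Admissible f ω₀) (hω : 0 < ω₀) (hμ : μ < ω₀) (s : ℂ) :
    powerIntegral f μ s = mellin (shifted f ω₀ μ) (s + 1) := by
  have := integral_shifted hf hω hμ (fun x => (x : ℂ) ^ s)
  rw [powerIntegral, mellin]
  simp only [add_sub_cancel_right, smul_eq_mul]
  simp only [mul_comm (f _), mul_comm (shifted f ω₀ μ _)] at this
  exact this

/-- The continued moments are given by the explicit continuation. -/
theorem sigmaFun_eq (hf : Admissible f ω₀) (hω : 0 < ω₀) (hμ : μ < ω₀) {d : ℕ} {ν : ℂ}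
    {e : ℕ → ℂ} {n : ℕ} (h : PowerTail (shifted f ω₀ μ) (ω₀ - μ) (d - 2 * ν) e n) {s : ℂ}
    (hs : s.re < n - ((d : ℂ) - 2 * ν).re - 1)
    (hs' : ∀ m < n, s + 1 + ((d : ℂ) - 2 * ν - m) ≠ 0) :
    sigmaFun f d ν μ s = sigmaExt (shifted f ω₀ μ) (ω₀ - μ) (d - 2 * ν) e n s := by
  have hopen : IsOpen {s : ℂ | s.re < n - ((d : ℂ) - 2 * ν).re - 1 ∧
      ∀ m ∈ Finset.range n, s + 1 + ((d : ℂ) - 2 * ν - m) ≠ 0} := by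
    refine (isOpen_lt Complex.continuous_re continuous_const).inter ?_
    have : {s : ℂ | ∀ m ∈ Finset.range n, s + 1 + ((d : ℂ) - 2 * ν - m) ≠ 0} =
        ⋂ m ∈ Finset.range n, {s : ℂ | s + 1 + ((d : ℂ) - 2 * ν - m) ≠ 0} := by ext; simp
    change IsOpen {s : ℂ | ∀ m ∈ Finset.range n, s + 1 + ((d : ℂ) - 2 * ν - m) ≠ 0}
    rw [this]
    exact isOpen_biInter_finset fun m _ => isOpen_ne_fun (by fun_prop) continuous_const
  have hd : DifferentiableOn ℂ (sigmaExt (shifted f ω₀ μ) (ω₀ - μ) (d - 2 * ν) e n)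
      {s : ℂ | s.re < n - ((d : ℂ) - 2 * ν).re - 1 ∧
      ∀ m ∈ Finset.range n, s + 1 + ((d : ℂ) - 2 * ν - m) ≠ 0} := fun z hz =>
    (h.differentiableAt_sigmaExt hz.1 fun m hm =>
      hz.2 m (Finset.mem_range.2 hm)).differentiableWithinAt
  refine continuation_eq hs h.meromorphicOn_sigmaExt (fun z hz => ?_)
    (hd.analyticAt (hopen.mem_nhds ⟨hs, fun m hm => hs' m (Finset.mem_range.1 hm)⟩))
  rw [powerIntegral_eq hf hω hμ]
  exact (h.hasMellin_of_re_lt (s := z) (by simp; linarith)).2.symm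

end HighTemp

end

/-! ### Exact formula and complete expansion at fixed ν -/

noncomputable section

namespace HighTemp

variable {f : ℝ → ℂ} {ω₀ μ : ℝ} {d : ℕ} {ν : ℂ} {c : ℕ → ℂ}

theorem sigmaContinues_of_expansion (hf : Admissible f ω₀) (hω : 0 < ω₀) (hμ : μ < ω₀) {N : ℕ}
    (h : HasPowerExpansion f d ν c N) : SigmaContinues f d ν μ N := by
  have hT := powerTail_shifted hf hμ h
  refine ⟨fun s hs => ?_, fun s hs => ?_⟩
  · have h1 := hT.hasMellin_of_re_lt (s := s) (by simp; linarith)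
    constructor
    · have h2 := (integrableOn_shifted_iff hf hω hμ (fun x => (x : ℂ) ^ s)).2
        (by simpa [MellinConvergent, mul_comm] using h1.1)
      simpa [mul_comm] using h2
    · rw [sigmaFun_eq hf hω hμ hT (s := s) (by simp; linarith [(Nat.cast_nonneg N : (0 : ℝ) ≤ N)])
        (fun m _ hm => ?_), ← h1.2, ← powerIntegral_eq hf hω hμ, powerIntegral]
      have := congrArg Complex.re hm
      simp at this
      linarith [(Nat.cast_nonneg m : (0 : ℝ) ≤ m)]
  · have hopen : IsOpen {s : ℂ | s.re < 2 * ν.re - d + N ∧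
        ∀ m : ℕ, m ≤ N → s ≠ 2 * ν - d - 1 + m} := by
      refine (isOpen_lt Complex.continuous_re continuous_const).inter ?_
      have : {s : ℂ | ∀ m : ℕ, m ≤ N → s ≠ 2 * ν - d - 1 + m} =
          ⋂ m ∈ Finset.range (N + 1), {s : ℂ | s ≠ 2 * ν - d - 1 + m} := by
        ext; simp
      change IsOpen {s : ℂ | ∀ m : ℕ, m ≤ N → s ≠ 2 * ν - d - 1 + m}
      rw [this]
      exact isOpen_biInter_finset fun m _ => isOpen_ne
    have key : ∀ z ∈ {s : ℂ | s.re < 2 * ν.re - d + N ∧ ∀ m : ℕ, m ≤ N → s ≠ 2 * ν - d - 1 + m},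
        z.re < ((N + 1 : ℕ) : ℝ) - ((d : ℂ) - 2 * ν).re - 1 ∧
        ∀ m < N + 1, z + 1 + ((d : ℂ) - 2 * ν - m) ≠ 0 := fun z hz =>
      ⟨by have := hz.1; simp; linarith, fun m hm h0 =>
        hz.2 m (Nat.lt_succ_iff.1 hm) (by linear_combination h0)⟩
    refine DifferentiableAt.differentiableWithinAt ?_
    refine (hT.differentiableAt_sigmaExt (key s hs).1 (key s hs).2).congr_of_eventuallyEq ?_
    filter_upwards [hopen.mem_nhds hs] with z hz
    exact sigmaFun_eq hf hω hμ hT (key z hz).1 (key z hz).2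

lemma integrableOn_thermal (hf : Admissible f ω₀) (hω : 0 < ω₀) (hμ : μ < ω₀) {N : ℕ}
    (h : HasPowerExpansion f d ν c N) (st : Statistics) {β : ℝ} (hβ : 0 < β) :
    IntegrableOn (fun ω : ℝ => f ω * (occupation st (β * (ω - μ)) : ℂ)) (Set.Ioi 0) volume :=
  (integrableOn_shifted_iff hf hω hμ (fun x => (occupation st (β * x) : ℂ))).2
    ((powerTail_shifted hf hμ h).integrableOn_mul_occupation st hβ)

/-- `Complex.Gamma 0` and division by zero are both 0 here, in agreement with 1/Γ(0) = 0. The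
fermionic sum may therefore start at l = -1 like the bosonic one. -/
lemma integerCoeff_fermi_neg_one : integerCoeff .fermi (-1) = 0 := by simp [integerCoeff]

lemma sum_integerCoeff (st : Statistics) (L : ℤ) (F : ℤ → ℂ) :
    ∑ l ∈ Finset.Ico (firstIndex st) L, integerCoeff st l * F l =
      ∑ j ∈ Finset.range (L + 1).toNat, integerCoeff st ((j : ℤ) - 1) * F ((j : ℤ) - 1) := by
  have h1 : ∑ l ∈ Finset.Ico (firstIndex st) L, integerCoeff st l * F l =
      ∑ l ∈ Finset.Ico (-1) L, integerCoeff st l * F l := by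
    cases st with
    | bose => rfl
    | fermi =>
      refine Finset.sum_subset (fun l hl => ?_) fun l hl hl' => ?_
      · simp only [firstIndex, Finset.mem_Ico] at hl ⊢; omega
      · have : l = -1 := by
          simp only [firstIndex, Finset.mem_Ico] at hl hl'; omega
        rw [this, integerCoeff_fermi_neg_one, zero_mul]
  rw [h1]
  refine (Finset.sum_bij (fun (j : ℕ) _ => (j : ℤ) - 1) ?_ ?_ ?_ ?_).symm
  · intro j hj; simp only [Finset.mem_range, Finset.mem_Ico] at hj ⊢; omega
  · intro i _ j _ h
    have h' : (i : ℤ) - 1 = (j : ℤ) - 1 := h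
    omega
  · intro l hl
    simp only [Finset.mem_range, Finset.mem_Ico] at hl ⊢
    exact ⟨(l + 1).toNat, by omega, by omega⟩
  · intro j _; rfl

lemma doubleTerm_eq (st : Statistics) {β : ℝ} (hβ : 0 < β) (k n : ℕ) :
    doubleTerm st d ν c μ β k n = (β : ℂ) ^ (((k + n : ℕ) : ℂ) + 2 * ν - (d + 1)) *
      statZeta st ((d : ℂ) + 1 - 2 * ν - (k + n : ℕ)) *
      (Complex.Gamma ((d : ℂ) + 1 - 2 * ν - k) * c k * (μ : ℂ) ^ n / (n.factorial : ℂ)) := by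
  have hβc : (β : ℂ) ≠ 0 := by exact_mod_cast hβ.ne'
  have e1 : ((k + n : ℕ) : ℂ) + 2 * ν - (d + 1) = n - ((d : ℂ) + 1 - 2 * ν - k) := by
    push_cast; ring
  have e2 : (d : ℂ) + 1 - 2 * ν - (k + n : ℕ) = (d : ℂ) + 1 - 2 * ν - k - n := by push_cast; ring
  rw [doubleTerm, e1, e2, Complex.cpow_sub (n : ℂ) _ hβc, Complex.cpow_natCast, mul_pow]
  ring

/-- The power of β and the zeta factor depend on k + n only, so each antidiagonal of the double
series is one term of the exact formula. -/
lemma groupedTerm_eq_sum (st : Statistics) {β : ℝ} (hβ : 0 < β)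
    (m : ℕ) : groupedTerm st d ν c μ β m =
      ∑ p ∈ Finset.HasAntidiagonal.antidiagonal m, doubleTerm st d ν c μ β p.1 p.2 := by
  rw [← Finset.Nat.sum_antidiagonal_swap, Finset.Nat.sum_antidiagonal_eq_sum_range_succ_mk,
    groupedTerm, Finset.mul_sum]
  refine Finset.sum_congr rfl fun n hn => ?_
  have hnm : n ≤ m := Nat.lt_succ_iff.1 (Finset.mem_range.1 hn)
  simp only [Prod.swap]
  rw [doubleTerm_eq st hβ, Nat.sub_add_cancel hnm, Nat.cast_sub hnm]
  have : (d : ℂ) + 1 - 2 * ν - (m - n) = (d : ℂ) + 1 - 2 * ν - m + n := by ring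
  rw [this]

lemma groupedTerm_eq (st : Statistics) (hν : ∀ j : ℤ, 2 * ν ≠ j) (β : ℝ) (m : ℕ) :
    groupedTerm st d ν c μ β m = shiftCoeff (d - 2 * ν) c μ m *
      ((β : ℂ) ^ (-((d : ℂ) - 2 * ν - m + 1)) * (Complex.Gamma ((d : ℂ) - 2 * ν - m + 1) *
        statZeta st ((d : ℂ) - 2 * ν - m + 1))) := by
  have h1 : shiftCoeff (d - 2 * ν) c μ m * Complex.Gamma ((d : ℂ) - 2 * ν - m + 1) =
      ∑ n ∈ Finset.range (m + 1), Complex.Gamma ((d : ℂ) + 1 - 2 * ν - m + n) * c (m - n) *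
        (μ : ℂ) ^ n / (n.factorial : ℂ) := by
    rw [shiftCoeff, ← Finset.sum_range_reflect, Finset.sum_mul]
    refine Finset.sum_congr rfl fun n hn => ?_
    have hnm : n ≤ m := Nat.lt_succ_iff.1 (Finset.mem_range.1 hn)
    have e1 : m + 1 - 1 - n = m - n := by omega
    have e2 : m - (m - n) = n := by omega
    have e3 : (d : ℂ) + 1 - 2 * ν - m + n = ((d : ℂ) - 2 * ν - m) + 1 + n := by ring
    have e4 : (d : ℂ) - 2 * ν - ((m - n : ℕ) : ℂ) = (d : ℂ) - 2 * ν - m + n := by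
      rw [Nat.cast_sub hnm]; ring
    have hne : (n.factorial : ℂ) ≠ 0 := by exact_mod_cast n.factorial_ne_zero
    rw [e1, e2, e3, e4, Gamma_add_nat n _ fun j hj => hν (d - m - j) (by
      push_cast; linear_combination -hj)]
    field_simp
  rw [groupedTerm, ← h1]
  have e1 : (m : ℂ) + 2 * ν - (d + 1) = -((d : ℂ) - 2 * ν - m + 1) := by ring
  have e2 : (d : ℂ) + 1 - 2 * ν - m = (d : ℂ) - 2 * ν - m + 1 := by ring
  rw [e1, e2]; ring

/-- The thermal integral in terms of the expansion and a remainder in the original variable. -/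
theorem thermalIntegral_eq (hf : Admissible f ω₀) (hω : 0 < ω₀) (hμ : μ < ω₀) {N : ℕ}
    (hν : ∀ j : ℤ, 2 * ν ≠ j) (h : HasPowerExpansion f d ν c N) (st : Statistics) {x₀ : ℝ}
    (hx₁ : 2 * ν.re - d - 1 + N < x₀) (hx₂ : x₀ < 2 * ν.re - d + N) (hx : ∀ l : ℤ, x₀ ≠ l)
    {β : ℝ} (hβ : 0 < β) :
    thermalIntegral st f β μ =
      ∑ m ∈ Finset.range (N + 1), groupedTerm st d ν c μ β m
      + ∑ l ∈ Finset.Ico (firstIndex st) (⌊x₀⌋ + 1), integerTerm st f d ν μ β l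
      + remainder st (shifted f ω₀ μ) (d - 2 * ν) (shiftCoeff (d - 2 * ν) c μ) (N + 1) x₀ β := by
  have hT := powerTail_shifted hf hμ h
  have h1 := hT.integral_occupation st hx (fun m hm => ?_) (by simp; linarith)
    (fun j hj => hν (d - j) (by push_cast; linear_combination -hj)) hβ
  · rw [thermalIntegral, integral_shifted hf hω hμ (fun x => (occupation st (β * x) : ℂ)), h1]
    congr 1
    congr 1
    · exact Finset.sum_congr rfl fun m _ => (groupedTerm_eq st hν β m).symm
    · simp only [integerTerm, mul_assoc]
      rw [sum_integerCoeff st _ (fun l => sigmaFun f d ν μ (l : ℂ) * (β : ℂ) ^ l)]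
      -- The sum over l ≤ ⌊x₀⌋ is the sum over Laurent indices j = l + 1 below the truncation order.
      have : (⌊x₀⌋ + 1 + 1).toNat = truncOrder x₀ := by rw [truncOrder, add_assoc]; rfl
      rw [this]
      refine Finset.sum_congr rfl fun j hj => ?_
      have hj' := lt_of_lt_truncOrder hx (Finset.mem_range.1 hj)
      rw [sigmaFun_eq hf hω hμ hT (by simp; linarith) (fun m _ h0 => hν (d + j - m) (by
        push_cast at h0 ⊢; linear_combination -h0)), ← Complex.cpow_intCast]
      push_cast; rfl
  · have : (m : ℝ) ≤ N := by exact_mod_cast Nat.lt_succ_iff.1 hm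
    simp; linarith

theorem exactExpansion (hf : Admissible f ω₀) (hω : 0 < ω₀) (hμ : μ < ω₀) {N : ℕ}
    (hν : ∀ j : ℤ, 2 * ν ≠ j) (h : HasPowerExpansion f d ν c N) (st : Statistics) :
    ExactExpansion st f d ν c μ N := by
  have hT := powerTail_shifted hf hμ h
  refine fun β hβ => ⟨integrableOn_thermal hf hω hμ h st hβ, fun x₀ hx₁ hx₂ hx => ?_⟩
  have hs : ∀ m < N + 1, (m : ℝ) < x₀ + 1 + ((d : ℂ) - 2 * ν).re := fun m hm => by
    have : (m : ℝ) ≤ N := by exact_mod_cast Nat.lt_succ_iff.1 hm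
    simp; linarith
  have hs' : x₀ + 1 + ((d : ℂ) - 2 * ν).re < ((N + 1 : ℕ) : ℝ) := by simp; linarith
  obtain ⟨hc1, hc2⟩ := hT.remainder_eq_contour st hx hs hs' hβ
  have e : ∀ t : ℝ, contourIntegrand st f d ν μ β (x₀ + t * Complex.I) =
      Complex.Gamma (-(x₀ + t * Complex.I)) * statZeta st (-(x₀ + t * Complex.I)) *
      sigmaExt (shifted f ω₀ μ) (ω₀ - μ) (d - 2 * ν) (shiftCoeff (d - 2 * ν) c μ) (N + 1)
        (x₀ + t * Complex.I) * (β : ℂ) ^ (x₀ + t * Complex.I) := fun t => by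
    rw [contourIntegrand, sigmaFun_eq hf hω hμ hT (by simp; linarith) fun m hm h0 => ?_]
    have h1 := congrArg Complex.re h0
    have h2 := hs m hm
    simp at h1 h2
    linarith
  simp only [e]
  refine ⟨hc1, ?_⟩
  rw [← hc2, thermalIntegral_eq hf hω hμ hν h st hx₁ hx₂ hx hβ]
  congr 2

lemma cpow_isBigO_zero {s : ℂ} {M : ℝ} (h : M ≤ s.re) :
    (fun β : ℝ => (β : ℂ) ^ s) =O[𝓝[>] 0] fun β : ℝ => β ^ M := by
  refine IsBigO.of_bound 1 ?_
  filter_upwards [Ioc_mem_nhdsGT one_pos] with β hβ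
  rw [norm_ofReal_cpow hβ.1, one_mul, Real.norm_of_nonneg (Real.rpow_nonneg hβ.1.le _)]
  exact Real.rpow_le_rpow_of_exponent_ge hβ.1 hβ.2 h

lemma partialExpansion_eq (st : Statistics) {β : ℝ} (hβ : 0 < β)
    (K : ℕ) (L : ℤ) : partialExpansion st f d ν c μ K L β =
      ∑ m ∈ Finset.range K, groupedTerm st d ν c μ β m +
      ∑ l ∈ Finset.Ico (firstIndex st) L, integerTerm st f d ν μ β l := by
  simp only [partialExpansion, groupedTerm_eq_sum st hβ]

lemma remainder_isBigO {g : ℝ → ℂ} {δ : ℝ} {α : ℂ} {e : ℕ → ℂ} {n : ℕ} (h : PowerTail g δ α e n)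
    (st : Statistics) {x₀ : ℝ} (hx : ∀ l : ℤ, x₀ ≠ l)
    (hs : ∀ m < n, (m : ℝ) < x₀ + 1 + α.re) (hs' : x₀ + 1 + α.re < n) :
    remainder st g α e n x₀ =O[𝓝[>] 0] fun β : ℝ => β ^ x₀ := by
  obtain ⟨C, hC⟩ := h.remainder_bound st hx hs hs'
  refine IsBigO.of_bound C ?_
  filter_upwards [self_mem_nhdsWithin] with β hβ
  rw [Real.norm_of_nonneg (Real.rpow_nonneg (le_of_lt hβ) _)]
  exact hC β hβ

lemma rpow_isBigO_zero {p M : ℝ} (h : M ≤ p) :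
    (fun β : ℝ => β ^ p) =O[𝓝[>] 0] fun β : ℝ => β ^ M := by
  refine IsBigO.of_bound 1 ?_
  filter_upwards [Ioc_mem_nhdsGT one_pos] with β hβ
  rw [one_mul, Real.norm_of_nonneg (Real.rpow_nonneg hβ.1.le _),
    Real.norm_of_nonneg (Real.rpow_nonneg hβ.1.le _)]
  exact Real.rpow_le_rpow_of_exponent_ge hβ.1 hβ.2 h

/-- The exact formula is applied with one group of terms more than requested, so that its strip lies
to the right of M; the additional terms and the remainder are all O(β^M). -/
theorem completeExpansion (hf : Admissible f ω₀) (hω : 0 < ω₀) (hμ : μ < ω₀)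
    (hν : ∀ j : ℤ, 2 * ν ≠ j) (h : ∀ N, HasPowerExpansion f d ν c N) (st : Statistics) :
    CompleteExpansion st f d ν c μ := by
  intro M
  set K : ℕ := ⌈M - 2 * ν.re + (d + 1)⌉₊ with hK
  have hKM : M - 2 * ν.re + (d + 1) ≤ K := Nat.le_ceil _
  -- An irrational x₀ avoids the integers, and the choice of K puts the left edge of the strip at M
  -- or beyond.
  obtain ⟨x₀, hx, hx₁, hx₂⟩ := exists_irrational_btwn
    (show 2 * ν.re - d - 1 + K < 2 * ν.re - d + K by linarith)
  have hx' : ∀ l : ℤ, x₀ ≠ l := fun l => hx.ne_int l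
  have hMx : M < x₀ := by linarith
  have hT := powerTail_shifted hf hμ (h K)
  have hrem := (remainder_isBigO hT st hx' (fun m hm => by
    have : (m : ℝ) ≤ K := by exact_mod_cast Nat.lt_succ_iff.1 hm
    simp; linarith) (by simp; linarith)).trans (rpow_isBigO_zero hMx.le)
  have hsub : Finset.Ico (firstIndex st) ⌈M⌉ ⊆ Finset.Ico (firstIndex st) (⌊x₀⌋ + 1) :=
    Finset.Ico_subset_Ico_right (Int.ceil_le.2 (by
      have := Int.lt_floor_add_one x₀; push_cast; linarith))
  have hg : (fun β : ℝ => groupedTerm st d ν c μ β K) =O[𝓝[>] 0] fun β : ℝ => β ^ M := by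
    have h1 := (cpow_isBigO_zero (s := (K : ℂ) + 2 * ν - (d + 1)) (M := M) (by simp; linarith)
      ).const_mul_left (statZeta st ((d : ℂ) + 1 - 2 * ν - K) *
        ∑ n ∈ Finset.range (K + 1), Complex.Gamma ((d : ℂ) + 1 - 2 * ν - K + n) * c (K - n) *
          (μ : ℂ) ^ n / (n.factorial : ℂ))
    refine h1.congr_left fun β => ?_
    rw [groupedTerm]; ring
  have hl : (fun β : ℝ => ∑ l ∈ Finset.Ico (firstIndex st) (⌊x₀⌋ + 1) \
      Finset.Ico (firstIndex st) ⌈M⌉, integerTerm st f d ν μ β l)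
      =O[𝓝[>] 0] fun β : ℝ => β ^ M := by
    refine IsBigO.fun_sum fun l hl => ?_
    have hlM : M ≤ l := by
      simp only [Finset.mem_sdiff, Finset.mem_Ico, not_and, not_lt] at hl
      exact Int.ceil_le.1 (hl.2 hl.1.1)
    have h1 := (cpow_isBigO_zero (s := (l : ℂ)) (M := M) (by simpa using hlM)).const_mul_left
      (integerCoeff st l * sigmaFun f d ν μ (l : ℂ))
    refine h1.congr_left fun β => ?_
    rw [integerTerm, Complex.cpow_intCast]
  refine ((hg.add hl).add hrem).congr' ?_ EventuallyEq.rfl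
  filter_upwards [self_mem_nhdsWithin] with β hβ
  rw [partialExpansion_eq st hβ, thermalIntegral_eq hf hω hμ hν (h K) st hx₁ hx₂ hx' hβ,
    Finset.sum_range_succ, ← Finset.sum_sdiff hsub]
  ring

end HighTemp

end

/-! ### Families in ν: continuity of the coefficients at ν = 0 -/

noncomputable section

namespace HighTemp

/-- Data for the limit `ν → 0`: a family of admissible functions that is continuous at `0` in the
sense of distributions and has a uniform power expansion. -/
structure RegularFamily (F : ℂ → ℝ → ℂ) (ω₀ : ℝ) (d : ℕ) (c : ℕ → ℂ → ℂ) : Prop where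
  pos : 0 < ω₀
  admissible : ∀ ν : ℂ, ν.re < 1 → Admissible (F ν) ω₀
  continuousAt : ∀ φ : ℝ → ℝ, ContDiff ℝ (⊤ : ℕ∞) φ → HasCompactSupport φ →
    ContinuousAt (fun ν : ℂ => ∫ ω : ℝ, (φ ω : ℂ) * F ν ω) 0
  expansion : HasUniformPowerExpansion F d c

variable {F : ℂ → ℝ → ℂ} {ω₀ : ℝ} {d : ℕ} {c : ℕ → ℂ → ℂ}

lemma eventually_re_lt {r : ℝ} (hr : 0 < r) : ∀ᶠ ν : ℂ in 𝓝 0, ν.re < r :=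
  (isOpen_lt Complex.continuous_re continuous_const).mem_nhds (by simpa using hr)

lemma eventually_abs_re_lt {r : ℝ} (hr : 0 < r) : ∀ᶠ ν : ℂ in 𝓝 0, |ν.re| < r :=
  (isOpen_lt (continuous_abs.comp Complex.continuous_re) continuous_const).mem_nhds
    (by simpa using hr)

lemma powTrunc_bound_of_uniform (h : HasUniformPowerExpansion F d c) (N : ℕ) :
    ∃ C R : ℝ, 0 < R ∧ ∀ᶠ ν in 𝓝 (0 : ℂ), ∀ ω : ℝ, R ≤ ω →
      ‖F ν ω - powTrunc (d - 2 * ν) (fun k => c k ν) (N + 1) ω‖ ≤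
        C * ω ^ (((d : ℂ) - 2 * ν).re - ((N + 1 : ℕ) : ℝ)) := by
  obtain ⟨C, R, hR, h⟩ := h N
  refine ⟨C, R, hR, h.mono fun ν hν ω hω => ?_⟩
  have e : ((d : ℂ) - 2 * ν).re - ((N + 1 : ℕ) : ℝ) = (d : ℝ) - 2 * ν.re - N - 1 := by
    simp; ring
  rw [e]
  exact hν ω hω

lemma hasPowerExpansion_of_uniform (h : HasUniformPowerExpansion F d c) (N : ℕ) :
    ∀ᶠ ν in 𝓝 (0 : ℂ), HasPowerExpansion (F ν) d ν (fun k => c k ν) N := by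
  obtain ⟨C, R, hR, h⟩ := h N
  refine h.mono fun ν hν => IsBigO.of_bound C ?_
  filter_upwards [eventually_ge_atTop R] with ω hω
  have : 0 < ω := hR.trans_le hω
  rw [Real.norm_of_nonneg (by positivity)]
  exact hν ω hω

/-- The Mellin transform of a smooth bump at `r` in terms of a real integral. -/
lemma mellin_ofReal (ψ : ℝ → ℝ) (r : ℝ) : mellin (fun ω => (ψ ω : ℂ)) r =
    ((∫ ω in Set.Ioi (0 : ℝ), ω ^ (r - 1) * ψ ω : ℝ) : ℂ) := by
  rw [mellin, ← integral_complex_ofReal]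
  refine setIntegral_congr_fun measurableSet_Ioi fun ω (hω : 0 < ω) => ?_
  have := Complex.ofReal_cpow hω.le (r - 1)
  push_cast at this ⊢
  rw [this, smul_eq_mul]

lemma bump_isBigO {lam : ℝ} (hlam : 0 < lam) {ψ : ℝ → ℝ}
    (hψ : ∀ ω, ψ ω ≠ 0 → lam < ω ∧ ω < 2 * lam) (q : ℝ) :
    (fun ω => (ψ ω : ℂ)) =O[atTop] (fun ω : ℝ => ω ^ q) ∧
    (fun ω => (ψ ω : ℂ)) =O[𝓝[>] 0] (fun ω : ℝ => ω ^ q) := by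
  constructor
  · refine (isBigO_zero _ _).congr' ?_ EventuallyEq.rfl
    filter_upwards [eventually_ge_atTop (2 * lam)] with ω hω
    by_contra hne
    exact absurd (hψ ω fun h => hne (by simp [h])).2 (not_lt.2 hω)
  · refine (isBigO_zero _ _).congr' ?_ EventuallyEq.rfl
    filter_upwards [Ioc_mem_nhdsGT hlam] with ω hω
    by_contra hne
    exact absurd (hψ ω fun h => hne (by simp [h])).1 (not_lt.2 hω.2)

/-- The coefficients of the uniform expansion are continuous at `0`. -/
theorem RegularFamily.continuousAt_coeff (h : RegularFamily F ω₀ d c) (N : ℕ) :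
    ContinuousAt (c N) 0 := by
  induction N using Nat.strong_induction_on with
  | _ N ih =>
  -- Pairing with a bump ψ supported in (λ, 2λ) gives I ≈ ∑_{k≤N} c_k m_k, where m_k pairs ψ with
  -- the k-th power. Solving for c_N, with the lower coefficients continuous by induction, gives a
  -- continuous approximant whose error tends to 0 uniformly near ν = 0 as λ grows.
  refine continuousAt_of_locally_uniform_approx_of_continuousAt fun u hu => ?_
  obtain ⟨ε, hε, hεu⟩ := Metric.mem_uniformity_dist.1 hu
  obtain ⟨C, R, hR, hexp⟩ := powTrunc_bound_of_uniform h.expansion N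
  -- The expansion error is at most (|C|/λ) Q(ν), with Q < 2 Q(0) and |m_N| > Q(0)/2 near 0; after
  -- division it is below 4|C|/λ < ε.
  set lam : ℝ := max (max R ω₀) (4 * |C| / ε + 1) with hlamdef
  have hlamR : R ≤ lam := (le_max_left _ _).trans (le_max_left _ _)
  have hlamω : ω₀ ≤ lam := (le_max_right _ _).trans (le_max_left _ _)
  have hlamC : 4 * |C| / ε < lam := (lt_add_one _).trans_le (le_max_right _ _)
  have hlam : 0 < lam := hR.trans_le hlamR
  let b : ContDiffBump (3 * lam / 2 : ℝ) := ⟨lam / 4, lam / 2, by positivity, by linarith⟩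
  set ψ : ℝ → ℝ := fun x => b x with hψdef
  have hψsupp : ∀ ω, ψ ω ≠ 0 → lam < ω ∧ ω < 2 * lam := fun ω hω => by
    have h1 : ω ∈ Function.support b := hω
    rw [b.support_eq, Real.ball_eq_Ioo] at h1
    have h2 : b.rOut = lam / 2 := rfl
    rw [h2] at h1
    exact ⟨by linarith [h1.1], by linarith [h1.2]⟩
  have hψc : Continuous ψ := b.continuous
  have hψ0 : ∀ ω, 0 ≤ ψ ω := fun ω => b.nonneg
  have hψli : LocallyIntegrableOn (fun ω => (ψ ω : ℂ)) (Set.Ioi 0) :=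
    (Complex.continuous_ofReal.comp hψc).locallyIntegrable.locallyIntegrableOn _
  have hψd : Differentiable ℂ (mellin fun ω => (ψ ω : ℂ)) := fun s =>
    mellin_differentiableAt_of_isBigO_rpow (a := s.re + 1) (b := s.re - 1) hψli
      (bump_isBigO hlam hψsupp _).1 (by linarith) (bump_isBigO hlam hψsupp _).2 (by linarith)
  have hψm : ∀ s : ℂ, MellinConvergent (fun ω => (ψ ω : ℂ)) s := fun s =>
    mellinConvergent_of_isBigO_rpow (a := s.re + 1) (b := s.re - 1) hψli
      (bump_isBigO hlam hψsupp _).1 (by linarith) (bump_isBigO hlam hψsupp _).2 (by linarith)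
  set m : ℕ → ℂ → ℂ := fun k ν => mellin (fun ω => (ψ ω : ℂ)) ((d : ℂ) - 2 * ν - k + 1) with hm
  have hmc : ∀ k, Continuous (m k) := fun k => hψd.continuous.comp (by fun_prop)
  set Q : ℂ → ℝ := fun ν => ∫ ω in Set.Ioi (0 : ℝ), ω ^ ((d : ℝ) - 2 * ν.re - N) * ψ ω with hQ
  have hQeq : ∀ ν, mellin (fun ω => (ψ ω : ℂ)) (((d : ℝ) - 2 * ν.re - N + 1 : ℝ) : ℂ) = (Q ν : ℂ) :=
    fun ν => by rw [mellin_ofReal, add_sub_cancel_right]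
  have hQc : Continuous Q := by
    have h1 : Q = fun ν : ℂ =>
        (mellin (fun ω => (ψ ω : ℂ)) (((d : ℝ) - 2 * ν.re - N + 1 : ℝ) : ℂ)).re := by
      ext ν; rw [hQeq]; simp
    rw [h1]
    exact Complex.continuous_re.comp (hψd.continuous.comp
      (Complex.continuous_ofReal.comp (by fun_prop)))
  have hQi : ∀ r : ℝ, IntegrableOn (fun ω : ℝ => ω ^ r * ψ ω) (Set.Ioi 0) volume := fun r => by
    refine (integrableOn_congr_fun (fun ω (hω : 0 < ω) => ?_) measurableSet_Ioi).1
      (hψm ((r + 1 : ℝ) : ℂ)).norm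
    rw [norm_smul, norm_ofReal_cpow hω]
    simp [abs_of_nonneg (hψ0 ω)]
  have hQ0 : 0 < Q 0 := by
    rw [hQ]
    simp only
    rw [setIntegral_pos_iff_support_of_nonneg_ae _ (hQi _)]
    · have hsub : Metric.ball (3 * lam / 2 : ℝ) (lam / 2) ⊆ Function.support (fun ω : ℝ =>
          ω ^ ((d : ℝ) - 2 * (0 : ℂ).re - N) * ψ ω) ∩ Set.Ioi 0 := by
        intro ω hω
        have h1 : ω ∈ Function.support b := by rw [b.support_eq]; exact hω
        have h2 : 0 < ω := hlam.trans (hψsupp ω h1).1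
        exact ⟨mul_ne_zero (Real.rpow_pos_of_pos h2 _).ne' h1, h2⟩
      exact (Metric.measure_ball_pos volume _ (by positivity)).trans_le (measure_mono hsub)
    · filter_upwards [ae_restrict_mem measurableSet_Ioi] with ω hω
      exact mul_nonneg (Real.rpow_nonneg (le_of_lt hω) _) (hψ0 ω)
  have hmQ : m N 0 = (Q 0 : ℂ) := by
    rw [← hQeq]; simp [hm]
  have hI := h.continuousAt ψ b.contDiff b.hasCompactSupport
  set I : ℂ → ℂ := fun ν => ∫ ω : ℝ, (ψ ω : ℂ) * F ν ω with hIdef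
  have hne : m N 0 ≠ 0 := by rw [hmQ]; exact_mod_cast hQ0.ne'
  have hev1 : ∀ᶠ ν in 𝓝 (0 : ℂ), Q 0 / 2 < ‖m N ν‖ := by
    refine (hmc N).norm.continuousAt.eventually_const_lt ?_
    change Q 0 / 2 < ‖m N 0‖
    rw [hmQ, Complex.norm_of_nonneg hQ0.le]; linarith
  have hev2 : ∀ᶠ ν in 𝓝 (0 : ℂ), Q ν < 2 * Q 0 :=
    hQc.continuousAt.eventually_lt_const (by linarith)
  refine ⟨_, hexp.and (hev1.and (hev2.and (eventually_re_lt one_pos))),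
    fun ν => (I ν - ∑ k ∈ Finset.range N, c k ν * m k ν) / m N ν, ?_, ?_⟩
  · refine ContinuousAt.div (hI.sub ?_) (hmc N).continuousAt hne
    exact tendsto_finsetSum _ fun k hk => (ih k (Finset.mem_range.1 hk)).mul (hmc k).continuousAt
  · rintro ν ⟨hν1, hν2, hν3, hν4⟩
    refine hεu ?_
    have hmpos : 0 < ‖m N ν‖ := lt_trans (by linarith) hν2
    have hmne : m N ν ≠ 0 := norm_pos_iff.1 hmpos
    have hFi : Integrable (fun ω => (ψ ω : ℂ) * F ν ω) := by
      have h1 := (locallyIntegrable_shifted (μ := 0) (h.admissible ν hν4)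
        ).integrable_smul_left_of_hasCompactSupport (g := fun ω => (ψ ω : ℂ))
        (Complex.continuous_ofReal.comp hψc) (b.hasCompactSupport.comp_left Complex.ofReal_zero)
      refine h1.congr (Eventually.of_forall fun ω => ?_)
      simp only [smul_eq_mul]
      by_cases hω : ψ ω = 0
      · simp [hω]
      · rw [shifted_of_gt (by linarith [(hψsupp ω hω).1]), add_zero]
    have hIs : I ν = ∫ ω in Set.Ioi (0 : ℝ), (ψ ω : ℂ) * F ν ω := by
      refine (setIntegral_eq_integral_of_forall_compl_eq_zero fun ω hω => ?_).symm
      have : ψ ω = 0 := by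
        by_contra hne
        exact hω (hlam.trans (hψsupp ω hne).1)
      simp [this]
    have hPi := hasMellin_sum (Finset.range (N + 1)) (s := 1)
      (f := fun k ω => c k ν • ((ω : ℂ) ^ ((d : ℂ) - 2 * ν - k) • (ψ ω : ℂ)))
      (m := fun k => c k ν * m k ν) (fun k _ => by
        refine hasMellin_smul ⟨?_, ?_⟩ _
        · refine (MellinConvergent.cpow_smul (f := fun ω => (ψ ω : ℂ))).2 (hψm _)
        · rw [mellin_cpow_smul]; simp only [hm]; congr 1; ring)
    have hPe : ∀ ω : ℝ, ∑ k ∈ Finset.range (N + 1), c k ν • ((ω : ℂ) ^ ((d : ℂ) - 2 * ν - k) •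
        (ψ ω : ℂ)) = powTrunc (d - 2 * ν) (fun k => c k ν) (N + 1) ω * ψ ω := fun ω => by
      rw [powTrunc, Finset.sum_mul]
      simp only [smul_eq_mul, mul_assoc]
    simp only [hPe] at hPi
    have hPi1 : IntegrableOn (fun ω => powTrunc (d - 2 * ν) (fun k => c k ν) (N + 1) ω * ψ ω)
        (Set.Ioi 0) volume := by simpa [MellinConvergent] using hPi.1
    have hPi2 : ∫ ω in Set.Ioi (0 : ℝ), powTrunc (d - 2 * ν) (fun k => c k ν) (N + 1) ω * ψ ω =
        ∑ k ∈ Finset.range (N + 1), c k ν * m k ν := by simpa [mellin] using hPi.2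
    have herr : I ν - ∑ k ∈ Finset.range (N + 1), c k ν * m k ν = ∫ ω in Set.Ioi (0 : ℝ),
        ((ψ ω : ℂ) * F ν ω - powTrunc (d - 2 * ν) (fun k => c k ν) (N + 1) ω * ψ ω) := by
      rw [integral_sub hFi.integrableOn hPi1, hIs, hPi2]
    have hbd : ‖I ν - ∑ k ∈ Finset.range (N + 1), c k ν * m k ν‖ ≤ |C| / lam * Q ν := by
      rw [herr, hQ, ← integral_const_mul]
      refine norm_integral_le_of_norm_le ((hQi _).const_mul _) ?_
      filter_upwards [ae_restrict_mem measurableSet_Ioi] with ω hω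
      have hω0 : 0 < ω := hω
      rw [mul_comm (ψ ω : ℂ), ← sub_mul, norm_mul, Complex.norm_of_nonneg (hψ0 ω)]
      by_cases hψω : ψ ω = 0
      · simp [hψω]
      · have hωl := (hψsupp ω hψω).1
        have h1 := hν1 ω (hlamR.trans hωl.le)
        have e1 : ((d : ℂ) - 2 * ν).re - ((N + 1 : ℕ) : ℝ) = (d : ℝ) - 2 * ν.re - N - 1 := by
          simp; ring
        rw [e1, Real.rpow_sub_one hω0.ne'] at h1
        have h2 : C * (ω ^ ((d : ℝ) - 2 * ν.re - N) / ω) ≤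
            |C| * (ω ^ ((d : ℝ) - 2 * ν.re - N) / lam) := by
          have := hψ0 ω
          gcongr
          exact le_abs_self C
        calc _ ≤ |C| * (ω ^ ((d : ℝ) - 2 * ν.re - N) / lam) * ψ ω := by
              gcongr
              · exact hψ0 ω
              · exact h1.trans h2
          _ = _ := by ring
    have e2 : c N ν - (I ν - ∑ k ∈ Finset.range N, c k ν * m k ν) / m N ν =
        -((I ν - ∑ k ∈ Finset.range (N + 1), c k ν * m k ν) / m N ν) := by
      rw [Finset.sum_range_succ]; field_simp; ring
    rw [dist_eq_norm, e2, norm_neg, norm_div, div_lt_iff₀ hmpos]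
    refine hbd.trans_lt ?_
    have h3 : |C| / lam * Q ν ≤ |C| / lam * (4 * ‖m N ν‖) := by gcongr; linarith
    have h4 : |C| / lam * 4 < ε := by
      rw [div_mul_eq_mul_div, div_lt_iff₀ hlam, ← div_lt_iff₀' hε, mul_comm |C|]
      exact hlamC
    calc _ ≤ |C| / lam * (4 * ‖m N ν‖) := h3
      _ = |C| / lam * 4 * ‖m N ν‖ := by ring
      _ < ε * ‖m N ν‖ := by gcongr

lemma RegularFamily.continuousAt_shiftCoeff (h : RegularFamily F ω₀ d c) (μ : ℝ) (m : ℕ) :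
    ContinuousAt (fun ν => shiftCoeff (d - 2 * ν) (fun k => c k ν) μ m) 0 := by
  refine tendsto_finsetSum _ fun k _ => ((h.continuousAt_coeff k).mul ?_).mul continuousAt_const
  exact ((continuous_genBinom _).comp (by fun_prop)).continuousAt

/-- The expansion of the shifted family, uniform near `0`. -/
lemma RegularFamily.shifted_bound (h : RegularFamily F ω₀ d c) (μ : ℝ) (n : ℕ) :
    ∃ C R : ℝ, 0 < R ∧ ∀ᶠ ν in 𝓝 (0 : ℂ), ∀ x : ℝ, R ≤ x →
      ‖F ν (x + μ) - powTrunc (d - 2 * ν) (shiftCoeff (d - 2 * ν) (fun k => c k ν) μ) n x‖ ≤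
        C * x ^ (((d : ℂ) - 2 * ν).re - n) := by
  have hc : ∀ᶠ ν in 𝓝 (0 : ℂ), ∀ k ∈ Finset.range (n + 1), ‖c k ν‖ ≤
      ∑ k ∈ Finset.range (n + 1), (‖c k 0‖ + 1) := by
    rw [Finset.eventually_all]
    intro k hk
    have h1 := (h.continuousAt_coeff k).norm.eventually_lt_const (lt_add_one ‖c k 0‖)
    refine h1.mono fun ν hν => hν.le.trans ?_
    exact Finset.single_le_sum (f := fun k => ‖c k 0‖ + 1) (fun _ _ => by positivity) hk
  have hA : ∀ᶠ ν in 𝓝 (0 : ℂ), ‖(d : ℂ) - 2 * ν‖ ≤ d + 2 := by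
    have h1 : ContinuousAt (fun ν : ℂ => ‖(d : ℂ) - 2 * ν‖) 0 := by fun_prop
    refine (h1.eventually_lt_const (u := (d : ℝ) + 2) (by simp)).mono fun ν hν => hν.le
  -- The uniform expansion has at least one term, while n = 0 is also needed. One extra term is
  -- taken and then moved into the error, which adds B to the constant.
  obtain ⟨C, R, hR, hexp⟩ := powTrunc_bound_of_uniform h.expansion n
  set B := ∑ k ∈ Finset.range (n + 1), (‖c k 0‖ + 1)
  have hB : 0 ≤ B := Finset.sum_nonneg fun _ _ => by positivity
  obtain ⟨C', R', hR', h'⟩ := shift_expansion (d + 2) B (|C| + B) (max R 1) μ n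
  refine ⟨C', R', hR', ?_⟩
  filter_upwards [hc, hA, hexp] with ν h1 h2 h3
  refine h' _ _ _ h2 (fun k hk => h1 k (Finset.mem_range.2 (by omega))) fun ω hω => ?_
  have hω1 : 1 ≤ ω := (le_max_right _ _).trans hω
  have hω0 : 0 < ω := by linarith
  have h4 := h3 ω ((le_max_left _ _).trans hω)
  have h5 : F ν ω - powTrunc (d - 2 * ν) (fun k => c k ν) n ω =
      (F ν ω - powTrunc (d - 2 * ν) (fun k => c k ν) (n + 1) ω) +
        c n ν * (ω : ℂ) ^ ((d : ℂ) - 2 * ν - n) := by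
    rw [powTrunc, powTrunc, Finset.sum_range_succ]; ring
  rw [h5, add_mul]
  refine (norm_add_le _ _).trans (add_le_add (h4.trans ?_) ?_)
  · have h6 : ω ^ (((d : ℂ) - 2 * ν).re - ((n + 1 : ℕ) : ℝ)) ≤
        ω ^ (((d : ℂ) - 2 * ν).re - (n : ℝ)) :=
      Real.rpow_le_rpow_of_exponent_le hω1 (by push_cast; linarith)
    calc _ ≤ |C| * ω ^ (((d : ℂ) - 2 * ν).re - ((n + 1 : ℕ) : ℝ)) := by
          gcongr; exact le_abs_self C
      _ ≤ _ := by gcongr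
  · rw [norm_mul, norm_ofReal_cpow hω0]
    have h7 : ((d : ℂ) - 2 * ν - n).re = ((d : ℂ) - 2 * ν).re - n := by simp
    rw [h7]
    gcongr
    exact h1 n (Finset.mem_range.2 (by omega))

lemma RegularFamily.eventually_powerTail (h : RegularFamily F ω₀ d c) {μ : ℝ} (hμ : μ < ω₀)
    (n : ℕ) : ∀ᶠ ν in 𝓝 (0 : ℂ), PowerTail (shifted (F ν) ω₀ μ) (ω₀ - μ) (d - 2 * ν)
      (shiftCoeff (d - 2 * ν) (fun k => c k ν) μ) n := by
  obtain ⟨C, R, hR, hb⟩ := h.shifted_bound μ n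
  filter_upwards [hb, eventually_re_lt one_pos] with ν h1 h2
  exact powerTail_of_bound (h.admissible ν h2) hμ h1

/-- A smooth cutoff that is `1` on `(-∞, lam]` and `0` on `[2 lam, ∞)`. -/
def cutoff (lam x : ℝ) : ℝ := Real.smoothTransition (2 - x / lam)

lemma cutoff_of_le {lam x : ℝ} (hl : 0 < lam) (hx : x ≤ lam) : cutoff lam x = 1 := by
  refine Real.smoothTransition.one_of_one_le ?_
  have : x / lam ≤ 1 := (div_le_one hl).2 hx
  linarith

lemma cutoff_of_ge {lam x : ℝ} (hl : 0 < lam) (hx : 2 * lam ≤ x) : cutoff lam x = 0 := by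
  refine Real.smoothTransition.zero_of_nonpos ?_
  have : 2 ≤ x / lam := (le_div_iff₀ hl).2 hx
  linarith

lemma contDiff_cutoff (lam : ℝ) : ContDiff ℝ (⊤ : ℕ∞) (cutoff lam) :=
  Real.smoothTransition.contDiff.comp (contDiff_const.sub (contDiff_id.div_const _))

lemma cutoff_nonneg (lam x : ℝ) : 0 ≤ cutoff lam x := Real.smoothTransition.nonneg _

lemma cutoff_le_one (lam x : ℝ) : cutoff lam x ≤ 1 := Real.smoothTransition.le_one _

/-- Continuity in `ν` of the pairing with a smooth weight that is cut off at infinity. -/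
lemma RegularFamily.continuousAt_integral_cutoff (h : RegularFamily F ω₀ d c) {μ : ℝ}
    (hμ : μ < ω₀) {w : ℝ → ℝ} (hw : ∀ x, 0 < x → ContDiffAt ℝ (⊤ : ℕ∞) w x) {lam : ℝ}
    (hl : 0 < lam) :
    ContinuousAt (fun ν => ∫ x in Set.Ioi (0 : ℝ),
      shifted (F ν) ω₀ μ x * ((cutoff lam x * w x : ℝ) : ℂ)) 0 := by
  -- The weight is smooth only for ω > μ, and only ω > 0 enters the integral. The factor θ rises
  -- from 0 to 1 between a > max(0, μ) and ω₀, where the family vanishes, so φ becomes a test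
  -- function without changing the integral.
  set a : ℝ := (max 0 μ + ω₀) / 2 with ha
  have hm : max 0 μ < ω₀ := max_lt h.pos hμ
  have ha1 : max 0 μ < a := by linarith
  have ha2 : a < ω₀ := by linarith
  set θ : ℝ → ℝ := fun ω => Real.smoothTransition ((ω - a) / (ω₀ - a)) with hθ
  have hθ0 : ∀ ω ≤ a, θ ω = 0 := fun ω hω => Real.smoothTransition.zero_of_nonpos
    (div_nonpos_of_nonpos_of_nonneg (by linarith) (by linarith))
  have hθ1 : ∀ ω, ω₀ ≤ ω → θ ω = 1 := fun ω hω => Real.smoothTransition.one_of_one_le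
    ((one_le_div (by linarith)).2 (by linarith))
  have hθs : ContDiff ℝ (⊤ : ℕ∞) θ :=
    Real.smoothTransition.contDiff.comp ((contDiff_id.sub contDiff_const).div_const _)
  set φ : ℝ → ℝ := fun ω => θ ω * (cutoff lam (ω - μ) * w (ω - μ)) with hφ
  have hφs : ContDiff ℝ (⊤ : ℕ∞) φ := by
    rw [contDiff_iff_contDiffAt]
    intro ω
    rcases lt_or_ge ω a with hω | hω
    · refine contDiffAt_const (c := (0 : ℝ)) |>.congr_of_eventuallyEq ?_
      filter_upwards [eventually_lt_nhds hω] with z hz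
      simp [hφ, hθ0 z hz.le]
    · have h1 : 0 < ω - μ := by linarith [le_max_right 0 μ]
      have hs : ContDiffAt ℝ (⊤ : ℕ∞) (fun ω : ℝ => ω - μ) ω := contDiffAt_id.sub contDiffAt_const
      exact hθs.contDiffAt.mul (((contDiff_cutoff lam).contDiffAt.comp ω hs).mul
        (ContDiffAt.comp ω (hw _ h1) hs))
  have hφc : HasCompactSupport φ := by
    refine HasCompactSupport.intro (isCompact_Icc (a := a) (b := μ + 2 * lam)) fun ω hω => ?_
    rw [Set.mem_Icc, not_and_or, not_le, not_le] at hω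
    rcases hω with hω | hω
    · simp [hφ, hθ0 ω hω.le]
    · simp [hφ, cutoff_of_ge hl (show 2 * lam ≤ ω - μ by linarith)]
  refine (h.continuousAt φ hφs hφc).congr ?_
  filter_upwards [eventually_re_lt one_pos] with ν hν
  have hadm := h.admissible ν hν
  have h1 := integral_shifted hadm h.pos hμ (fun x => ((cutoff lam x * w x : ℝ) : ℂ))
  rw [← h1, ← integral_indicator measurableSet_Ioi]
  refine integral_congr_ae (Eventually.of_forall fun ω => ?_)
  simp only
  rcases le_or_gt ω 0 with h0 | h0
  · rw [Set.indicator_of_notMem (show ω ∉ Set.Ioi 0 from not_lt.2 h0)]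
    simp [hφ, hθ0 ω (by linarith [le_max_left 0 μ])]
  · rw [Set.indicator_of_mem (show ω ∈ Set.Ioi 0 from h0)]
    rcases le_or_gt ω ω₀ with h2 | h2
    · simp [hadm.vanishes ω ⟨h0.le, h2⟩]
    · simp only [hφ, hθ1 ω h2.le, one_mul]; ring

end HighTemp

end

/-! ### Continuity of the remainder and of the thermal integral at ν = 0 -/

noncomputable section

namespace HighTemp

variable {F : ℂ → ℝ → ℂ} {ω₀ : ℝ} {d : ℕ} {c : ℕ → ℂ → ℂ}

/-- Continuity in `ν` of the integral of the excess over the power expansion against a smooth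
weight of power growth. -/
theorem RegularFamily.continuousAt_integral_excess (h : RegularFamily F ω₀ d c) {μ : ℝ}
    (hμ : μ < ω₀) {w : ℝ → ℝ} (hw : ∀ x, 0 < x → ContDiffAt ℝ (⊤ : ℕ∞) w x) {x₀ Cw : ℝ}
    (hC : ∀ x, 0 < x → |w x| ≤ Cw * x ^ x₀) {n : ℕ} (hs : ∀ m < n, (m : ℝ) < x₀ + 1 + d)
    (hs' : x₀ + 1 + d < n) :
    ContinuousAt (fun ν => ∫ x in Set.Ioi (0 : ℝ), (shifted (F ν) ω₀ μ x -
      powTrunc (d - 2 * ν) (shiftCoeff (d - 2 * ν) (fun k => c k ν) μ) n x) * (w x : ℂ)) 0 := by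
  refine continuousAt_of_locally_uniform_approx_of_continuousAt fun u hu => ?_
  obtain ⟨ε, hε, hεu⟩ := Metric.mem_uniformity_dist.1 hu
  obtain ⟨C, R, hR, hb⟩ := h.shifted_bound μ n
  -- Half of the gap to the edge of the strip is kept in reserve: for |Re ν| < η/2 the integrand is
  -- O(x^(-1-η)) uniformly in ν, so the part beyond λ is uniformly small.
  obtain ⟨η, hη, hηn⟩ : ∃ η : ℝ, 0 < η ∧ 2 * η = n - x₀ - 1 - d :=
    ⟨(n - x₀ - 1 - d) / 2, by linarith, by ring⟩
  have hCw : 0 ≤ Cw := by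
    have := (abs_nonneg _).trans (hC 1 one_pos)
    simpa using this
  have hlim : Tendsto (fun l : ℝ => |C| * Cw * (l ^ (-η) / η)) atTop (𝓝 0) := by
    have := ((tendsto_rpow_neg_atTop hη).div_const η).const_mul (|C| * Cw)
    simpa using this
  obtain ⟨lam, hlamε, hlam1, hlamR, hlamω⟩ := ((hlim.eventually_lt_const hε).and
    ((eventually_ge_atTop 1).and ((eventually_ge_atTop R).and
      (eventually_ge_atTop (ω₀ - μ))))).exists
  have hlam : 0 < lam := by linarith
  set v : ℝ → ℂ := fun x => ((cutoff lam x * w x : ℝ) : ℂ) with hv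
  have hwc : ContinuousOn w (Set.Ioi 0) := fun x hx => (hw x hx).continuousAt.continuousWithinAt
  have hwC : ContinuousOn (fun x => (w x : ℂ)) (Set.Ioi 0) :=
    Complex.continuous_ofReal.comp_continuousOn hwc
  have hvc : ContinuousOn v (Set.Ioi 0) := Complex.continuous_ofReal.comp_continuousOn
    ((contDiff_cutoff lam).continuous.continuousOn.mul hwc)
  have hvli : LocallyIntegrableOn v (Set.Ioi 0) volume := hvc.locallyIntegrableOn measurableSet_Ioi
  have hvC : ∀ x, 0 < x → ‖v x‖ ≤ Cw * x ^ x₀ := fun x hx => by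
    rw [hv, Complex.norm_real, Real.norm_eq_abs, abs_mul, abs_of_nonneg (cutoff_nonneg _ _)]
    calc _ ≤ 1 * |w x| := by gcongr; exact cutoff_le_one _ _
      _ ≤ _ := by rw [one_mul]; exact hC x hx
  have hvtop : ∀ q : ℝ, v =O[atTop] fun x : ℝ => x ^ q := fun q => by
    refine (isBigO_zero _ _).congr' ?_ EventuallyEq.rfl
    filter_upwards [eventually_ge_atTop (2 * lam)] with x hx
    simp [hv, cutoff_of_ge hlam hx]
  have hvzero : v =O[𝓝[>] 0] fun x : ℝ => x ^ (-(-x₀)) := by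
    refine IsBigO.of_bound Cw ?_
    filter_upwards [self_mem_nhdsWithin] with x hx
    have hx0 : 0 < x := hx
    rw [neg_neg, Real.norm_of_nonneg (by positivity)]
    exact hvC x hx
  have hvm : ∀ s : ℂ, -x₀ < s.re → MellinConvergent v s := fun s hs =>
    mellinConvergent_of_isBigO_rpow (a := s.re + 1) hvli (hvtop _) (by linarith) hvzero hs
  have hvd : ∀ s : ℂ, -x₀ < s.re → DifferentiableAt ℂ (mellin v) s := fun s hs =>
    mellin_differentiableAt_of_isBigO_rpow (a := s.re + 1) hvli (hvtop _) (by linarith) hvzero hs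
  have hev1 : ∀ᶠ ν in 𝓝 (0 : ℂ), ∀ m ∈ Finset.range n, (m : ℝ) < x₀ + 1 + ((d : ℂ) - 2 * ν).re := by
    rw [Finset.eventually_all]
    intro m hm
    have h1 : ContinuousAt (fun ν : ℂ => x₀ + 1 + ((d : ℂ) - 2 * ν).re) 0 := by fun_prop
    exact h1.eventually_const_lt (by simpa using hs m (Finset.mem_range.1 hm))
  have hev2 : ∀ᶠ ν in 𝓝 (0 : ℂ), |ν.re| < η / 2 := eventually_abs_re_lt (by positivity)
  -- The approximant uses the cut-off weight v: the pairing with the family is a test-function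
  -- pairing, and the subtracted powers give Mellin transforms of v, continuous in ν.
  refine ⟨_, hb.and (hev1.and (hev2.and (h.eventually_powerTail hμ n))), fun ν =>
    (∫ x in Set.Ioi (0 : ℝ), shifted (F ν) ω₀ μ x * v x) - ∑ m ∈ Finset.range n,
      shiftCoeff (d - 2 * ν) (fun k => c k ν) μ m * mellin v ((d : ℂ) - 2 * ν - m + 1), ?_, ?_⟩
  · refine (h.continuousAt_integral_cutoff hμ hw hlam).sub ?_
    refine tendsto_finsetSum _ fun m hm => (h.continuousAt_shiftCoeff μ m).mul ?_
    have h1 := hs m (Finset.mem_range.1 hm)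
    refine ContinuousAt.comp (f := fun ν : ℂ => (d : ℂ) - 2 * ν - m + 1) (g := mellin v)
      (hvd _ ?_).continuousAt (by fun_prop)
    simp; linarith
  · rintro ν ⟨hν1, hν2, hν3, hT⟩
    refine hεu ?_
    set g := shifted (F ν) ω₀ μ
    set e := shiftCoeff (d - 2 * ν) (fun k => c k ν) μ
    have hre : ((d : ℂ) - 2 * ν).re = d - 2 * ν.re := by simp
    obtain ⟨ha1, ha2⟩ := abs_lt.1 hν3
    have hsν : ∀ m < n, (m : ℝ) < x₀ + 1 + ((d : ℂ) - 2 * ν).re := fun m hm =>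
      hν2 m (Finset.mem_range.2 hm)
    have hsν' : x₀ + 1 + ((d : ℂ) - 2 * ν).re < n := by rw [hre]; linarith
    have hiw : IntegrableOn (fun x => (g x - powTrunc (d - 2 * ν) e n x) * (w x : ℂ))
        (Set.Ioi 0) volume :=
      hT.integrable_excess_mul hsν hsν' hwC fun x hx => by simpa using hC x hx
    have hiv : IntegrableOn (fun x => (g x - powTrunc (d - 2 * ν) e n x) * v x)
        (Set.Ioi 0) volume := hT.integrable_excess_mul hsν hsν' hvc hvC
    have hPi := hasMellin_sum (Finset.range n) (s := 1)
      (f := fun m x => e m • ((x : ℂ) ^ ((d : ℂ) - 2 * ν - m) • v x))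
      (m := fun m => e m * mellin v ((d : ℂ) - 2 * ν - m + 1)) (fun m hm => by
        have h1 := hsν m (Finset.mem_range.1 hm)
        rw [hre] at h1
        refine hasMellin_smul ⟨MellinConvergent.cpow_smul.2 (hvm _ ?_), ?_⟩ _
        · simp; linarith
        · rw [mellin_cpow_smul]; congr 1; ring)
    have hPe : ∀ x : ℝ, ∑ m ∈ Finset.range n, e m • ((x : ℂ) ^ ((d : ℂ) - 2 * ν - m) • v x) =
        powTrunc (d - 2 * ν) e n x * v x := fun x => by
      rw [powTrunc, Finset.sum_mul]
      simp only [smul_eq_mul, mul_assoc]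
    simp only [hPe] at hPi
    have hPi1 : IntegrableOn (fun x => powTrunc (d - 2 * ν) e n x * v x) (Set.Ioi 0) volume := by
      simpa [MellinConvergent] using hPi.1
    have hPi2 : ∫ x in Set.Ioi (0 : ℝ), powTrunc (d - 2 * ν) e n x * v x =
        ∑ m ∈ Finset.range n, e m * mellin v ((d : ℂ) - 2 * ν - m + 1) := by
      simpa [mellin] using hPi.2
    have hgv : ∫ x in Set.Ioi (0 : ℝ), g x * v x =
        (∫ x in Set.Ioi (0 : ℝ), (g x - powTrunc (d - 2 * ν) e n x) * v x) +
          ∫ x in Set.Ioi (0 : ℝ), powTrunc (d - 2 * ν) e n x * v x := by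
      rw [← integral_add hiv hPi1]
      congr 1
      ext x; ring
    rw [dist_eq_norm]
    change ‖_ - ((∫ x in Set.Ioi (0 : ℝ), g x * v x) - ∑ m ∈ Finset.range n,
      e m * mellin v ((d : ℂ) - 2 * ν - m + 1))‖ < ε
    rw [hgv, hPi2, add_sub_cancel_right, ← integral_sub hiw hiv]
    have hint : IntegrableOn (fun x : ℝ => x ^ (-1 - η)) (Set.Ioi lam) volume :=
      integrableOn_Ioi_rpow_of_lt (by linarith) hlam
    have hval : ∫ x in Set.Ioi lam, x ^ (-1 - η) = lam ^ (-η) / η := by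
      rw [integral_Ioi_rpow_of_lt (by linarith) hlam, show -1 - η + 1 = -η by ring, neg_div_neg_eq]
    refine lt_of_le_of_lt ?_ hlamε
    rw [← hval, ← integral_const_mul]
    have hind : ∫ x in Set.Ioi lam, |C| * Cw * x ^ (-1 - η) = ∫ x in Set.Ioi (0 : ℝ),
        Set.indicator (Set.Ioi lam) (fun x => |C| * Cw * x ^ (-1 - η)) x := by
      rw [setIntegral_indicator measurableSet_Ioi, Set.inter_eq_self_of_subset_right
        (Set.Ioi_subset_Ioi hlam.le)]
    rw [hind]
    refine norm_integral_le_of_norm_le ?_ ?_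
    · exact ((integrable_indicator_iff measurableSet_Ioi).2 (hint.const_mul _)).integrableOn
    · filter_upwards [ae_restrict_mem measurableSet_Ioi] with x hx
      have hx0 : 0 < x := hx
      rw [← mul_sub, norm_mul]
      rcases le_or_gt x lam with hxl | hxl
      · simp only [hv]
        rw [cutoff_of_le hlam hxl, Set.indicator_of_notMem (show x ∉ Set.Ioi lam from not_lt.2 hxl)]
        simp
      · rw [Set.indicator_of_mem (show x ∈ Set.Ioi lam from hxl)]
        have h1 : ‖g x - powTrunc (d - 2 * ν) e n x‖ ≤ |C| * x ^ (((d : ℂ) - 2 * ν).re - n) := by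
          have h2 := hν1 x (hlamR.trans hxl.le)
          rw [← shifted_of_gt (f := F ν) (ω₀ := ω₀) (hlamω.trans_lt hxl)] at h2
          exact h2.trans (by gcongr; exact le_abs_self C)
        have h3 : ‖(w x : ℂ) - v x‖ ≤ Cw * x ^ x₀ := by
          have h4 : (w x : ℂ) - v x = (((1 - cutoff lam x) * w x : ℝ) : ℂ) := by
            rw [hv]; push_cast; ring
          rw [h4, Complex.norm_real, Real.norm_eq_abs, abs_mul,
            abs_of_nonneg (by linarith [cutoff_le_one lam x])]
          calc _ ≤ 1 * |w x| := by gcongr; linarith [cutoff_nonneg lam x]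
            _ ≤ _ := by rw [one_mul]; exact hC x hx0
        calc _ ≤ (|C| * x ^ (((d : ℂ) - 2 * ν).re - n)) * (Cw * x ^ x₀) := by gcongr
          _ = |C| * Cw * x ^ (((d : ℂ) - 2 * ν).re - n + x₀) := by
              rw [Real.rpow_add hx0]; ring
          _ ≤ _ := by
              gcongr
              · linarith
              · rw [hre]; linarith

/-- Continuity in `ν` of the remainder of the high-temperature expansion. -/
theorem RegularFamily.continuousAt_remainder (h : RegularFamily F ω₀ d c) {μ : ℝ} (hμ : μ < ω₀)
    (st : Statistics) {x₀ : ℝ} (hx : ∀ l : ℤ, x₀ ≠ l) {n : ℕ}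
    (hs : ∀ m < n, (m : ℝ) < x₀ + 1 + d) (hs' : x₀ + 1 + d < n) {β : ℝ} (hβ : 0 < β) :
    ContinuousAt (fun ν => remainder st (shifted (F ν) ω₀ μ) (d - 2 * ν)
      (shiftCoeff (d - 2 * ν) (fun k => c k ν) μ) n x₀ β) 0 := by
  obtain ⟨C, -, hC⟩ := exists_bound_occTruncC st hx
  refine h.continuousAt_integral_excess hμ (w := fun x => occTrunc st (truncOrder x₀) (β * x))
    (fun x hx0 => ?_) (x₀ := x₀) (Cw := C * β ^ x₀) (fun x hx0 => ?_) hs hs'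
  · have h1 : AnalyticAt ℝ (occTrunc st (truncOrder x₀)) (β * x) :=
      analyticAt_occTrunc st _ (by positivity)
    exact ContDiffAt.comp x (f := fun x : ℝ => β * x) h1.contDiffAt (by fun_prop)
  · have := bound_occTruncC_mul hβ hC hx0
    simpa [occTruncC] using this

/-- With n = 0 nothing is subtracted from g, and with x₀ < -1 nothing from the occupation function.
Continuity of the thermal integral is thus a case of continuity of the remainder. -/
lemma remainder_zero_eq_thermalIntegral {f : ℝ → ℂ} {μ : ℝ} (hf : Admissible f ω₀) (hω : 0 < ω₀)
    (hμ : μ < ω₀) (st : Statistics) (α : ℂ) (e : ℕ → ℂ) {x₀ : ℝ} (hx : x₀ < -1) (β : ℝ) :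
    remainder st (shifted f ω₀ μ) α e 0 x₀ β = thermalIntegral st f β μ := by
  have h1 : truncOrder x₀ = 0 := by
    have h2 : ⌊x₀⌋ < -1 := Int.floor_lt.2 (by simpa using hx)
    unfold truncOrder; omega
  rw [thermalIntegral, integral_shifted hf hω hμ (fun x => (occupation st (β * x) : ℂ)), remainder, h1]
  simp [powTrunc, occTruncC, occTrunc_zero]

lemma sub_half_ne_intCast (a l : ℤ) : (a : ℝ) - 1 / 2 ≠ l := fun h => by
  have h1 : ((2 * a - 1 : ℤ) : ℝ) = ((2 * l : ℤ) : ℝ) := by push_cast; linarith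
  have h2 : 2 * a - 1 = 2 * l := by exact_mod_cast h1
  omega

lemma RegularFamily.continuousAt_thermalIntegral (h : RegularFamily F ω₀ d c) {μ : ℝ} (hμ : μ < ω₀)
    (st : Statistics) {β : ℝ} (hβ : 0 < β) :
    ContinuousAt (fun ν => thermalIntegral st (F ν) β μ) 0 := by
  have hx := sub_half_ne_intCast (-(d : ℤ) - 1)
  have h1 := h.continuousAt_remainder hμ st hx (n := 0) (by simp) (by push_cast; linarith) hβ
  refine h1.congr ?_
  filter_upwards [eventually_re_lt one_pos] with ν hν
  refine remainder_zero_eq_thermalIntegral (h.admissible ν hν) h.pos hμ st _ _ ?_ β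
  have : (0 : ℝ) ≤ d := d.cast_nonneg
  push_cast; linarith

end HighTemp

end

/-! ### The limit ν → 0 of the expansion and its logarithms -/

noncomputable section

namespace HighTemp

variable {F : ℂ → ℝ → ℂ} {ω₀ : ℝ} {d : ℕ} {c : ℕ → ℂ → ℂ}

lemma tendsto_exp_slope (a : ℂ) :
    Tendsto (fun ν : ℂ => (Complex.exp (2 * ν * a) - 1) / ν) (𝓝[≠] 0) (𝓝 (2 * a)) := by
  have h1 : HasDerivAt (fun ν : ℂ => Complex.exp (2 * ν * a)) (2 * a) 0 := by
    have h2 : HasDerivAt (fun ν : ℂ => 2 * ν * a) (2 * a) 0 := by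
      simpa using ((hasDerivAt_id (0 : ℂ)).const_mul 2).mul_const a
    simpa using h2.cexp
  have h3 := h1.tendsto_slope
  refine h3.congr fun ν => ?_
  simp [slope_def_field]

/-- If `β^{2ν} A(ν) + B(ν)` converges as `ν → 0` for every `β > 0`, then the limit is an affine
function of `log β`. -/
lemma exists_log_of_tendsto {A B : ℂ → ℂ} {t : ℝ → ℂ}
    (h : ∀ β : ℝ, 0 < β → Tendsto (fun ν : ℂ => (β : ℂ) ^ (2 * ν) * A ν + B ν) (𝓝[≠] 0) (𝓝 (t β))) :
    ∃ a b : ℂ, ∀ β : ℝ, 0 < β → t β = a + b * (Real.log β : ℂ) := by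
  have h1 := h 1 one_pos
  have hd : ∀ β : ℝ, 0 < β → Tendsto (fun ν : ℂ =>
      (Complex.exp (2 * ν * (Real.log β : ℂ)) - 1) * A ν) (𝓝[≠] 0) (𝓝 (t β - t 1)) := fun β hβ => by
    refine ((h β hβ).sub h1).congr fun ν => ?_
    rw [Complex.cpow_def_of_ne_zero (by exact_mod_cast hβ.ne'), ← Complex.ofReal_log hβ.le,
      mul_comm (Real.log β : ℂ)]
    simp; ring
  -- The value β = e calibrates A: it gives the limit of (e^(2ν) - 1) A(ν), and (e^(2ν log β) -
  -- 1)/(e^(2ν) - 1) tends to log β.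
  have he := hd (Real.exp 1) (Real.exp_pos 1)
  simp only [Real.log_exp, Complex.ofReal_one] at he
  refine ⟨t 1, t (Real.exp 1) - t 1, fun β hβ => ?_⟩
  have h2 := (he.mul (tendsto_exp_slope (Real.log β))).div (tendsto_exp_slope 1) (by norm_num)
  have h3 : ∀ᶠ ν : ℂ in 𝓝[≠] 0, (Complex.exp (2 * ν * 1) - 1) / ν ≠ 0 :=
    (tendsto_exp_slope 1).eventually_ne (by norm_num)
  have h4 := tendsto_nhds_unique (h2.congr' ?_) (hd β hβ)
  · rw [← sub_eq_iff_eq_add', ← h4]; ring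
  · filter_upwards [h3, self_mem_nhdsWithin] with ν h5 h6
    have h6' : ν ≠ 0 := h6
    have h7 : Complex.exp (2 * ν * 1) - 1 ≠ 0 := fun h => h5 (by rw [h, zero_div])
    rw [mul_one] at h7
    simp only [Pi.div_apply, mul_one]
    field_simp

lemma eventually_two_mul_ne_intCast : ∀ᶠ ν : ℂ in 𝓝[≠] 0, ∀ j : ℤ, 2 * ν ≠ j := by
  have h1 : Tendsto (fun ν : ℂ => 2 * ν) (𝓝[≠] 0) (𝓝[≠] 0) := by
    refine tendsto_nhdsWithin_of_tendsto_nhds_of_eventually_within _ ?_ ?_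
    · have : ContinuousAt (fun ν : ℂ => 2 * ν) 0 := by fun_prop
      simpa using this.tendsto.mono_left nhdsWithin_le_nhds
    · filter_upwards [self_mem_nhdsWithin] with ν hν
      exact mul_ne_zero two_ne_zero hν
  exact h1.eventually (eventually_ne_intCast 0)

lemma partialExpansion_of_neg (st : Statistics) (f : ℝ → ℂ) (ν : ℂ) (e : ℕ → ℂ) (μ : ℝ) {L : ℤ}
    (hL : L + d < 0) (β : ℝ) : partialExpansion st f d ν e μ (L + (d + 1)).toNat L β = 0 := by
  have h1 : (L + (d + 1)).toNat = 0 := by omega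
  have h2 : Finset.Ico (firstIndex st) L = ∅ := by
    refine Finset.Ico_eq_empty ?_
    cases st <;> simp only [firstIndex] <;> omega
  simp [partialExpansion, h1, h2]

/-- The partial expansions converge as `ν → 0`; the error is slightly larger than the first
omitted terms. -/
theorem RegularFamily.exists_limit (h : RegularFamily F ω₀ d c) {μ : ℝ} (hμ : μ < ω₀)
    (st : Statistics) (L : ℤ) : ∃ S : ℝ → ℂ,
    (∀ β : ℝ, 0 < β → Tendsto (fun ν : ℂ =>
      partialExpansion st (F ν) d ν (fun k => c k ν) μ (L + (d + 1)).toNat L β)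
        (𝓝[≠] (0 : ℂ)) (𝓝 (S β))) ∧
    (fun β : ℝ => thermalIntegral st (F 0) β μ - S β) =O[𝓝[>] 0]
      fun β : ℝ => β ^ ((L : ℝ) - 1 / 2) := by
  -- The line x₀ = L - 1/2 misses the integers and stays in the strip belonging to N = L + d as long
  -- as |Re ν| < 1/4. If L + d < 0 the partial expansion is empty and the remainder is the whole
  -- integral.
  have hx := sub_half_ne_intCast L
  have hd : (0 : ℝ) ≤ d := d.cast_nonneg
  rcases lt_or_ge (L + d) 0 with hL | hL
  · refine ⟨fun _ => 0, fun β hβ => by simp only [partialExpansion_of_neg st _ _ _ _ hL]; exact tendsto_const_nhds, ?_⟩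
    have hL' : (L : ℝ) + d + 1 ≤ 0 := by exact_mod_cast (by omega : L + d + 1 ≤ 0)
    have h1 := remainder_isBigO (h.eventually_powerTail hμ 0).self_of_nhds st hx (by simp)
      (by simp; linarith)
    refine h1.congr_left fun β => ?_
    rw [sub_zero]
    exact remainder_zero_eq_thermalIntegral (h.admissible 0 (by simp)) h.pos hμ st _ _
      (by linarith) β
  · obtain ⟨N, hN⟩ := Int.eq_ofNat_of_zero_le hL
    have hNr : (N : ℝ) = L + d := by exact_mod_cast hN.symm
    have hK : (L + (d + 1)).toNat = N + 1 := by omega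
    have hs : ∀ m < N + 1, (m : ℝ) < (L : ℝ) - 1 / 2 + 1 + d := fun m hm => by
      have : (m : ℝ) ≤ N := by exact_mod_cast Nat.lt_succ_iff.1 hm
      linarith
    have hs' : (L : ℝ) - 1 / 2 + 1 + d < (N + 1 : ℕ) := by push_cast; linarith
    have hfl : ⌊(L : ℝ) - 1 / 2⌋ + 1 = L := by
      have : ⌊(L : ℝ) - 1 / 2⌋ = L - 1 := by
        rw [Int.floor_eq_iff]; push_cast; constructor <;> linarith
      omega
    -- For 2ν not an integer the partial expansion equals the thermal integral minus the remainder,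
    -- and both are continuous at 0; this defines the limit although single terms may blow up.
    refine ⟨fun β => thermalIntegral st (F 0) β μ - remainder st (shifted (F 0) ω₀ μ) (d - 2 * 0)
      (shiftCoeff (d - 2 * 0) (fun k => c k 0) μ) (N + 1) (L - 1 / 2) β, fun β hβ => ?_, ?_⟩
    · have h1 := ((h.continuousAt_thermalIntegral hμ st hβ).sub
        (h.continuousAt_remainder hμ st hx hs hs' hβ)).tendsto.mono_left
          (nhdsWithin_le_nhds (s := {0}ᶜ))
      refine h1.congr' ?_
      filter_upwards [eventually_two_mul_ne_intCast,
        (eventually_abs_re_lt (show (0 : ℝ) < 1 / 4 by norm_num)).filter_mono nhdsWithin_le_nhds,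
        (hasPowerExpansion_of_uniform h.expansion N).filter_mono nhdsWithin_le_nhds] with ν h2 h3 h4
      obtain ⟨h5, h6⟩ := abs_lt.1 h3
      have h7 := thermalIntegral_eq (h.admissible ν (by linarith)) h.pos hμ h2 h4 st
        (x₀ := L - 1 / 2) (by linarith) (by linarith) hx hβ
      simp only [Pi.sub_apply]
      rw [hK, partialExpansion_eq st hβ, h7, hfl]
      simp
    · simp only [sub_sub_cancel]
      exact remainder_isBigO (h.eventually_powerTail hμ (N + 1)).self_of_nhds st hx
        (by simpa using hs) (by simpa using hs')

/-- The step from L to L + 1 adds at most one antidiagonal, scaling as β^(L+2ν), and one integer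
term, scaling as β^L. That A and B do not depend on β is what forces the logarithm in the limit to
be simple. -/
lemma partialExpansion_succ (st : Statistics) (f : ℝ → ℂ) (ν : ℂ) (e : ℕ → ℂ) (μ : ℝ) (L : ℤ) :
    ∃ A B : ℂ, ∀ β : ℝ, 0 < β →
      partialExpansion st f d ν e μ (L + 1 + (d + 1)).toNat (L + 1) β
        - partialExpansion st f d ν e μ (L + (d + 1)).toNat L β
      = (β : ℂ) ^ L * ((β : ℂ) ^ (2 * ν) * A + B) := by
  have hI : ∃ B : ℂ, ∀ β : ℝ, ∑ l ∈ Finset.Ico (firstIndex st) (L + 1), integerTerm st f d ν μ β l =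
      ∑ l ∈ Finset.Ico (firstIndex st) L, integerTerm st f d ν μ β l + (β : ℂ) ^ L * B := by
    by_cases hL : firstIndex st ≤ L
    · refine ⟨integerCoeff st L * sigmaFun f d ν μ (L : ℂ), fun β => ?_⟩
      have h1 : Finset.Ico (firstIndex st) (L + 1) = insert L (Finset.Ico (firstIndex st) L) := by
        ext l; simp only [Finset.mem_Ico, Finset.mem_insert]; omega
      rw [h1, Finset.sum_insert (by simp), integerTerm]; ring
    · refine ⟨0, fun β => ?_⟩
      rw [Finset.Ico_eq_empty (by omega), Finset.Ico_eq_empty (by omega)]; simp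
  obtain ⟨B, hB⟩ := hI
  rcases lt_or_ge (L + (d + 1)) 0 with hL | hL
  · refine ⟨0, B, fun β hβ => ?_⟩
    have h1 : (L + 1 + (d + 1)).toNat = (L + (d + 1)).toNat := by omega
    rw [partialExpansion_eq st hβ, partialExpansion_eq st hβ, hB, h1]; ring
  · obtain ⟨K, hK⟩ := Int.eq_ofNat_of_zero_le hL
    have h1 : (L + 1 + (d + 1)).toNat = K + 1 := by omega
    have h2 : (L + (d + 1)).toNat = K := by omega
    have hKc : (K : ℂ) = L + (d + 1) := by exact_mod_cast hK.symm
    refine ⟨groupedTerm st d ν e μ 1 K, B, fun β hβ => ?_⟩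
    have hβc : (β : ℂ) ≠ 0 := by exact_mod_cast hβ.ne'
    have h3 : groupedTerm st d ν e μ β K = (β : ℂ) ^ L * ((β : ℂ) ^ (2 * ν) *
        groupedTerm st d ν e μ 1 K) := by
      rw [groupedTerm, groupedTerm, show (K : ℂ) + 2 * ν - (d + 1) = L + 2 * ν by rw [hKc]; ring,
        Complex.cpow_add _ _ hβc, Complex.cpow_intCast]
      simp only [Complex.ofReal_one, Complex.one_cpow]
      ring
    rw [partialExpansion_eq st hβ, partialExpansion_eq st hβ, hB, h1, h2, Finset.sum_range_succ, h3]
    ring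

lemma continuousAt_reflect (h : ∀ φ : ℝ → ℝ, ContDiff ℝ (⊤ : ℕ∞) φ → HasCompactSupport φ →
    ContinuousAt (fun ν : ℂ => ∫ ω : ℝ, (φ ω : ℂ) * F ν ω) 0) (φ : ℝ → ℝ)
    (hφ : ContDiff ℝ (⊤ : ℕ∞) φ) (hφc : HasCompactSupport φ) :
    ContinuousAt (fun ν : ℂ => ∫ ω : ℝ, (φ ω : ℂ) * F ν (-ω)) 0 := by
  refine (h (fun ω => φ (-ω)) (hφ.comp contDiff_neg)
    (hφc.comp_homeomorph (Homeomorph.neg ℝ))).congr (Eventually.of_forall fun ν => ?_)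
  simpa using integral_neg_eq_self (fun ω => (φ ω : ℂ) * F ν (-ω)) (volume : Measure ℝ)

/-- The bound from `RegularFamily.exists_limit` at L is half a power too weak. At L + 1 it is better
than needed, and the difference of the two limits is β^L times an affine function of log β. -/
theorem limitExpansion (h : RegularFamily F ω₀ d c) {μ : ℝ} (hμ : μ < ω₀) (st : Statistics) :
    LimitExpansion st F d c μ := by
  refine ⟨fun β hβ => integrableOn_thermal (h.admissible 0 (by simp)) h.pos hμ
    (hasPowerExpansion_of_uniform h.expansion 0).self_of_nhds st hβ, fun L => ?_⟩
  obtain ⟨S, hS, -⟩ := h.exists_limit hμ st L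
  obtain ⟨S', hS', hO⟩ := h.exists_limit hμ st (L + 1)
  refine ⟨S, hS, ?_⟩
  choose A B hAB using fun ν : ℂ => partialExpansion_succ (d := d) st (F ν) ν (fun k => c k ν) μ L
  obtain ⟨a, b, hab⟩ := exists_log_of_tendsto (A := A) (B := B)
    (t := fun β => ((β : ℂ) ^ L)⁻¹ * (S' β - S β)) fun β hβ => by
      have hβc : (β : ℂ) ^ L ≠ 0 := zpow_ne_zero _ (by exact_mod_cast hβ.ne')
      refine (((hS' β hβ).sub (hS β hβ)).const_mul _).congr fun ν => ?_
      rw [hAB ν β hβ, inv_mul_cancel_left₀ hβc]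
  have hlog : ∀ᶠ β : ℝ in 𝓝[>] 0, 0 < β ∧ β ≤ 1 ∧ 1 ≤ |Real.log β| := by
    filter_upwards [Ioc_mem_nhdsGT (Real.exp_pos (-1))] with β hβ
    have h1 : Real.log β ≤ -1 := (Real.log_le_iff_le_exp hβ.1).2 hβ.2
    refine ⟨hβ.1, hβ.2.trans (Real.exp_le_one_iff.2 (by norm_num)), ?_⟩
    rw [abs_of_neg (by linarith)]; linarith
  have h1 : (fun β : ℝ => S' β - S β) =O[𝓝[>] 0] fun β : ℝ => β ^ L * |Real.log β| := by
    refine IsBigO.of_bound (‖a‖ + ‖b‖) ?_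
    filter_upwards [hlog] with β hβ
    obtain ⟨h0, h1, h2⟩ := hβ
    have hβc : (β : ℂ) ^ L ≠ 0 := zpow_ne_zero _ (by exact_mod_cast h0.ne')
    have h3 : S' β - S β = (β : ℂ) ^ L * (a + b * (Real.log β : ℂ)) := by
      rw [← hab β h0, mul_inv_cancel_left₀ hβc]
    have h4 : 0 < β ^ L := zpow_pos h0 L
    rw [h3, norm_mul, norm_zpow, Complex.norm_of_nonneg h0.le, Real.norm_of_nonneg (by positivity)]
    have h5 : ‖a + b * (Real.log β : ℂ)‖ ≤ ‖a‖ * |Real.log β| + ‖b‖ * |Real.log β| := by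
      refine (norm_add_le _ _).trans (add_le_add (le_mul_of_one_le_right (norm_nonneg _) h2) ?_)
      rw [norm_mul, Complex.norm_real, Real.norm_eq_abs]
    calc _ ≤ β ^ L * (‖a‖ * |Real.log β| + ‖b‖ * |Real.log β|) := by gcongr
      _ = _ := by ring
  have h2 : (fun β : ℝ => β ^ (((L + 1 : ℤ) : ℝ) - 1 / 2)) =O[𝓝[>] 0]
      fun β : ℝ => β ^ L * |Real.log β| := by
    refine IsBigO.of_bound 1 ?_
    filter_upwards [hlog] with β hβ
    obtain ⟨h0, h1, h2⟩ := hβ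
    have h4 : 0 < β ^ L := zpow_pos h0 L
    rw [Real.norm_of_nonneg (by positivity), Real.norm_of_nonneg (by positivity), one_mul]
    calc β ^ (((L + 1 : ℤ) : ℝ) - 1 / 2) ≤ β ^ (L : ℝ) :=
          Real.rpow_le_rpow_of_exponent_ge h0 h1 (by push_cast; linarith)
      _ = β ^ L := Real.rpow_intCast _ _
      _ ≤ _ := le_mul_of_one_le_right h4.le h2
  exact ((hO.trans h2).add h1).congr_left fun β => by ring

end HighTemp

end

/-- `Z ν ω` is the generalized zeta function `ζ_+(ν, ω)`, `ζp k ν` and `ζm k ν` are the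
coefficients of its expansions at `ω → +∞` and at `ω → -∞`. Particles are described by `Z ν ω`,
`ω > 0`, and `μ`, antiparticles by `Z ν (-ω)`, `ω > 0`, and `-μ`. -/
theorem mainTheorem1 (d : ℕ) (Z : ℂ → ℝ → ℂ) (ζp ζm : ℕ → ℂ → ℂ) (ωp ωm : ℝ)
    (hωp : 0 < ωp) (hωm : 0 < ωm)
    (hp : ∀ ν : ℂ, ν.re < 1 → HighTemp.Admissible (Z ν) ωp)
    (hm : ∀ ν : ℂ, ν.re < 1 → HighTemp.Admissible (fun ω => Z ν (-ω)) ωm)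
    (μ : ℝ) (hμp : μ < ωp) (hμm : -ωm < μ) :
    -- exact formulas with remainder, at fixed `ν` and `N`
    (∀ (ν : ℂ) (N : ℕ), ν.re < 1 → (∀ j : ℤ, 2 * ν ≠ j) →
      (HighTemp.HasPowerExpansion (Z ν) d ν (fun k => ζp k ν) N →
        HighTemp.SigmaContinues (Z ν) d ν μ N ∧
        ∀ st : HighTemp.Statistics,
          HighTemp.ExactExpansion st (Z ν) d ν (fun k => ζp k ν) μ N) ∧
      (HighTemp.HasPowerExpansion (fun ω => Z ν (-ω)) d ν (fun k => ζm k ν) N →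
        HighTemp.SigmaContinues (fun ω => Z ν (-ω)) d ν (-μ) N ∧
        ∀ st : HighTemp.Statistics,
          HighTemp.ExactExpansion st (fun ω => Z ν (-ω)) d ν (fun k => ζm k ν) (-μ) N)) ∧
    -- complete asymptotic expansions at fixed `ν`
    (∀ ν : ℂ, ν.re < 1 → (∀ j : ℤ, 2 * ν ≠ j) →
      ((∀ N : ℕ, HighTemp.HasPowerExpansion (Z ν) d ν (fun k => ζp k ν) N) →
        ∀ st : HighTemp.Statistics,
          HighTemp.CompleteExpansion st (Z ν) d ν (fun k => ζp k ν) μ) ∧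
      ((∀ N : ℕ, HighTemp.HasPowerExpansion (fun ω => Z ν (-ω)) d ν (fun k => ζm k ν) N) →
        ∀ st : HighTemp.Statistics,
          HighTemp.CompleteExpansion st (fun ω => Z ν (-ω)) d ν (fun k => ζm k ν) (-μ))) ∧
    -- the limit `ν → 0` and the potential itself
    ((∀ φ : ℝ → ℝ, ContDiff ℝ (⊤ : ℕ∞) φ → HasCompactSupport φ →
        ContinuousAt (fun ν : ℂ => ∫ ω : ℝ, (φ ω : ℂ) * Z ν ω) 0) →
      (HighTemp.HasUniformPowerExpansion Z d ζp →
        ∀ st : HighTemp.Statistics, HighTemp.LimitExpansion st Z d ζp μ) ∧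
      (HighTemp.HasUniformPowerExpansion (fun ν ω => Z ν (-ω)) d ζm →
        ∀ st : HighTemp.Statistics,
          HighTemp.LimitExpansion st (fun ν ω => Z ν (-ω)) d ζm (-μ)) ∧
      (HighTemp.HasUniformPowerExpansion Z d ζp →
        HighTemp.HasUniformPowerExpansion (fun ν ω => Z ν (-ω)) d ζm →
        ∀ (st : HighTemp.Statistics) (β : ℝ), 0 < β →
          HighTemp.omegaPotential st (Z 0) β μ =
            -(HighTemp.thermalIntegral st (Z 0) β μ
              + HighTemp.thermalIntegral st (fun ω => Z 0 (-ω)) β (-μ)))) := by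
  have hplus : ∀ c : ℕ → ℂ → ℂ, (∀ φ : ℝ → ℝ, ContDiff ℝ (⊤ : ℕ∞) φ → HasCompactSupport φ →
      ContinuousAt (fun ν : ℂ => ∫ ω : ℝ, (φ ω : ℂ) * Z ν ω) 0) →
      HighTemp.HasUniformPowerExpansion Z d c → HighTemp.RegularFamily Z ωp d c :=
    fun c hc he => ⟨hωp, hp, hc, he⟩
  -- Reflection ω ↦ -ω turns antiparticles into particles with -μ; the continuity hypothesis is
  -- invariant under it because test functions may be reflected.
  have hminus : ∀ c : ℕ → ℂ → ℂ, (∀ φ : ℝ → ℝ, ContDiff ℝ (⊤ : ℕ∞) φ → HasCompactSupport φ →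
      ContinuousAt (fun ν : ℂ => ∫ ω : ℝ, (φ ω : ℂ) * Z ν ω) 0) →
      HighTemp.HasUniformPowerExpansion (fun ν ω => Z ν (-ω)) d c →
      HighTemp.RegularFamily (fun ν ω => Z ν (-ω)) ωm d c := fun c hc he =>
    ⟨hωm, hm, HighTemp.continuousAt_reflect hc, he⟩
  have hμm' : -μ < ωm := by linarith
  refine ⟨fun ν N hν hν' => ⟨fun h => ?_, fun h => ?_⟩, fun ν hν hν' => ⟨fun h st => ?_,
    fun h st => ?_⟩, fun hc => ⟨fun h st => ?_, fun h st => ?_, fun h h' st β hβ => ?_⟩⟩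
  · exact ⟨HighTemp.sigmaContinues_of_expansion (hp ν hν) hωp hμp h,
      HighTemp.exactExpansion (hp ν hν) hωp hμp hν' h⟩
  · exact ⟨HighTemp.sigmaContinues_of_expansion (hm ν hν) hωm hμm' h,
      HighTemp.exactExpansion (hm ν hν) hωm hμm' hν' h⟩
  · exact HighTemp.completeExpansion (hp ν hν) hωp hμp hν' h st
  · exact HighTemp.completeExpansion (hm ν hν) hωm hμm' hν' h st
  · exact HighTemp.limitExpansion (hplus _ hc h) hμp st
  · exact HighTemp.limitExpansion (hminus _ hc h) hμm' st
  · have h1 := (HighTemp.limitExpansion (hplus _ hc h) hμp st).1 β hβ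
    have h2 := (HighTemp.limitExpansion (hminus _ hc h') hμm' st).1 β hβ
    simp only [sub_neg_eq_add] at h2
    simp only [HighTemp.omegaPotential, HighTemp.thermalIntegral, sub_neg_eq_add]
    rw [integral_add h1 h2]
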